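/- **Proposition 3.3.** Let $X$ be a connected, non-compact complex manifold of complex dimension $n$ (Hausdorff and second countable), and let $D=\sum_i D_i\subset X$ be a compact simple normal crossing divisor (possibly empty) with irreducible components $D_i$; let $\beta_i\in(0,1)$ for each $i$. Let $g$ be an ALE conical Kähler metric on $(X,\sum_i(1-\beta_i)D_i)$, that is, a smooth Kähler metric on $X^\circ=X\setminus D$ such that: (i) for every $p\in D$ there are complex coordinates $(z_1,\dots,z_n)$ centred at $p$, an integer $1\le k\le n$ and distinct indices $i_1,\dots,i_k$ such that in the coordinate domain $D=\{z_1\cdots z_k=0\}$ with $D_{i_j}=\{z_j=0\}$ for $1\le j\le k$, and a constant $C>1$ such that on the complement of $D$ in this domain $$C^{-1}g_\beta\le g\le C g_\beta,\qquad g_\beta=\sum_{j=1}^k|z_j|^{2\beta_{i_j}-2}|dz_j|^2+\sum_{j=k+1}^n|dz_j|^2;$$ (ii) there are a compact set $K\subset X$, a finite group $\Gamma\subset U(n)$ acting freely on $\mathbb{C}^n\setminus\{0\}$, a real number $R_0$ and a diffeomorphism $\phi$ from $X\setminus K$ onto $\{|z|>R_0\}/\Gamma\subset\mathbb{C}^n/\Gamma$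 such that $|\phi(x)|\to\infty$ exactly when $x\to\infty$ in $X$ (i.e. when $x$ leaves every compact subset of $X$), and a number $\lambda>0$ such that, $g_0$ denoting the flat metric with its connection $\nabla_0$, $$\big\|\nabla_0^k\big((\phi^{-1})^*g-g_0\big)\big\|_{g_0}=O(|z|^{-\lambda-k})\quad\text{as }|z|\to\infty,\ \text{for every integer }k\ge0.$$ Let $\mu_g$ be the Borel measure $\mu_g(A)=\int_{A\cap X^\circ}dV_g$ on $X$. Then the Riemannian distance of $(X^\circ,g)$ extends to a continuous function $d_g:X\times X\to\mathbb{R}$, and $(X,d_g,\mu_g)$ satisfies a local $(1,2)$-Poincaré inequality: there are $\Lambda>1$ and a function $c:(0,\infty)\to(0,\infty)$ such that for every $R>0$, every $x\in X$, every $0<r\le R$ and every Lipschitz function $f:(X,d_g)\to\mathbb{R}$, writing $B=\{y: d_g(x,y)<r\}$ and $\Lambda B=\{y: d_g(x,y)<\Lambda r\}$, $$\frac1{\mu_g(B)}\int_B|f-f_B|\,d\mu_g\ \le\ c(R)\,r\left(\frac1{\mu_g(\Lambda B)}\int_{\Lambda B}(\mathrm{Lip} f)^2\,d\mu_g\right)^{1/2}.$$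 Here $f_B=\frac1{\mu_g(B)}\int_B f\,d\mu_g$ and $\mathrm{Lip} f(y)=\limsup_{w\to y,\,w\ne y}\frac{|f(w)-f(y)|}{d_g(w,y)}$; the balls have positive finite measure and the integrals are finite. -/

import Mathlib

open Set Filter MeasureTheory Topology
open scoped Manifold ContDiff ENNReal

noncomputable section

/-! ### Complex coordinates and tensors on a complex manifold -/

/-- The coordinate space `ℂⁿ` with its Hermitian norm. -/
abbrev Cn (n : ℕ) : Type := EuclideanSpace ℂ (Fin n)

/-- The flat metric `g₀` of `ℂⁿ`, i.e. `g₀(v, w) = Re ⟨v, w⟩`, as a real bilinear form. -/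
def flatMetric (n : ℕ) : Cn n →L[ℝ] Cn n →L[ℝ] ℝ := innerSL ℝ

/-- A field of real bilinear forms on the tangent spaces of a manifold `X` modelled on `ℂⁿ`.
The real tangent space `TangentSpace 𝓘(ℝ, Cn n) x` is by definition a copy of `Cn n` (the vectors
being read in the preferred chart at `x`). -/
abbrev BilinField (n : ℕ) (X : Type*) : Type _ := X → (Cn n →L[ℝ] Cn n →L[ℝ] ℝ)

section Manifold

variable {n : ℕ} {X : Type*} [TopologicalSpace X] [ChartedSpace (Cn n) X]

/-- The (real) differential at `z` of a map from `ℂⁿ` to the manifold. -/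
def realDifferential (F : Cn n → X) (z : Cn n) : Cn n →L[ℝ] Cn n :=
  mfderiv 𝓘(ℝ, Cn n) 𝓘(ℝ, Cn n) F z

/-- The pull-back `F^* g` at `z`: `(v, w) ↦ g (dF_z v, dF_z w)`. -/
def pullbackMetric (g : BilinField n X) (F : Cn n → X) (z : Cn n) : Cn n →L[ℝ] Cn n →L[ℝ] ℝ :=
  (g (F z)).bilinearComp (realDifferential F z) (realDifferential F z)

/-- `g` is a smooth Kähler metric on the open subset `U` of the complex manifold `X`. In every
holomorphic chart `ψ`, the coordinate expression `G` of `g` is symmetric, positive definite,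
invariant under the complex structure, smooth, and its Kähler form `ω(v, w) = G(iv, w)` is closed:
`dω(u, v, w) = ∂_u ω(v, w) + ∂_v ω(w, u) + ∂_w ω(u, v) = 0` for constant vectors `u, v, w`. -/
structure IsKahlerMetricOn (g : BilinField n X) (U : Set X) : Prop where
  symm : ∀ ψ ∈ IsManifold.maximalAtlas 𝓘(ℂ, Cn n) ω X, ∀ z ∈ ψ.target ∩ ψ.symm ⁻¹' U, ∀ v w,
    pullbackMetric g ψ.symm z v w = pullbackMetric g ψ.symm z w v
  pos : ∀ ψ ∈ IsManifold.maximalAtlas 𝓘(ℂ, Cn n) ω X, ∀ z ∈ ψ.target ∩ ψ.symm ⁻¹' U, ∀ v, v ≠ 0 →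
    0 < pullbackMetric g ψ.symm z v v
  hermitian : ∀ ψ ∈ IsManifold.maximalAtlas 𝓘(ℂ, Cn n) ω X, ∀ z ∈ ψ.target ∩ ψ.symm ⁻¹' U, ∀ v w,
    pullbackMetric g ψ.symm z (Complex.I • v) (Complex.I • w) = pullbackMetric g ψ.symm z v w
  smooth : ∀ ψ ∈ IsManifold.maximalAtlas 𝓘(ℂ, Cn n) ω X,
    ContDiffOn ℝ ∞ (pullbackMetric g ψ.symm) (ψ.target ∩ ψ.symm ⁻¹' U)
  closed : ∀ ψ ∈ IsManifold.maximalAtlas 𝓘(ℂ, Cn n) ω X, ∀ z ∈ ψ.target ∩ ψ.symm ⁻¹' U, ∀ u v w,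
    fderiv ℝ (fun y ↦ pullbackMetric g ψ.symm y (Complex.I • v) w) z u +
      fderiv ℝ (fun y ↦ pullbackMetric g ψ.symm y (Complex.I • w) u) z v +
      fderiv ℝ (fun y ↦ pullbackMetric g ψ.symm y (Complex.I • u) v) z w = 0

/-! ### Simple normal crossing divisors -/

variable {ι : Type*}

/-- `ψ = (z₁, …, zₙ)` are complex coordinates centred at `p` in whose domain the components of
`D = ⋃ Dᵢ` that occur are exactly the `D_{σ j} = {z_j = 0}`, for the first `k` coordinates
(the labels `σ j` being distinct). -/
structure IsAdaptedChart (D : ι → Set X) (p : X) (ψ : OpenPartialHomeomorph X (Cn n))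
    (k : ℕ) (hk : k ≤ n) (σ : Fin k → ι) : Prop where
  mem_atlas : ψ ∈ IsManifold.maximalAtlas 𝓘(ℂ, Cn n) ω X
  mem_source : p ∈ ψ.source
  centred : ψ p = 0
  injective : Function.Injective σ
  mem_iff : ∀ j : Fin k, ∀ x ∈ ψ.source, x ∈ D (σ j) ↔ ψ x (Fin.castLE hk j) = 0
  disjoint : ∀ i, i ∉ range σ → Disjoint (D i) ψ.source

/-- `D = ∑ Dᵢ` is a compact simple normal crossing divisor with irreducible components `Dᵢ`:
each `Dᵢ` is nonempty and connected, and near each point of `D` the components are coordinate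
hyperplanes (in particular they are smooth hypersurfaces which cross normally). -/
structure IsCompactSNCDivisor (n : ℕ) {X : Type*} [TopologicalSpace X] [ChartedSpace (Cn n) X]
    {ι : Type*} (D : ι → Set X) : Prop where
  isCompact : IsCompact (⋃ i, D i)
  isConnected : ∀ i, IsConnected (D i)
  exists_chart : ∀ p ∈ ⋃ i, D i, ∃ (ψ : OpenPartialHomeomorph X (Cn n)) (k : ℕ) (hk : k ≤ n)
    (σ : Fin k → ι), IsAdaptedChart D p ψ k hk σ

/-- The quadratic form `g_b(v, v) = ∑_{j ≤ k} |z_j|^{2 b_j - 2} |v_j|² + ∑_{j > k} |v_j|²` of the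
model cone metric on `ℂⁿ` with cone angles `2π b_j` along `{z_j = 0}`, `1 ≤ j ≤ k`. -/
def modelConeMetric (n k : ℕ) (b : Fin k → ℝ) (z v : Cn n) : ℝ :=
  ∑ j : Fin n, if h : (j : ℕ) < k then ‖z j‖ ^ (2 * b ⟨j, h⟩ - 2) * ‖v j‖ ^ 2 else ‖v j‖ ^ 2

/-! ### ALE conical Kähler metrics -/

/-- `g` is asymptotically locally Euclidean. There are a compact set `K ⊆ X`, a finite group
`Γ ⊂ U(n)` acting freely away from zero, and a diffeomorphism `φ` from `X \ K` onto a neighbourhood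
of infinity `{|z| > R₀} / Γ` of `ℂⁿ / Γ` with respect to which `g` is asymptotic to the flat metric
at the rate `|z|^{-ℓ}` with all derivatives. The diffeomorphism is given through the composition
`Φ = φ⁻¹ ∘ π : {|z| > R₀} → X \ K` with the quotient map `π`: this is a surjective local
diffeomorphism whose fibres are the orbits of `Γ`, and `Φ^* g` is `(φ⁻¹)^* g` read in the
coordinates `z`. The condition `cocompact` says that `|φ(x)| → ∞` precisely when `x → ∞` in `X`. -/
def IsALE (g : BilinField n X) : Prop :=
  ∃ (K : Set X) (Γ : Subgroup (Cn n ≃ₗᵢ[ℂ] Cn n)) (R₀ : ℝ) (Φ : Cn n → X),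
    IsCompact K ∧ Finite Γ ∧ (∀ γ ∈ Γ, γ ≠ 1 → ∀ z, z ≠ 0 → γ z ≠ z) ∧
    IsLocalDiffeomorphOn 𝓘(ℝ, Cn n) 𝓘(ℝ, Cn n) ∞ Φ {z | R₀ < ‖z‖} ∧
    Φ '' {z | R₀ < ‖z‖} = Kᶜ ∧
    (∀ z w, R₀ < ‖z‖ → R₀ < ‖w‖ → (Φ z = Φ w ↔ ∃ γ ∈ Γ, γ z = w)) ∧
    map Φ (Bornology.cobounded (Cn n)) = cocompact X ∧
    ∃ ℓ : ℝ, 0 < ℓ ∧ ∀ k : ℕ,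
      (fun z ↦ iteratedFDeriv ℝ k (fun y ↦ pullbackMetric g Φ y - flatMetric n) z)
        =O[Bornology.cobounded (Cn n)] fun z ↦ ‖z‖ ^ (-ℓ - k)

/-- `g` is an ALE conical Kähler metric on the pair `(X, ∑ (1 - βᵢ) Dᵢ)`. -/
structure IsALEConicalKahlerMetric (D : ι → Set X) (β : ι → ℝ) (g : BilinField n X) : Prop where
  kahler : IsKahlerMetricOn g (⋃ i, D i)ᶜ
  conical : ∀ p ∈ ⋃ i, D i, ∃ (ψ : OpenPartialHomeomorph X (Cn n)) (k : ℕ) (hk : k ≤ n)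
    (σ : Fin k → ι), IsAdaptedChart D p ψ k hk σ ∧ ∃ C : ℝ, 1 < C ∧
      ∀ z ∈ ψ.target, ψ.symm z ∉ ⋃ i, D i → ∀ v : Cn n,
        C⁻¹ * modelConeMetric n k (β ∘ σ) z v ≤ pullbackMetric g ψ.symm z v v ∧
        pullbackMetric g ψ.symm z v v ≤ C * modelConeMetric n k (β ∘ σ) z v
  ale : IsALE g

/-! ### The metric measure space `(X, d_g, μ_g)` -/

/-- The velocity `γ'(t)` of a path in `X`. -/
def pathVelocity (γ : ℝ → X) (t : ℝ) : Cn n :=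
  mfderiv 𝓘(ℝ, ℝ) 𝓘(ℝ, Cn n) γ t (1 : ℝ)

/-- The `g`-length of a path `γ : [0, 1] → X`, the integral of `g(γ', γ')^{1/2}`. -/
def gLength (g : BilinField n X) (γ : ℝ → X) : ℝ≥0∞ :=
  ∫⁻ t in Icc (0 : ℝ) 1, ENNReal.ofReal
    (√(g (γ t) (pathVelocity γ t) (pathVelocity γ t)))

/-- The Riemannian distance of `(U, g)`: the infimum of the lengths of the `C¹` paths in `U`. -/
def riemannianEDistOn (g : BilinField n X) (U : Set X) (x y : X) : ℝ≥0∞ :=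
  ⨅ (γ : ℝ → X) (_ : ContMDiffOn 𝓘(ℝ, ℝ) 𝓘(ℝ, Cn n) 1 γ (Icc 0 1) ∧
    MapsTo γ (Icc 0 1) U ∧ γ 0 = x ∧ γ 1 = y), gLength g γ

/-- The distance `d_g` on `X`: the continuous extension to `X × X` of the Riemannian distance
of `(X \ D, g)`. -/
def conicalDist (g : BilinField n X) (D : Set X) (x y : X) : ℝ :=
  extendFrom (Dᶜ ×ˢ Dᶜ) (fun p : X × X ↦ (riemannianEDistOn g Dᶜ p.1 p.2).toReal) (x, y)

/-- The Riemannian volume density of a bilinear form `G` on `ℂⁿ = ℝ²ⁿ` with respect to Lebesgue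
measure: the square root of the determinant of its matrix in a real orthonormal basis. -/
def volumeDensity (G : Cn n →L[ℝ] Cn n →L[ℝ] ℝ) : ℝ :=
  √(Matrix.det (Matrix.of fun a b ↦
    G (stdOrthonormalBasis ℝ (Cn n) a) (stdOrthonormalBasis ℝ (Cn n) b)))

/-- The Riemannian measure of `(X \ D, g)` in the domain of a chart `ψ` (zero elsewhere). -/
def chartMeasure [MeasurableSpace X] (g : BilinField n X) (D : Set X)
    (ψ : OpenPartialHomeomorph X (Cn n)) : Measure X :=
  Measure.map ψ.symm ((volume.restrict (ψ.target ∩ ψ.symm ⁻¹' Dᶜ)).withDensity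
    fun z ↦ ENNReal.ofReal (volumeDensity (pullbackMetric g ψ.symm z)))

/-- The measure `μ_g(A) = ∫_{A \ D} dV_g` on `X`: the least measure that dominates the Riemannian
measure of `(X \ D, g)` in every holomorphic chart. (The chart measures agree on overlaps, so
that it coincides with each of them on its domain.) -/
def conicalMeasure [MeasurableSpace X] (g : BilinField n X) (D : Set X) : Measure X :=
  ⨆ ψ ∈ IsManifold.maximalAtlas 𝓘(ℂ, Cn n) ω X, chartMeasure g D ψ

end Manifold

/-! ### The local Poincaré inequality -/

section Poincare

variable {X : Type*}

/-- The open ball of a distance function `d`. -/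
def distBall (d : X → X → ℝ) (x : X) (r : ℝ) : Set X := {y | d x y < r}

/-- `f` is Lipschitz with respect to `d`. -/
def IsLipschitzFor (d : X → X → ℝ) (f : X → ℝ) : Prop :=
  ∃ L : ℝ, ∀ x y, |f x - f y| ≤ L * d x y

/-- The local Lipschitz constant `Lip f (x) = limsup_{y → x, y ≠ x} |f y - f x| / d(x, y)`. -/
def localLip (d : X → X → ℝ) (f : X → ℝ) (x : X) : ℝ :=
  limsup (fun y ↦ |f y - f x| / d x y) (comap (d x) (𝓝[>] 0))

/-- The local `(1,2)`-Poincaré inequality, together with the finiteness of the quantities in it. -/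
def LocalPoincare12 [MeasurableSpace X] (d : X → X → ℝ) (μ : Measure X) : Prop :=
  ∃ Λ : ℝ, 1 < Λ ∧ ∃ c : ℝ → ℝ, (∀ R, 0 < R → 0 < c R) ∧
    ∀ R, 0 < R → ∀ (x : X) (r : ℝ), 0 < r → r ≤ R →
      (0 < μ (distBall d x r) ∧ μ (distBall d x (Λ * r)) < ⊤) ∧
      ∀ f : X → ℝ, IsLipschitzFor d f →
        IntegrableOn f (distBall d x r) μ ∧
        IntegrableOn (fun y ↦ localLip d f y ^ 2) (distBall d x (Λ * r)) μ ∧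
        ⨍ y in distBall d x r, |f y - ⨍ z in distBall d x r, f z ∂μ| ∂μ ≤
          c R * r * √(⨍ y in distBall d x (Λ * r), localLip d f y ^ 2 ∂μ)

end Poincare

end

/-!
Around every point of `X` there is a chart of uniform size in which the distance and the measure of
`g` are comparable, with uniform constants, to the Euclidean ones. Off `D` and away from infinity
these are holomorphic charts; near `D` the map `z_j ↦ z_j |z_j| ^ (β_j - 1)` turns the model cone
metric into one comparable with the flat metric; near infinity the ALE condition makes `φ` almost
isometric on balls of fixed radius. Compactness of the remaining region makes the size and the
distortion uniform.

In a convex Euclidean set, integrating an upper gradient along segments gives the `(1,1)`-Poincaré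
inequality, and the charts transport it to all small balls of `X`. It propagates to the balls of
radius at most `R` by enlarging the radius in small steps: since `d_g` is a length distance, an
enlarged ball is covered by boundedly many balls of the previous radius, and the means over
neighbouring balls are compared on their overlap. Finally, Jensen's inequality and the doubling
property at bounded scales give the `(1,2)` form.
-/

noncomputable section

section EuclideanPoincare

variable {E : Type*} [NormedAddCommGroup E]

/-- The extended function `h` bounds the pointwise Lipschitz constant of `u` on `s`. This is the
form of an upper gradient that survives composition with charts; the strict inequality in the
hypothesis leaves no condition at the points where `h` is infinite. -/
def IsLipBoundOn (u : E → ℝ) (h : E → ℝ≥0∞) (s : Set E) : Prop :=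
  ∀ w ∈ s, ∀ c : ℝ, h w < ENNReal.ofReal c → ∀ᶠ w' in 𝓝 w, |u w' - u w| ≤ c * ‖w' - w‖

variable [NormedSpace ℝ E]

lemma segment_point_mem {s : Set E} (hs : Convex ℝ s) {x y : E} (hx : x ∈ s) (hy : y ∈ s)
    {t : ℝ} (ht : t ∈ Icc (0 : ℝ) 1) : (1 - t) • x + t • y ∈ s :=
  hs hx hy (by linarith [ht.2]) ht.1 (by ring)

lemma segment_point_sub (x y : E) (t t' : ℝ) :
    ((1 - t) • x + t • y) - ((1 - t') • x + t' • y) = (t - t') • (y - x) := by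
  module

lemma IsLipBoundOn.enorm_deriv_segment_le {u : E → ℝ} {h : E → ℝ≥0∞} {s : Set E}
    (hu : IsLipBoundOn u h s) {x y : E} (hxy : y ≠ x) {t : ℝ} (ht : (1 - t) • x + t • y ∈ s) :
    ‖deriv (fun t : ℝ ↦ u ((1 - t) • x + t • y)) t‖ₑ ≤
      ‖y - x‖ₑ * h ((1 - t) • x + t • y) := by
  have hN : 0 < ‖y - x‖ := norm_pos_iff.2 (sub_ne_zero.2 hxy)
  set w := (1 - t) • x + t • y with hw
  have deriv_le : ∀ c : ℝ, h w < ENNReal.ofReal c →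
      ‖deriv (fun t : ℝ ↦ u ((1 - t) • x + t • y)) t‖ ≤ c * ‖y - x‖ := by
    intro c hc
    have hc0 : 0 < c := ENNReal.ofReal_pos.1 (bot_le.trans_lt hc)
    refine norm_deriv_le_of_lip' (by positivity) ?_
    have hcont : ContinuousAt (fun t : ℝ ↦ (1 - t) • x + t • y) t := by fun_prop
    filter_upwards [hcont (hu w ht c hc)] with t' ht'
    have hbound : |u ((1 - t') • x + t' • y) - u w| ≤ c * ‖((1 - t') • x + t' • y) - w‖ := ht'
    rw [hw, segment_point_sub, norm_smul] at hbound
    exact hbound.trans_eq (by ring)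
  rcases eq_or_ne (h w) ⊤ with htop | hfin
  · rw [htop, ENNReal.mul_top (by simpa using hN.ne')]
    exact le_top
  · have hle : ‖deriv (fun t : ℝ ↦ u ((1 - t) • x + t • y)) t‖ ≤ (h w).toReal * ‖y - x‖ := by
      rw [← div_le_iff₀ hN]
      refine le_of_forall_gt_imp_ge_of_dense fun c hc ↦ ?_
      rw [div_le_iff₀ hN]
      exact deriv_le c ((ENNReal.lt_ofReal_iff_toReal_lt hfin).2 hc)
    rw [← ofReal_norm, ← ofReal_norm, ← ENNReal.ofReal_toReal hfin,
      ← ENNReal.ofReal_mul (norm_nonneg _), mul_comm]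
    exact ENNReal.ofReal_le_ofReal hle

lemma IsLipBoundOn.enorm_sub_le_lintegral_segment {u : E → ℝ} {h : E → ℝ≥0∞} {s : Set E}
    (hgrad : IsLipBoundOn u h s) (hs : Convex ℝ s) {K : NNReal} (hu : LipschitzOnWith K u s)
    {x y : E} (hx : x ∈ s) (hy : y ∈ s) :
    ‖u y - u x‖ₑ ≤ ‖y - x‖ₑ * ∫⁻ t in Icc (0 : ℝ) 1, h ((1 - t) • x + t • y) := by
  rcases eq_or_ne y x with rfl | hxy
  · simp
  set φ : ℝ → ℝ := fun t ↦ u ((1 - t) • x + t • y) with hφ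
  have hlip : LipschitzOnWith (K * ‖y - x‖₊) φ (uIcc 0 1) := by
    rw [uIcc_of_le zero_le_one]
    refine LipschitzOnWith.of_dist_le_mul fun t ht t' ht' ↦ ?_
    refine (hu.dist_le_mul _ (segment_point_mem hs hx hy ht) _
      (segment_point_mem hs hx hy ht')).trans_eq ?_
    rw [dist_eq_norm, segment_point_sub, norm_smul, dist_eq_norm]
    push_cast
    ring
  have hFTC : u y - u x = ∫ t in Icc (0 : ℝ) 1, deriv φ t := by
    rw [integral_Icc_eq_integral_Ioc, ← intervalIntegral.integral_of_le zero_le_one,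
      hlip.absolutelyContinuousOnInterval.integral_deriv_eq_sub]
    simp [hφ]
  calc ‖u y - u x‖ₑ ≤ ∫⁻ t in Icc (0 : ℝ) 1, ‖deriv φ t‖ₑ := by
        rw [hFTC]
        exact enorm_integral_le_lintegral_enorm _
    _ ≤ ∫⁻ t in Icc (0 : ℝ) 1, ‖y - x‖ₑ * h ((1 - t) • x + t • y) :=
        setLIntegral_mono' measurableSet_Icc fun t ht ↦
          hgrad.enorm_deriv_segment_le hxy (segment_point_mem hs hx hy ht)
    _ = ‖y - x‖ₑ * ∫⁻ t in Icc (0 : ℝ) 1, h ((1 - t) • x + t • y) :=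
        lintegral_const_mul' _ _ enorm_ne_top

variable [FiniteDimensional ℝ E] [MeasurableSpace E] [BorelSpace E]
  (μ : Measure E) [μ.IsAddHaarMeasure]

lemma lintegral_comp_add_smul_le {h : E → ℝ≥0∞} (hh : Measurable h) (v : E) {t : ℝ}
    (ht : 1 / 2 ≤ t) :
    ∫⁻ y, h (v + t • y) ∂μ ≤ 2 ^ Module.finrank ℝ E * ∫⁻ y, h y ∂μ := by
  have ht0 : 0 < t := by linarith
  have hscale : |(t ^ Module.finrank ℝ E)⁻¹| ≤ 2 ^ Module.finrank ℝ E := by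
    rw [abs_of_pos (by positivity), ← inv_pow]
    gcongr
    rw [inv_le_comm₀ ht0 two_pos]
    linarith
  calc ∫⁻ y, h (v + t • y) ∂μ = ∫⁻ y, h (v + y) ∂(Measure.map (fun x ↦ t • x) μ) := by
        rw [lintegral_map (by fun_prop) (by fun_prop)]
    _ = ENNReal.ofReal |(t ^ Module.finrank ℝ E)⁻¹| * ∫⁻ y, h y ∂μ := by
        rw [Measure.map_addHaar_smul μ ht0.ne', lintegral_smul_measure,
          lintegral_add_left_eq_self (μ := μ) h v, smul_eq_mul]
    _ ≤ ENNReal.ofReal (2 ^ Module.finrank ℝ E) * ∫⁻ y, h y ∂μ := by gcongr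
    _ = 2 ^ Module.finrank ℝ E * ∫⁻ y, h y ∂μ := by
        rw [ENNReal.ofReal_pow two_pos.le, ENNReal.ofReal_ofNat]

lemma lintegral_lintegral_segment_point_le {k : E → ℝ≥0∞} (hk : Measurable k) (s : Set E) (t : ℝ) :
    ∫⁻ x in s, ∫⁻ y in s, k ((1 - t) • x + t • y) ∂μ ∂μ ≤
      μ s * (2 ^ Module.finrank ℝ E * ∫⁻ y, k y ∂μ) := by
  have of_half_le : ∀ t : ℝ, 1 / 2 ≤ t →
      ∫⁻ x in s, ∫⁻ y in s, k ((1 - t) • x + t • y) ∂μ ∂μ ≤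
        μ s * (2 ^ Module.finrank ℝ E * ∫⁻ y, k y ∂μ) := by
    intro t ht
    calc ∫⁻ x in s, ∫⁻ y in s, k ((1 - t) • x + t • y) ∂μ ∂μ
        ≤ ∫⁻ x in s, (2 ^ Module.finrank ℝ E * ∫⁻ y, k y ∂μ) ∂μ := lintegral_mono fun x ↦
          (setLIntegral_le_lintegral _ _).trans (lintegral_comp_add_smul_le μ hk _ ht)
      _ = μ s * (2 ^ Module.finrank ℝ E * ∫⁻ y, k y ∂μ) := by rw [setLIntegral_const, mul_comm]
  rcases le_total (1 / 2) t with ht | ht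
  · exact of_half_le t ht
  -- For `t ≤ 1 / 2` exchange the roles of `x` and `y`.
  · rw [lintegral_lintegral_swap]
    · simpa only [sub_sub_cancel, add_comm] using of_half_le (1 - t) (by linarith)
    · exact (hk.comp (by fun_prop :
        Measurable fun p : E × E ↦ (1 - t) • p.1 + t • p.2)).aemeasurable

lemma lintegral_lintegral_lintegral_segment_le {k : E → ℝ≥0∞} (hk : Measurable k) (s : Set E) :
    ∫⁻ x in s, ∫⁻ y in s, ∫⁻ t in Icc (0 : ℝ) 1, k ((1 - t) • x + t • y) ∂volume ∂μ ∂μ ≤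
      μ s * (2 ^ Module.finrank ℝ E * ∫⁻ y, k y ∂μ) := by
  calc ∫⁻ x in s, ∫⁻ y in s, ∫⁻ t in Icc (0 : ℝ) 1, k ((1 - t) • x + t • y) ∂volume ∂μ ∂μ
      = ∫⁻ x in s, ∫⁻ t in Icc (0 : ℝ) 1, ∫⁻ y in s, k ((1 - t) • x + t • y) ∂μ ∂volume ∂μ := by
        refine lintegral_congr fun x ↦ lintegral_lintegral_swap ?_
        exact (hk.comp (by fun_prop :
          Measurable fun p : E × ℝ ↦ (1 - p.2) • x + p.2 • p.1)).aemeasurable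
    _ = ∫⁻ t in Icc (0 : ℝ) 1, ∫⁻ x in s, ∫⁻ y in s, k ((1 - t) • x + t • y) ∂μ ∂μ ∂volume := by
        refine lintegral_lintegral_swap ?_
        have : Measurable fun p : (E × ℝ) × E ↦ k ((1 - p.1.2) • p.1.1 + p.1.2 • p.2) :=
          hk.comp (by fun_prop)
        exact (this.lintegral_prod_right' (ν := μ.restrict s)).aemeasurable
    _ ≤ ∫⁻ _ in Icc (0 : ℝ) 1, μ s * (2 ^ Module.finrank ℝ E * ∫⁻ y, k y ∂μ) :=
        lintegral_mono fun t ↦ lintegral_lintegral_segment_point_le μ hk s t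
    _ = μ s * (2 ^ Module.finrank ℝ E * ∫⁻ y, k y ∂μ) := by simp

lemma IsLipBoundOn.lintegral_lintegral_enorm_sub_le {u : E → ℝ} {h : E → ℝ≥0∞} {s : Set E}
    (hgrad : IsLipBoundOn u h s) (hh : Measurable h) (hs : Convex ℝ s) (hsm : MeasurableSet s)
    {K : NNReal} (hu : LipschitzOnWith K u s) :
    ∫⁻ x in s, ∫⁻ y in s, ‖u y - u x‖ₑ ∂μ ∂μ ≤
      Metric.ediam s * (μ s * (2 ^ Module.finrank ℝ E * ∫⁻ y in s, h y ∂μ)) := by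
  set k : E → ℝ≥0∞ := s.indicator h with hk
  have hkm : Measurable k := hh.indicator hsm
  have hpt : ∀ x ∈ s, ∀ y ∈ s, ‖u y - u x‖ₑ ≤
      Metric.ediam s * ∫⁻ t in Icc (0 : ℝ) 1, k ((1 - t) • x + t • y) := by
    intro x hx y hy
    refine (hgrad.enorm_sub_le_lintegral_segment hs hu hx hy).trans ?_
    have hxy : ‖y - x‖ₑ ≤ Metric.ediam s := by
      rw [← edist_eq_enorm_sub]
      exact Metric.edist_le_ediam_of_mem hy hx
    refine mul_le_mul' hxy (setLIntegral_mono' measurableSet_Icc fun t ht ↦ ?_)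
    rw [hk, indicator_of_mem (segment_point_mem hs hx hy ht)]
  have hkt : ∀ x, Measurable fun y ↦ ∫⁻ t in Icc (0 : ℝ) 1, k ((1 - t) • x + t • y) := fun x ↦
    Measurable.lintegral_prod_right' (f := fun p : E × ℝ ↦ k ((1 - p.2) • x + p.2 • p.1))
      (hkm.comp (by fun_prop))
  have hkt' : Measurable fun x ↦
      ∫⁻ y in s, ∫⁻ t in Icc (0 : ℝ) 1, k ((1 - t) • x + t • y) ∂volume ∂μ := by
    have : Measurable fun p : (E × E) × ℝ ↦ k ((1 - p.2) • p.1.1 + p.2 • p.1.2) :=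
      hkm.comp (by fun_prop)
    exact (this.lintegral_prod_right' (ν := volume.restrict (Icc (0 : ℝ) 1))).lintegral_prod_right'
  calc ∫⁻ x in s, ∫⁻ y in s, ‖u y - u x‖ₑ ∂μ ∂μ
      ≤ ∫⁻ x in s, ∫⁻ y in s, Metric.ediam s *
          ∫⁻ t in Icc (0 : ℝ) 1, k ((1 - t) • x + t • y) ∂volume ∂μ ∂μ :=
        setLIntegral_mono' hsm fun x hx ↦ setLIntegral_mono' hsm fun y hy ↦ hpt x hx y hy
    _ = Metric.ediam s * ∫⁻ x in s, ∫⁻ y in s,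
          ∫⁻ t in Icc (0 : ℝ) 1, k ((1 - t) • x + t • y) ∂volume ∂μ ∂μ := by
        simp_rw [lintegral_const_mul _ (hkt _)]
        exact lintegral_const_mul _ hkt'
    _ ≤ Metric.ediam s * (μ s * (2 ^ Module.finrank ℝ E * ∫⁻ y, k y ∂μ)) := by
        gcongr
        exact lintegral_lintegral_lintegral_segment_le μ hkm s
    _ = Metric.ediam s * (μ s * (2 ^ Module.finrank ℝ E * ∫⁻ y in s, h y ∂μ)) := by
        rw [hk, lintegral_indicator hsm]

theorem IsLipBoundOn.exists_lintegral_enorm_sub_le {u : E → ℝ} {h : E → ℝ≥0∞} {s : Set E}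
    (hgrad : IsLipBoundOn u h s) (hh : Measurable h) (hs : Convex ℝ s) (hsm : MeasurableSet s)
    (hs0 : μ s ≠ 0) (hst : μ s ≠ ⊤) {K : NNReal} (hu : LipschitzOnWith K u s) :
    ∃ a : ℝ, ∫⁻ y in s, ‖u y - a‖ₑ ∂μ ≤
      Metric.ediam s * 2 ^ Module.finrank ℝ E * ∫⁻ y in s, h y ∂μ := by
  have hum : AEMeasurable u (μ.restrict s) := hu.continuousOn.aemeasurable hsm
  have hmean : AEMeasurable (fun x ↦ ∫⁻ y in s, ‖u y - u x‖ₑ ∂μ) (μ.restrict s) := by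
    have : AEMeasurable (fun p : E × E ↦ ‖u p.2 - u p.1‖ₑ)
        ((μ.restrict s).prod (μ.restrict s)) :=
      ((hum.comp_quasiMeasurePreserving Measure.quasiMeasurePreserving_snd).sub
        (hum.comp_quasiMeasurePreserving Measure.quasiMeasurePreserving_fst)).enorm
    exact this.lintegral_prod_right'
  obtain ⟨x, -, hx⟩ := exists_le_setLAverage hs0 hst hmean
  refine ⟨u x, hx.trans ?_⟩
  rw [setLAverage_eq]
  refine ENNReal.div_le_of_le_mul' ?_
  refine (hgrad.lintegral_lintegral_enorm_sub_le μ hh hs hsm hu).trans_eq ?_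
  ring

end EuclideanPoincare

section LocalLip

variable {X : Type*} {d : X → X → ℝ} {f : X → ℝ} {x : X}

lemma localLip_eq_sInf : localLip d f x =
    sInf {a : ℝ | ∀ᶠ y in comap (d x) (𝓝[>] 0), |f y - f x| / d x y ≤ a} := by
  rw [localLip, limsup_eq]

lemma eventually_dist_pos : ∀ᶠ y in comap (d x) (𝓝[>] 0), 0 < d x y :=
  preimage_mem_comap self_mem_nhdsWithin

lemma nonneg_of_eventually_div_le [(comap (d x) (𝓝[>] 0)).NeBot] {a : ℝ}
    (ha : ∀ᶠ y in comap (d x) (𝓝[>] 0), |f y - f x| / d x y ≤ a) : 0 ≤ a := by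
  obtain ⟨y, hpos, hy⟩ := (eventually_dist_pos.and ha).exists
  exact (div_nonneg (abs_nonneg _) hpos.le).trans hy

lemma localLip_nonneg : 0 ≤ localLip d f x := by
  rw [localLip_eq_sInf]
  rcases eq_or_neBot (comap (d x) (𝓝[>] 0)) with h | h
  · simp [h]
  · exact Real.sInf_nonneg fun a ha ↦ nonneg_of_eventually_div_le ha

lemma eventually_div_le {L : ℝ} (hL : ∀ y, |f y - f x| ≤ L * d x y) :
    ∀ᶠ y in comap (d x) (𝓝[>] 0), |f y - f x| / d x y ≤ L := by
  filter_upwards [eventually_dist_pos] with y hy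
  rw [div_le_iff₀ hy]
  exact hL y

lemma localLip_le {L : ℝ} (hL0 : 0 ≤ L) (hL : ∀ y, |f y - f x| ≤ L * d x y) :
    localLip d f x ≤ L := by
  rw [localLip_eq_sInf]
  rcases eq_or_neBot (comap (d x) (𝓝[>] 0)) with h | h
  · simp [h, hL0]
  · exact csInf_le ⟨0, fun a ha ↦ nonneg_of_eventually_div_le ha⟩ (eventually_div_le hL)

lemma localLip_lt_iff {L : ℝ} (hL : ∀ y, |f y - f x| ≤ L * d x y) {c : ℝ} (hc : 0 < c) :
    localLip d f x < c ↔
      ∃ a < c, ∀ᶠ y in comap (d x) (𝓝[>] 0), |f y - f x| / d x y ≤ a := by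
  rw [localLip_eq_sInf]
  rcases eq_or_neBot (comap (d x) (𝓝[>] 0)) with h | h
  · simp only [h, eventually_bot, ofPred_true, Real.sInf_univ, hc, and_true, true_iff]
    exact exists_lt c
  · have hbdd : BddBelow {a : ℝ | ∀ᶠ y in comap (d x) (𝓝[>] 0), |f y - f x| / d x y ≤ a} :=
      ⟨0, fun a ha ↦ nonneg_of_eventually_div_le ha⟩
    rw [csInf_lt_iff hbdd ⟨L, eventually_div_le hL⟩]
    exact exists_congr fun a ↦ and_comm

lemma eventually_comap_dist_iff {p : X → Prop} :
    (∀ᶠ y in comap (d x) (𝓝[>] 0), p y) ↔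
      ∃ k : ℕ, ∀ y, 0 < d x y → d x y < 1 / ((k : ℝ) + 1) → p y := by
  rw [eventually_comap]
  constructor
  · intro h
    obtain ⟨u, hu, hsub⟩ := mem_nhdsGT_iff_exists_Ioo_subset.1 h
    obtain ⟨k, hk⟩ := exists_nat_one_div_lt (show (0 : ℝ) < u from hu)
    exact ⟨k, fun y h0 h1 ↦ hsub ⟨h0, h1.trans hk⟩ y rfl⟩
  · rintro ⟨k, hk⟩
    refine mem_nhdsGT_iff_exists_Ioo_subset.2 ⟨1 / ((k : ℝ) + 1), ?_, ?_⟩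
    · exact mem_Ioi.2 (by positivity)
    · rintro t ⟨h0, h1⟩ y rfl
      exact hk y h0 h1

end LocalLip

section LengthDist

variable {X : Type*}

lemma distBall_mono (d : X → X → ℝ) (x : X) {r t : ℝ} (h : r ≤ t) :
    distBall d x r ⊆ distBall d x t :=
  fun _ hy ↦ lt_of_lt_of_le hy h

variable [TopologicalSpace X]

/-- A length (pseudo-)distance that is continuous for the given topology: two points at distance
less than `a + b` have an intermediate point at distances less than `a` and `b` from them. The
balls of `d` need not be a basis of the topology. -/
structure IsLengthDist (d : X → X → ℝ) : Prop where
  self : ∀ x, d x x = 0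
  symm : ∀ x y, d x y = d y x
  triangle : ∀ x y z, d x z ≤ d x y + d y z
  continuous : Continuous fun p : X × X ↦ d p.1 p.2
  exists_between : ∀ x y a b, 0 < a → 0 < b → d x y < a + b → ∃ z, d x z < a ∧ d z y < b

namespace IsLengthDist

variable {d : X → X → ℝ} (hd : IsLengthDist d)
include hd

lemma nonneg (x y : X) : 0 ≤ d x y := by
  have := hd.triangle x y x
  rw [hd.self, hd.symm y x] at this
  linarith

lemma continuous_left (y : X) : Continuous fun x ↦ d x y :=
  hd.continuous.comp (by fun_prop : Continuous fun x ↦ (x, y))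

lemma continuous_right (x : X) : Continuous (d x) :=
  hd.continuous.comp (by fun_prop : Continuous fun y ↦ (x, y))

lemma isOpen_distBall (x : X) (r : ℝ) : IsOpen (distBall d x r) :=
  isOpen_lt (hd.continuous_right x) continuous_const

lemma distBall_subset {x y : X} {r t : ℝ} (h : d x y + r ≤ t) :
    distBall d y r ⊆ distBall d x t := fun z hz ↦ by
  have : d y z < r := hz
  exact (hd.triangle x y z).trans_lt (by linarith)

lemma exists_lipschitz_const {f : X → ℝ} (hf : IsLipschitzFor d f) :
    ∃ L : ℝ, 0 ≤ L ∧ ∀ x y, |f y - f x| ≤ L * d x y := by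
  obtain ⟨L, hL⟩ := hf
  refine ⟨max L 0, le_max_right _ _, fun x y ↦ ?_⟩
  rw [abs_sub_comm]
  exact (hL x y).trans (mul_le_mul_of_nonneg_right (le_max_left _ _) (hd.nonneg x y))

lemma continuous_of_isLipschitzFor {f : X → ℝ} (hf : IsLipschitzFor d f) : Continuous f := by
  obtain ⟨L, -, hL⟩ := hd.exists_lipschitz_const hf
  refine continuous_iff_continuousAt.2 fun x ↦ ?_
  rw [ContinuousAt, tendsto_iff_dist_tendsto_zero]
  have hcont : Continuous fun y ↦ L * d x y := continuous_const.mul (hd.continuous_right x)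
  have h0 : Tendsto (fun y ↦ L * d x y) (𝓝 x) (𝓝 0) := by
    simpa [hd.self] using hcont.tendsto x
  exact squeeze_zero (fun _ ↦ dist_nonneg) (hL x) h0

lemma measurable_localLip [MeasurableSpace X] [BorelSpace X] {f : X → ℝ}
    (hf : IsLipschitzFor d f) : Measurable (localLip d f) := by
  obtain ⟨L, -, hL⟩ := hd.exists_lipschitz_const hf
  refine measurable_of_Iio fun c ↦ ?_
  rcases le_or_gt c 0 with hc | hc
  · have hempty : localLip d f ⁻¹' Iio c = ∅ :=
      eq_empty_of_forall_notMem fun x hx ↦ hx.not_ge (hc.trans localLip_nonneg)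
    rw [hempty]
    exact MeasurableSet.empty
  have hsublevel : localLip d f ⁻¹' Iio c = ⋃ (q : ℚ) (_ : (q : ℝ) < c) (k : ℕ),
      (⋃ y, {x | 0 < d x y ∧ d x y < 1 / ((k : ℝ) + 1) ∧ q * d x y < |f y - f x|})ᶜ := by
    ext x
    simp only [mem_preimage, mem_Iio, localLip_lt_iff (hL x) hc, mem_iUnion, mem_compl_iff,
      mem_ofPred_eq, not_exists, not_and, not_lt, exists_prop, eventually_comap_dist_iff]
    constructor
    · rintro ⟨a, hac, k, hk⟩
      obtain ⟨q, haq, hqc⟩ := exists_rat_btwn hac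
      exact ⟨q, hqc, k, fun y h0 h1 ↦ ((div_le_iff₀ h0).1 (hk y h0 h1)).trans
        (mul_le_mul_of_nonneg_right haq.le h0.le)⟩
    · rintro ⟨q, hqc, k, hk⟩
      exact ⟨q, hqc, k, fun y h0 h1 ↦ (div_le_iff₀ h0).2 (hk y h0 h1)⟩
  rw [hsublevel]
  refine MeasurableSet.iUnion fun q ↦ MeasurableSet.iUnion fun _ ↦ MeasurableSet.iUnion fun k ↦ ?_
  have hdc (y : X) := hd.continuous_left y
  refine (isOpen_iUnion fun y ↦ ?_).measurableSet.compl
  exact (isOpen_lt continuous_const (hdc y)).inter ((isOpen_lt (hdc y) continuous_const).inter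
    (isOpen_lt (continuous_const.mul (hdc y))
      (continuous_const.sub (hd.continuous_of_isLipschitzFor hf)).abs))

end IsLengthDist

end LengthDist

section UniformChart

lemma aemeasurable_symm_restrict_target {X Y : Type*} [TopologicalSpace X] [MeasurableSpace X]
    [BorelSpace X] [TopologicalSpace Y] [MeasurableSpace Y] [OpensMeasurableSpace Y]
    (Ψ : OpenPartialHomeomorph X Y) (ν : Measure Y) : AEMeasurable Ψ.symm (ν.restrict Ψ.target) :=
  Ψ.continuousOn_symm.aemeasurable Ψ.open_target.measurableSet

variable {X : Type*} [TopologicalSpace X] [MeasurableSpace X]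
  {E : Type*} [NormedAddCommGroup E] [MeasurableSpace E]

/-- `Ψ` identifies a neighbourhood of `x` in `(X, d, μ)`, containing the ball of radius `ρ / L`,
with a piece of `E` containing the ball of radius `ρ`, up to a factor `L` for the distances and
a factor `C` for the measures. -/
structure IsUniformChart (d : X → X → ℝ) (μ : Measure X) (ν : Measure E) (L ρ : ℝ) (C : ℝ≥0∞)
    (x : X) (Ψ : OpenPartialHomeomorph X E) : Prop where
  mem_source : x ∈ Ψ.source
  ball_subset : Metric.ball (Ψ x) ρ ⊆ Ψ.target
  dist_le : ∀ w ∈ Metric.ball (Ψ x) ρ, ∀ w' ∈ Metric.ball (Ψ x) ρ,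
    d (Ψ.symm w) (Ψ.symm w') ≤ L * ‖w - w'‖
  le_dist : ∀ y, d x y < ρ / L → y ∈ Ψ.source ∧ ‖Ψ y - Ψ x‖ ≤ L * d x y
  measure_le : μ.restrict Ψ.source ≤ C • (ν.restrict Ψ.target).map Ψ.symm
  le_measure : (ν.restrict Ψ.target).map Ψ.symm ≤ C • μ

namespace IsUniformChart

variable {d : X → X → ℝ} {μ : Measure X} {ν : Measure E} {L ρ : ℝ} {C : ℝ≥0∞} {x : X}
  {Ψ : OpenPartialHomeomorph X E} (hΨ : IsUniformChart d μ ν L ρ C x Ψ) (hL : 1 ≤ L)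

section Points

include hΨ hL

lemma symm_mem_distBall {t : ℝ} (ht : t ≤ ρ) {w : E} (hw : w ∈ Metric.ball (Ψ x) t) :
    Ψ.symm w ∈ distBall d x (L * t) := by
  have hw' := mem_ball_iff_norm'.1 hw
  have ht0 : 0 < t := (norm_nonneg _).trans_lt hw'
  have h := hΨ.dist_le (Ψ x) (Metric.mem_ball_self (ht0.trans_le ht)) w
    (Metric.ball_subset_ball ht hw)
  rw [Ψ.left_inv hΨ.mem_source] at h
  exact h.trans_lt (mul_lt_mul_of_pos_left hw' (by linarith))

lemma mem_source_and_apply_mem_ball {r : ℝ} (hr : L * r ≤ ρ) {y : X} (hy : y ∈ distBall d x r) :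
    y ∈ Ψ.source ∧ Ψ y ∈ Metric.ball (Ψ x) (L * r) := by
  have hL0 : 0 < L := by linarith
  have hy' : d x y < r := hy
  obtain ⟨h1, h2⟩ := hΨ.le_dist y (hy'.trans_le ((le_div_iff₀' hL0).2 hr))
  exact ⟨h1, mem_ball_iff_norm.2 (h2.trans_lt (mul_lt_mul_of_pos_left hy' hL0))⟩

end Points

variable (hd : IsLengthDist d)

section LipBound

include hΨ hd

lemma lipschitzOnWith_comp_symm {f : X → ℝ} {K : ℝ} (hK0 : 0 ≤ K)
    (hK : ∀ y z, |f z - f y| ≤ K * d y z) :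
    LipschitzOnWith (Real.toNNReal (K * L)) (f ∘ Ψ.symm) (Metric.ball (Ψ x) ρ) := by
  refine LipschitzOnWith.of_dist_le' fun w hw w' hw' ↦ ?_
  rw [Real.dist_eq, dist_eq_norm, mul_assoc]
  refine (hK (Ψ.symm w') (Ψ.symm w)).trans (mul_le_mul_of_nonneg_left ?_ hK0)
  rw [hd.symm]
  exact hΨ.dist_le w hw w' hw'

lemma isLipBoundOn (hL : 1 ≤ L) {f : X → ℝ} (hf : IsLipschitzFor d f) :
    IsLipBoundOn (f ∘ Ψ.symm) (fun w ↦ ENNReal.ofReal (L * localLip d f (Ψ.symm w)))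
      (Metric.ball (Ψ x) ρ) := by
  intro w hw c hc
  have hL0 : 0 < L := by linarith
  have hc0 : 0 < c := ENNReal.ofReal_pos.1 (bot_le.trans_lt hc)
  obtain ⟨K, -, hK⟩ := hd.exists_lipschitz_const hf
  rw [ENNReal.ofReal_lt_ofReal_iff hc0, ← lt_div_iff₀' hL0,
    localLip_lt_iff (hK (Ψ.symm w)) (by positivity)] at hc
  obtain ⟨a, hac, ha⟩ := hc
  obtain ⟨k, hk⟩ := eventually_comap_dist_iff.1 ha
  have hδ : 0 < 1 / ((k : ℝ) + 1) / L := by positivity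
  filter_upwards [Metric.isOpen_ball.mem_nhds hw, Metric.ball_mem_nhds w hδ] with w' hw' hww'
  have hle := hΨ.dist_le w hw w' hw'
  rw [norm_sub_rev] at hle
  rw [mem_ball_iff_norm, lt_div_iff₀' hL0] at hww'
  rcases (hd.nonneg (Ψ.symm w) (Ψ.symm w')).eq_or_lt with h0 | h0
  · have := hK (Ψ.symm w) (Ψ.symm w')
    rw [← h0, mul_zero] at this
    exact this.trans (by positivity)
  · have := hk _ h0 (hle.trans_lt hww')
    rw [div_le_iff₀ h0] at this
    calc |(f ∘ Ψ.symm) w' - (f ∘ Ψ.symm) w| ≤ a * d (Ψ.symm w) (Ψ.symm w') := this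
      _ ≤ c / L * d (Ψ.symm w) (Ψ.symm w') := by gcongr
      _ ≤ c / L * (L * ‖w' - w‖) := by gcongr
      _ = c * ‖w' - w‖ := by field_simp

end LipBound

section Integrals

variable [BorelSpace X] [BorelSpace E]

include hΨ hd hL

lemma setLIntegral_distBall_le {r : ℝ} (hr : L * r ≤ ρ) {k : X → ℝ≥0∞} (hk : Measurable k) :
    ∫⁻ y in distBall d x r, k y ∂μ ≤ C * ∫⁻ w in Metric.ball (Ψ x) (L * r), k (Ψ.symm w) ∂ν := by
  have hBm : MeasurableSet (distBall d x r) := (hd.isOpen_distBall x r).measurableSet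
  have hsub : distBall d x r ⊆ Ψ.source :=
    fun y hy ↦ (hΨ.mem_source_and_apply_mem_ball hL hr hy).1
  calc ∫⁻ y in distBall d x r, k y ∂μ
      = ∫⁻ y, (distBall d x r).indicator k y ∂(μ.restrict Ψ.source) := by
        rw [lintegral_indicator hBm, Measure.restrict_restrict hBm, inter_eq_left.2 hsub]
    _ ≤ ∫⁻ y, (distBall d x r).indicator k y ∂(C • (ν.restrict Ψ.target).map Ψ.symm) :=
        lintegral_mono' hΨ.measure_le le_rfl
    _ = C * ∫⁻ w in Ψ.target, (distBall d x r).indicator k (Ψ.symm w) ∂ν := by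
        rw [lintegral_smul_measure, smul_eq_mul, lintegral_map' (hk.indicator hBm).aemeasurable
          (aemeasurable_symm_restrict_target Ψ ν)]
    _ ≤ C * ∫⁻ w, (Metric.ball (Ψ x) (L * r)).indicator (fun w ↦ k (Ψ.symm w)) w ∂ν := by
        gcongr C * ?_
        refine (setLIntegral_mono' Ψ.open_target.measurableSet fun w hw ↦ ?_).trans
          (setLIntegral_le_lintegral _ _)
        by_cases h : Ψ.symm w ∈ distBall d x r
        · have := (hΨ.mem_source_and_apply_mem_ball hL hr h).2
          rw [Ψ.right_inv hw] at this
          rw [indicator_of_mem h, indicator_of_mem this]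
        · rw [indicator_of_notMem h]
          exact zero_le
    _ = C * ∫⁻ w in Metric.ball (Ψ x) (L * r), k (Ψ.symm w) ∂ν := by
        rw [lintegral_indicator Metric.isOpen_ball.measurableSet]

lemma setLIntegral_ball_le {t : ℝ} (ht : t ≤ ρ) {k : X → ℝ≥0∞} (hk : Measurable k) :
    ∫⁻ w in Metric.ball (Ψ x) t, k (Ψ.symm w) ∂ν ≤ C * ∫⁻ y in distBall d x (L * t), k y ∂μ := by
  have hBm : MeasurableSet (distBall d x (L * t)) := (hd.isOpen_distBall x _).measurableSet
  have hsub : Metric.ball (Ψ x) t ⊆ Ψ.target :=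
    (Metric.ball_subset_ball ht).trans hΨ.ball_subset
  calc ∫⁻ w in Metric.ball (Ψ x) t, k (Ψ.symm w) ∂ν
      ≤ ∫⁻ w in Metric.ball (Ψ x) t, (distBall d x (L * t)).indicator k (Ψ.symm w) ∂ν := by
        refine setLIntegral_mono' Metric.isOpen_ball.measurableSet fun w hw ↦ ?_
        rw [indicator_of_mem (hΨ.symm_mem_distBall hL ht hw)]
    _ ≤ ∫⁻ w in Ψ.target, (distBall d x (L * t)).indicator k (Ψ.symm w) ∂ν :=
        lintegral_mono_set hsub
    _ = ∫⁻ y, (distBall d x (L * t)).indicator k y ∂((ν.restrict Ψ.target).map Ψ.symm) := by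
        rw [lintegral_map' (hk.indicator hBm).aemeasurable (aemeasurable_symm_restrict_target Ψ ν)]
    _ ≤ ∫⁻ y, (distBall d x (L * t)).indicator k y ∂(C • μ) := lintegral_mono' hΨ.le_measure le_rfl
    _ = C * ∫⁻ y in distBall d x (L * t), k y ∂μ := by
        rw [lintegral_smul_measure, smul_eq_mul, lintegral_indicator hBm]

variable [NormedSpace ℝ E] [FiniteDimensional ℝ E] [ν.IsAddHaarMeasure]

omit [NormedSpace ℝ E] [FiniteDimensional ℝ E] in
lemma measure_distBall_le {r : ℝ} (hr : L * r ≤ ρ) :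
    μ (distBall d x r) ≤ C * ν (Metric.ball 0 (L * r)) := by
  have := hΨ.setLIntegral_distBall_le hL hd hr (k := fun _ ↦ 1) measurable_const
  simpa [Measure.addHaar_ball_center] using this

omit [NormedSpace ℝ E] [FiniteDimensional ℝ E] in
lemma measure_ball_le {t : ℝ} (ht : t ≤ ρ) :
    ν (Metric.ball 0 t) ≤ C * μ (distBall d x (L * t)) := by
  have := hΨ.setLIntegral_ball_le hL hd ht (k := fun _ ↦ 1) measurable_const
  simpa [Measure.addHaar_ball_center] using this

lemma exists_lintegral_ball_enorm_comp_symm_sub_le {t : ℝ} (ht0 : 0 < t) (ht : t ≤ ρ) {f : X → ℝ}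
    (hf : IsLipschitzFor d f) :
    ∃ a : ℝ, ∫⁻ w in Metric.ball (Ψ x) t, ‖f (Ψ.symm w) - a‖ₑ ∂ν ≤
      ENNReal.ofReal (2 * t) * 2 ^ Module.finrank ℝ E *
        ∫⁻ w in Metric.ball (Ψ x) t, ENNReal.ofReal (L * localLip d f (Ψ.symm w)) ∂ν := by
  classical
  have hsub : Metric.ball (Ψ x) t ⊆ Metric.ball (Ψ x) ρ := Metric.ball_subset_ball ht
  -- `Ψ.symm` is continuous on the target only; `σ` is a measurable extension.
  let σ : E → X := Ψ.target.piecewise Ψ.symm fun _ ↦ x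
  have hσ : Measurable σ := Ψ.continuousOn_symm.measurable_piecewise continuousOn_const
    Ψ.open_target.measurableSet
  have hσ_eq : ∀ w ∈ Metric.ball (Ψ x) t, σ w = Ψ.symm w := fun w hw ↦
    piecewise_eq_of_mem _ _ _ (hΨ.ball_subset (hsub hw))
  have hgrad : IsLipBoundOn (f ∘ Ψ.symm) (fun w ↦ ENNReal.ofReal (L * localLip d f (σ w)))
      (Metric.ball (Ψ x) t) := by
    intro w hw c hc
    simp only [hσ_eq w hw] at hc
    exact hΨ.isLipBoundOn hd hL hf w (hsub hw) c hc
  obtain ⟨K, hK0, hK⟩ := hd.exists_lipschitz_const hf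
  obtain ⟨a, ha⟩ := hgrad.exists_lintegral_enorm_sub_le ν
    (measurable_const.mul ((hd.measurable_localLip hf).comp hσ)).ennreal_ofReal
    (convex_ball _ _) Metric.isOpen_ball.measurableSet (Metric.measure_ball_pos ν _ ht0).ne'
    measure_ball_lt_top.ne ((hΨ.lipschitzOnWith_comp_symm hd hK0 hK).mono hsub)
  refine ⟨a, ha.trans (mul_le_mul' (mul_le_mul' ?_ le_rfl) (le_of_eq ?_))⟩
  · rw [ENNReal.ofReal_mul two_pos.le, ENNReal.ofReal_ofNat, ← Metric.eball_ofReal]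
    exact Metric.ediam_eball_le
  · refine setLIntegral_congr_fun Metric.isOpen_ball.measurableSet fun w hw ↦ ?_
    simp only [hσ_eq w hw]

lemma exists_lintegral_enorm_sub_le {r : ℝ} (hr0 : 0 < r) (hr : L * r ≤ ρ) {f : X → ℝ}
    (hf : IsLipschitzFor d f) :
    ∃ a : ℝ, ∫⁻ y in distBall d x r, ‖f y - a‖ₑ ∂μ ≤
      (C * C * ENNReal.ofReal (2 * L * L) * 2 ^ Module.finrank ℝ E) * ENNReal.ofReal r *
        ∫⁻ y in distBall d x (L * L * r), ENNReal.ofReal (localLip d f y) ∂μ := by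
  have hL0 : 0 < L := by linarith
  obtain ⟨a, ha⟩ := hΨ.exists_lintegral_ball_enorm_comp_symm_sub_le hL hd (mul_pos hL0 hr0) hr hf
  refine ⟨a, ?_⟩
  have hfm : Measurable f := (hd.continuous_of_isLipschitzFor hf).measurable
  calc ∫⁻ y in distBall d x r, ‖f y - a‖ₑ ∂μ
      ≤ C * ∫⁻ w in Metric.ball (Ψ x) (L * r), ‖f (Ψ.symm w) - a‖ₑ ∂ν :=
        hΨ.setLIntegral_distBall_le hL hd hr (hfm.sub measurable_const).enorm
    _ ≤ C * (ENNReal.ofReal (2 * (L * r)) * 2 ^ Module.finrank ℝ E * (C *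
          ∫⁻ y in distBall d x (L * (L * r)), ENNReal.ofReal (L * localLip d f y) ∂μ)) := by
        gcongr
        exact ha.trans (mul_le_mul' le_rfl (hΨ.setLIntegral_ball_le hL hd hr
          (measurable_const.mul (hd.measurable_localLip hf)).ennreal_ofReal))
    _ = _ := by
        simp_rw [ENNReal.ofReal_mul hL0.le, ENNReal.ofReal_mul two_pos.le,
          ENNReal.ofReal_mul (mul_pos two_pos hL0).le, ENNReal.ofReal_mul hL0.le,
          ENNReal.ofReal_mul two_pos.le, lintegral_const_mul' _ _ ENNReal.ofReal_ne_top,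
          ← mul_assoc L L r]
        ring

end Integrals

end IsUniformChart

end UniformChart

section Oscillation

variable {α : Type*} [MeasurableSpace α] {μ : Measure α}

lemma setLIntegral_biUnion_finset_le {κ : Type*} (μ : Measure α) (V : Finset κ) (s : κ → Set α)
    (f : α → ℝ≥0∞) : ∫⁻ y in ⋃ v ∈ V, s v, f y ∂μ ≤ ∑ v ∈ V, ∫⁻ y in s v, f y ∂μ := by
  classical
  induction V using Finset.induction_on with
  | empty => simp
  | insert v V hv ih =>
    rw [Finset.set_biUnion_insert, Finset.sum_insert hv]
    exact (lintegral_union_le _ _ _).trans (add_le_add le_rfl ih)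

variable {f : α → ℝ}

lemma setLIntegral_enorm_sub_le_add (f : α → ℝ) (s : Set α) (a b : ℝ) :
    ∫⁻ y in s, ‖f y - b‖ₑ ∂μ ≤ ∫⁻ y in s, ‖f y - a‖ₑ ∂μ + ‖a - b‖ₑ * μ s := by
  rw [← setLIntegral_const, ← lintegral_add_right _ measurable_const]
  refine lintegral_mono fun y ↦ ?_
  rw [← sub_add_sub_cancel (f y) a b]
  exact enorm_add_le _ _

lemma enorm_sub_le_div_of_setLIntegral_le (hf : Measurable f) {s : Set α} {a b : ℝ}
    {m I J : ℝ≥0∞} (hm0 : m ≠ 0) (hmt : m ≠ ⊤) (hm : m ≤ μ s)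
    (ha : ∫⁻ y in s, ‖f y - a‖ₑ ∂μ ≤ I) (hb : ∫⁻ y in s, ‖f y - b‖ₑ ∂μ ≤ J) :
    ‖a - b‖ₑ ≤ (I + J) / m := by
  rw [ENNReal.le_div_iff_mul_le (Or.inl hm0) (Or.inl hmt)]
  calc ‖a - b‖ₑ * m ≤ ‖a - b‖ₑ * μ s := by gcongr
    _ = ∫⁻ _ in s, ‖a - b‖ₑ ∂μ := (setLIntegral_const _ _).symm
    _ ≤ ∫⁻ y in s, (‖f y - a‖ₑ + ‖f y - b‖ₑ) ∂μ := by
        refine lintegral_mono fun y ↦ ?_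
        rw [← sub_sub_sub_cancel_left b a (f y), add_comm]
        exact enorm_sub_le
    _ = ∫⁻ y in s, ‖f y - a‖ₑ ∂μ + ∫⁻ y in s, ‖f y - b‖ₑ ∂μ :=
        lintegral_add_left (hf.sub measurable_const).enorm _
    _ ≤ I + J := add_le_add ha hb

lemma setAverage_abs_sub_setAverage_le {s : Set α} (hs0 : μ s ≠ 0) (hst : μ s ≠ ⊤)
    (hf : IntegrableOn f s μ) (a : ℝ) :
    ⨍ y in s, |f y - ⨍ z in s, f z ∂μ| ∂μ ≤ 2 * ⨍ y in s, |f y - a| ∂μ := by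
  have : IsFiniteMeasure (μ.restrict s) := ⟨by simpa using hst.lt_top⟩
  have hs : 0 < μ.real s := ENNReal.toReal_pos hs0 hst
  have hfa : IntegrableOn (fun y ↦ f y - a) s μ := hf.sub (integrable_const a)
  have hmean : |a - ⨍ z in s, f z ∂μ| ≤ ⨍ y in s, |f y - a| ∂μ := by
    have : a - ⨍ z in s, f z ∂μ = - ⨍ z in s, (f z - a) ∂μ := by
      rw [setAverage_eq, setAverage_eq, integral_sub hf (integrable_const a), setIntegral_const]
      simp only [smul_eq_mul]
      field_simp
      ring
    rw [this, abs_neg, setAverage_eq, setAverage_eq, smul_eq_mul, smul_eq_mul, abs_mul,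
      abs_of_nonneg (by positivity)]
    gcongr
    exact abs_integral_le_integral_abs
  have hle (c : ℝ) : ⨍ y in s, |f y - c| ∂μ ≤ ⨍ y in s, (|f y - a| + |a - c|) ∂μ := by
    rw [setAverage_eq, setAverage_eq, smul_eq_mul, smul_eq_mul]
    exact mul_le_mul_of_nonneg_left (integral_mono (hf.sub (integrable_const _)).abs
      (hfa.abs.add (integrable_const _)) fun y ↦ abs_sub_le _ _ _) (inv_nonneg.2 hs.le)
  calc ⨍ y in s, |f y - ⨍ z in s, f z ∂μ| ∂μ
      ≤ ⨍ y in s, (|f y - a| + |a - ⨍ z in s, f z ∂μ|) ∂μ := hle _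
    _ = ⨍ y in s, |f y - a| ∂μ + |a - ⨍ z in s, f z ∂μ| := by
        rw [setAverage_eq, integral_add hfa.abs (integrable_const _), setIntegral_const, smul_add,
          ← setAverage_eq, smul_smul, inv_mul_cancel₀ hs.ne', one_smul]
    _ ≤ 2 * ⨍ y in s, |f y - a| ∂μ := by linarith

lemma setAverage_le_sqrt_setAverage_sq {s : Set α} (hs0 : μ s ≠ 0) (hst : μ s ≠ ⊤)
    (hf : IntegrableOn f s μ) (hf2 : IntegrableOn (fun y ↦ f y ^ 2) s μ) :
    ⨍ y in s, f y ∂μ ≤ √(⨍ y in s, f y ^ 2 ∂μ) :=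
  Real.le_sqrt_of_sq_le <| (even_two.convexOn_pow (𝕜 := ℝ)).map_set_average_le
    (continuous_pow 2).continuousOn isClosed_univ hs0 hst (ae_of_all _ fun _ ↦ mem_univ _) hf hf2

lemma setIntegral_abs_sub_le_of_lintegral_le {g : α → ℝ} {s t : Set α} {a : ℝ} {A : ℝ≥0∞}
    (hf : AEStronglyMeasurable f (μ.restrict s)) (hg0 : 0 ≤ g) (hg : IntegrableOn g t μ)
    (hA : A ≠ ⊤)
    (h : ∫⁻ y in s, ‖f y - a‖ₑ ∂μ ≤ A * ∫⁻ y in t, ENNReal.ofReal (g y) ∂μ) :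
    ∫ y in s, |f y - a| ∂μ ≤ A.toReal * ∫ y in t, g y ∂μ := by
  simp only [← Real.norm_eq_abs]
  rw [integral_norm_eq_lintegral_enorm (f := fun y ↦ f y - a) (hf.sub aestronglyMeasurable_const),
    integral_eq_lintegral_of_nonneg_ae (ae_of_all _ hg0) hg.aestronglyMeasurable,
    ← ENNReal.toReal_mul]
  exact ENNReal.toReal_mono (ENNReal.mul_ne_top hA hg.lintegral_lt_top.ne) h

lemma setAverage_abs_sub_setAverage_le_mul_sqrt {g : α → ℝ} {s t : Set α} {a : ℝ} {A D : ℝ≥0∞}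
    (hs0 : μ s ≠ 0) (hst : s ⊆ t) (ht : μ t ≠ ⊤) (hf : IntegrableOn f s μ) (hg0 : 0 ≤ g)
    (hg : IntegrableOn g t μ) (hg2 : IntegrableOn (fun y ↦ g y ^ 2) t μ) (hA : A ≠ ⊤) (hD : D ≠ ⊤)
    (hts : μ t ≤ D * μ s)
    (h : ∫⁻ y in s, ‖f y - a‖ₑ ∂μ ≤ A * ∫⁻ y in t, ENNReal.ofReal (g y) ∂μ) :
    ⨍ y in s, |f y - ⨍ z in s, f z ∂μ| ∂μ ≤
      2 * (A.toReal * D.toReal) * √(⨍ y in t, g y ^ 2 ∂μ) := by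
  have hs : μ s ≠ ⊤ := ne_top_of_le_ne_top ht (measure_mono hst)
  have ht0 : μ t ≠ 0 := fun h0 ↦ hs0 (measure_mono_null hst h0)
  have hs' : 0 < μ.real s := ENNReal.toReal_pos hs0 hs
  have ht' : 0 < μ.real t := ENNReal.toReal_pos ht0 ht
  have hts' : μ.real t ≤ D.toReal * μ.real s := by
    rw [measureReal_def, measureReal_def, ← ENNReal.toReal_mul]
    exact ENNReal.toReal_mono (ENNReal.mul_ne_top hD hs) hts
  set q := √(⨍ y in t, g y ^ 2 ∂μ)
  have hq : ∫ y in t, g y ∂μ ≤ μ.real t * q := by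
    rw [← inv_mul_le_iff₀ ht', ← smul_eq_mul, ← setAverage_eq]
    exact setAverage_le_sqrt_setAverage_sq ht0 ht hg hg2
  have hosc : ∫ y in s, |f y - a| ∂μ ≤ μ.real s * (A.toReal * D.toReal * q) :=
    calc ∫ y in s, |f y - a| ∂μ ≤ A.toReal * ∫ y in t, g y ∂μ :=
          setIntegral_abs_sub_le_of_lintegral_le hf.aestronglyMeasurable hg0 hg hA h
      _ ≤ A.toReal * (D.toReal * μ.real s * q) := by
          gcongr
          exact hq.trans (mul_le_mul_of_nonneg_right hts' (Real.sqrt_nonneg _))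
      _ = μ.real s * (A.toReal * D.toReal * q) := by ring
  calc ⨍ y in s, |f y - ⨍ z in s, f z ∂μ| ∂μ ≤ 2 * ⨍ y in s, |f y - a| ∂μ :=
        setAverage_abs_sub_setAverage_le hs0 hs hf a
    _ ≤ 2 * (A.toReal * D.toReal * q) := by
        rw [setAverage_eq, smul_eq_mul]
        exact mul_le_mul_of_nonneg_left ((inv_mul_le_iff₀ hs').2 hosc) zero_le_two
    _ = 2 * (A.toReal * D.toReal) * q := by ring

end Oscillation

section LengthDist

variable {X : Type*} [TopologicalSpace X] [MeasurableSpace X] {d : X → X → ℝ} {μ : Measure X}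
  {f : X → ℝ}

namespace IsLengthDist

variable (hd : IsLengthDist d)
include hd

lemma enorm_sub_le_of_lintegral_le (hf : Measurable f) {a : X → ℝ} {G : X → ℝ≥0∞} {x v : X}
    {s τ σ T : ℝ} {m A : ℝ≥0∞} (hm0 : m ≠ 0) (hmt : m ≠ ⊤) (hm : m ≤ μ (distBall d v s))
    (hs : d x v + s ≤ τ) (hT : d x v + σ ≤ T)
    (hv : ∫⁻ y in distBall d v τ, ‖f y - a v‖ₑ ∂μ ≤ A * ∫⁻ y in distBall d v σ, G y ∂μ)
    (hx : ∫⁻ y in distBall d x τ, ‖f y - a x‖ₑ ∂μ ≤ A * ∫⁻ y in distBall d x σ, G y ∂μ) :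
    ‖a v - a x‖ₑ ≤ 2 * A / m * ∫⁻ y in distBall d x T, G y ∂μ := by
  set I := ∫⁻ y in distBall d x T, G y ∂μ
  have hxv := hd.nonneg x v
  have hv' : ∫⁻ y in distBall d v s, ‖f y - a v‖ₑ ∂μ ≤ A * I :=
    (lintegral_mono_set (distBall_mono d v (by linarith))).trans
      (hv.trans (mul_le_mul' le_rfl (lintegral_mono_set (hd.distBall_subset hT))))
  have hx' : ∫⁻ y in distBall d v s, ‖f y - a x‖ₑ ∂μ ≤ A * I :=
    (lintegral_mono_set (hd.distBall_subset hs)).trans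
      (hx.trans (mul_le_mul' le_rfl (lintegral_mono_set (distBall_mono d x (by linarith)))))
  calc ‖a v - a x‖ₑ ≤ (A * I + A * I) / m :=
        enorm_sub_le_div_of_setLIntegral_le hf hm0 hmt hm hv' hx'
    _ = 2 * A / m * I := by rw [← two_mul, ← mul_assoc, ENNReal.mul_div_right_comm]

variable [BorelSpace X]

lemma integrableOn_distBall (hf : IsLipschitzFor d f) {x : X} {r : ℝ}
    (hr : μ (distBall d x r) ≠ ⊤) : IntegrableOn f (distBall d x r) μ := by
  obtain ⟨L, hL0, hL⟩ := hd.exists_lipschitz_const hf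
  refine Measure.integrableOn_of_bounded hr
    (hd.continuous_of_isLipschitzFor hf).aestronglyMeasurable (M := |f x| + L * r)
    ((ae_restrict_iff' (hd.isOpen_distBall x r).measurableSet).2 (ae_of_all _ fun y hy ↦ ?_))
  calc |f y| ≤ |f x| + |f y - f x| := by linarith [abs_sub_abs_le_abs_sub (f y) (f x)]
    _ ≤ |f x| + L * r := by
        have hy' : d x y ≤ r := le_of_lt hy
        gcongr
        exact (hL x y).trans (by gcongr)

lemma integrableOn_localLip_pow (hf : IsLipschitzFor d f) {s : Set X} (hs : μ s ≠ ⊤) (p : ℕ) :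
    IntegrableOn (fun y ↦ localLip d f y ^ p) s μ := by
  obtain ⟨L, hL0, hL⟩ := hd.exists_lipschitz_const hf
  refine Measure.integrableOn_of_bounded hs
    ((hd.measurable_localLip hf).pow_const p).aestronglyMeasurable (M := L ^ p)
    (ae_of_all _ fun y ↦ ?_)
  rw [Real.norm_of_nonneg (pow_nonneg localLip_nonneg p)]
  exact pow_le_pow_left₀ localLip_nonneg (localLip_le hL0 (hL y)) p

end IsLengthDist

end LengthDist

section HalfNet

variable {X : Type*} {d : X → X → ℝ}

/-- `V` is a finite set of points at distance less than `S` from `x`, such that the balls of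
radius `s / 2` about them cover the ball of radius `s` about `x`. -/
structure IsHalfNet (d : X → X → ℝ) (x : X) (s S : ℝ) (V : Finset X) : Prop where
  dist_lt : ∀ v ∈ V, d x v < S
  exists_dist_lt : ∀ y, d x y < s → ∃ v ∈ V, d v y < s / 2

namespace IsHalfNet

variable [TopologicalSpace X] {x : X} {s S t : ℝ} {V : Finset X} (hV : IsHalfNet d x s S V)
  (hd : IsLengthDist d) (hs0 : 0 < s) (ht : s / 2 < t)
include hV hd hs0 ht

lemma distBall_subset_biUnion : distBall d x (t + s / 2) ⊆ ⋃ v ∈ V, distBall d v t := by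
  intro y hy
  have hy' : d x y < s + (t - s / 2) := hy.trans_eq (by ring)
  obtain ⟨p, hxp, hpy⟩ := hd.exists_between x y s (t - s / 2) hs0 (by linarith) hy'
  obtain ⟨v, hv, hvp⟩ := hV.exists_dist_lt p hxp
  exact mem_iUnion₂.2 ⟨v, hv, (hd.triangle v p y).trans_lt (by linarith)⟩

variable [MeasurableSpace X] {μ : Measure X}

lemma measure_distBall_add_le {N : ℝ≥0∞} (hN : ∀ v ∈ V, μ (distBall d v t) ≤ N) :
    μ (distBall d x (t + s / 2)) ≤ V.card * N :=
  calc μ (distBall d x (t + s / 2)) ≤ μ (⋃ v ∈ V, distBall d v t) :=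
        measure_mono (hV.distBall_subset_biUnion hd hs0 ht)
    _ ≤ ∑ v ∈ V, μ (distBall d v t) := measure_biUnion_finset_le _ _
    _ ≤ V.card * N := by simpa using Finset.sum_le_card_nsmul V _ N hN

lemma lintegral_enorm_sub_le {f a : X → ℝ} {I J N : ℝ≥0∞}
    (hI : ∀ v ∈ V, ∫⁻ y in distBall d v t, ‖f y - a v‖ₑ ∂μ ≤ I)
    (hJ : ∀ v ∈ V, ‖a v - a x‖ₑ ≤ J) (hN : ∀ v ∈ V, μ (distBall d v t) ≤ N) :
    ∫⁻ y in distBall d x (t + s / 2), ‖f y - a x‖ₑ ∂μ ≤ V.card * (I + J * N) :=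
  calc ∫⁻ y in distBall d x (t + s / 2), ‖f y - a x‖ₑ ∂μ
      ≤ ∫⁻ y in ⋃ v ∈ V, distBall d v t, ‖f y - a x‖ₑ ∂μ :=
        lintegral_mono_set (hV.distBall_subset_biUnion hd hs0 ht)
    _ ≤ ∑ v ∈ V, ∫⁻ y in distBall d v t, ‖f y - a x‖ₑ ∂μ :=
        setLIntegral_biUnion_finset_le μ V _ _
    _ ≤ ∑ _v ∈ V, (I + J * N) := Finset.sum_le_sum fun v hv ↦
        (setLIntegral_enorm_sub_le_add f _ (a v) (a x)).trans
          (add_le_add (hI v hv) (mul_le_mul' (hJ v hv) (hN v hv)))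
    _ = V.card * (I + J * N) := by rw [Finset.sum_const, nsmul_eq_mul]

lemma lintegral_enorm_sub_le_mul {f a : X → ℝ} {G : X → ℝ≥0∞} (hf : Measurable f)
    {τ σ T U : ℝ} {A B m N : ℝ≥0∞} (hm0 : m ≠ 0) (hmt : m ≠ ⊤)
    (hm : ∀ v ∈ V, m ≤ μ (distBall d v s)) (hN : ∀ v ∈ V, μ (distBall d v t) ≤ N)
    (hτ : S + s ≤ τ) (hσ : S + σ ≤ U) (hT : S + T ≤ U)
    (hA : ∀ z, ∫⁻ y in distBall d z τ, ‖f y - a z‖ₑ ∂μ ≤ A * ∫⁻ y in distBall d z σ, G y ∂μ)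
    (hB : ∀ v ∈ V, ∫⁻ y in distBall d v t, ‖f y - a v‖ₑ ∂μ ≤ B * ∫⁻ y in distBall d v T, G y ∂μ) :
    ∫⁻ y in distBall d x (t + s / 2), ‖f y - a x‖ₑ ∂μ ≤
      V.card * (B + 2 * A / m * N) * ∫⁻ y in distBall d x U, G y ∂μ := by
  set I := ∫⁻ y in distBall d x U, G y ∂μ
  have hosc : ∀ v ∈ V, ∫⁻ y in distBall d v t, ‖f y - a v‖ₑ ∂μ ≤ B * I := fun v hv ↦
    (hB v hv).trans (mul_le_mul' le_rfl
      (lintegral_mono_set (hd.distBall_subset (by linarith [hV.dist_lt v hv]))))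
  have hconst : ∀ v ∈ V, ‖a v - a x‖ₑ ≤ 2 * A / m * I := fun v hv ↦
    hd.enorm_sub_le_of_lintegral_le hf hm0 hmt (hm v hv) (by linarith [hV.dist_lt v hv])
      (by linarith [hV.dist_lt v hv]) (hA v) (hA x)
  exact (hV.lintegral_enorm_sub_le hd hs0 ht hosc hconst hN).trans_eq (by ring)

end IsHalfNet

end HalfNet

section UniformAtlas

variable {X : Type*} [TopologicalSpace X] [MeasurableSpace X]
  {E : Type*} [NormedAddCommGroup E] [MeasurableSpace E]

/-- The length space `(X, d)` with the measure `μ` has a uniform chart of size `ρ`, with constants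
`L` and `C`, at each of its points: `(X, d, μ)` has bounded geometry. -/
structure HasBoundedGeometry (d : X → X → ℝ) (μ : Measure X) (ν : Measure E) (L ρ : ℝ)
    (C : ℝ≥0∞) : Prop where
  isLengthDist : IsLengthDist d
  one_le : 1 ≤ L
  pos : 0 < ρ
  ne_top : C ≠ ⊤
  exists_chart : ∀ x, ∃ Ψ : OpenPartialHomeomorph X E, IsUniformChart d μ ν L ρ C x Ψ

namespace HasBoundedGeometry

variable [NormedSpace ℝ E] [FiniteDimensional ℝ E] {d : X → X → ℝ} {μ : Measure X} {ν : Measure E}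
  {L ρ : ℝ} {C : ℝ≥0∞} (hX : HasBoundedGeometry d μ ν L ρ C)
include hX

lemma exists_isHalfNet {s : ℝ} (hs0 : 0 < s) (hs : L * s ≤ ρ) :
    ∃ n : ℕ, ∀ x, ∃ V : Finset X, V.card ≤ n ∧ IsHalfNet d x s (L * L * s) V := by
  classical
  have hL0 : 0 < L := zero_lt_one.trans_le hX.one_le
  have htb : TotallyBounded (Metric.ball (0 : E) L) :=
    (isCompact_closedBall (0 : E) L).totallyBounded.subset Metric.ball_subset_closedBall
  obtain ⟨t, htB, htfin, hcov⟩ := Metric.finite_approx_of_totallyBounded htb (1 / (2 * L))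
    (by positivity)
  refine ⟨htfin.toFinset.card, fun x ↦ ?_⟩
  obtain ⟨Ψ, hΨ⟩ := hX.exists_chart x
  have hmem : ∀ u ∈ Metric.ball (0 : E) L, Ψ x + s • u ∈ Metric.ball (Ψ x) (L * s) := by
    intro u hu
    rw [mem_ball_zero_iff] at hu
    rw [mem_ball_iff_norm, add_sub_cancel_left, norm_smul, Real.norm_of_nonneg hs0.le, mul_comm]
    exact mul_lt_mul_of_pos_right hu hs0
  refine ⟨htfin.toFinset.image fun u ↦ Ψ.symm (Ψ x + s • u), Finset.card_image_le,
    Finset.forall_mem_image.2 fun u hu ↦ ?_, fun y hy ↦ ?_⟩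
  · have := hΨ.symm_mem_distBall hX.one_le hs (hmem u (htB (htfin.mem_toFinset.1 hu)))
    rwa [← mul_assoc] at this
  · obtain ⟨hy1, hy2⟩ := hΨ.mem_source_and_apply_mem_ball hX.one_le hs hy
    obtain ⟨u, hu, hyu⟩ : ∃ u ∈ Metric.ball (0 : E) L, Ψ y = Ψ x + s • u := by
      refine ⟨s⁻¹ • (Ψ y - Ψ x), ?_, by rw [smul_inv_smul₀ hs0.ne', add_sub_cancel]⟩
      rw [mem_ball_zero_iff, norm_smul, norm_inv, Real.norm_of_nonneg hs0.le,
        inv_mul_lt_iff₀ hs0, mul_comm]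
      exact mem_ball_iff_norm.1 hy2
    obtain ⟨v, hv, huv⟩ := mem_iUnion₂.1 (hcov hu)
    refine ⟨_, Finset.mem_image_of_mem _ (htfin.mem_toFinset.2 hv), ?_⟩
    have h1 := hΨ.dist_le _ (Metric.ball_subset_ball hs (hmem v (htB hv))) _
      (Metric.ball_subset_ball hs hy2)
    rw [Ψ.left_inv hy1, hyu, add_sub_add_left_eq_sub, ← smul_sub, norm_smul,
      Real.norm_of_nonneg hs0.le] at h1
    rw [mem_ball_iff_norm', lt_div_iff₀ (by positivity)] at huv
    exact h1.trans_lt (by nlinarith)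

variable [BorelSpace X] [BorelSpace E] [ν.IsAddHaarMeasure]

lemma exists_measure_distBall_le (R : ℝ) :
    ∃ N : ℝ≥0∞, N ≠ ⊤ ∧ ∀ x, ∀ r ≤ R, μ (distBall d x r) ≤ N := by
  have hL0 : 0 < L := zero_lt_one.trans_le hX.one_le
  set s := ρ / L
  have hs0 : 0 < s := div_pos hX.pos hL0
  have hsρ : L * s = ρ := mul_div_cancel₀ _ hL0.ne'
  obtain ⟨n, hn⟩ := hX.exists_isHalfNet hs0 hsρ.le
  have bound (j : ℕ) : ∃ N : ℝ≥0∞, N ≠ ⊤ ∧ ∀ x, μ (distBall d x (s + j * (s / 2))) ≤ N := by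
    induction j with
    | zero =>
      refine ⟨C * ν (Metric.ball 0 (L * s)),
        ENNReal.mul_ne_top hX.ne_top measure_ball_lt_top.ne, fun x ↦ ?_⟩
      obtain ⟨Ψ, hΨ⟩ := hX.exists_chart x
      simpa using hΨ.measure_distBall_le hX.one_le hX.isLengthDist hsρ.le
    | succ j ih =>
      obtain ⟨N, hN, hNx⟩ := ih
      refine ⟨n * N, ENNReal.mul_ne_top (by simp) hN, fun x ↦ ?_⟩
      obtain ⟨V, hVn, hV⟩ := hn x
      have hpos : 0 ≤ (j : ℝ) * (s / 2) := by positivity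
      have hle := hV.measure_distBall_add_le hX.isLengthDist hs0
        (show s / 2 < s + j * (s / 2) by linarith) fun v _ ↦ hNx v
      rw [Nat.cast_succ, add_one_mul, ← add_assoc]
      exact hle.trans (by gcongr)
  obtain ⟨j, hj⟩ := exists_nat_ge (R / (s / 2))
  obtain ⟨N, hN, hNx⟩ := bound j
  rw [div_le_iff₀ (by positivity)] at hj
  exact ⟨N, hN, fun x r hr ↦ (measure_mono (distBall_mono d x (by linarith))).trans (hNx x)⟩

lemma exists_le_measure_distBall {r : ℝ} (hr : 0 < r) :
    ∃ m : ℝ≥0∞, m ≠ 0 ∧ m ≠ ⊤ ∧ ∀ x, ∀ t, r ≤ t → m ≤ μ (distBall d x t) := by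
  have hL0 : 0 < L := zero_lt_one.trans_le hX.one_le
  set t := min (r / L) ρ
  have ht0 : 0 < t := lt_min (div_pos hr hL0) hX.pos
  have htr : L * t ≤ r := (le_div_iff₀' hL0).1 (min_le_left _ _)
  refine ⟨ν (Metric.ball 0 t) / (C + 1),
    (ENNReal.div_pos (Metric.measure_ball_pos ν _ ht0).ne' (by finiteness [hX.ne_top])).ne',
    ENNReal.div_ne_top measure_ball_lt_top.ne (by simp), fun x t' ht' ↦ ?_⟩
  obtain ⟨Ψ, hΨ⟩ := hX.exists_chart x
  refine ENNReal.div_le_of_le_mul' ?_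
  calc ν (Metric.ball 0 t) ≤ C * μ (distBall d x (L * t)) :=
        hΨ.measure_ball_le hX.one_le hX.isLengthDist (min_le_right _ _)
    _ ≤ (C + 1) * μ (distBall d x t') := by
        gcongr
        · exact le_self_add
        · exact distBall_mono d x (htr.trans ht')

lemma measure_distBall_mul_le_of_le {Λ : ℝ} (hΛ : 1 ≤ Λ) (x : X) {r : ℝ} (hr0 : 0 < r)
    (hr : L * (Λ * r) ≤ ρ) : μ (distBall d x (Λ * r)) ≤
      C * ENNReal.ofReal ((L * Λ * L) ^ Module.finrank ℝ E) * C * μ (distBall d x r) := by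
  have hL0 : 0 < L := zero_lt_one.trans_le hX.one_le
  have hΛ0 : 0 < Λ := zero_lt_one.trans_le hΛ
  obtain ⟨Ψ, hΨ⟩ := hX.exists_chart x
  have hrL : r / L ≤ ρ :=
    calc r / L ≤ r := div_le_self hr0.le hX.one_le
      _ ≤ Λ * r := le_mul_of_one_le_left hr0.le hΛ
      _ ≤ L * (Λ * r) := le_mul_of_one_le_left (by positivity) hX.one_le
      _ ≤ ρ := hr
  have hscale : ν (Metric.ball 0 (L * (Λ * r))) =
      ENNReal.ofReal ((L * Λ * L) ^ Module.finrank ℝ E) * ν (Metric.ball 0 (r / L)) := by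
    have : L * (Λ * r) = (L * Λ * L) * (r / L) := by field_simp
    rw [this, Measure.addHaar_ball_mul_of_pos ν _ (mul_pos (mul_pos hL0 hΛ0) hL0)]
  have hle := hΨ.measure_ball_le hX.one_le hX.isLengthDist hrL
  rw [mul_div_cancel₀ _ hL0.ne'] at hle
  calc μ (distBall d x (Λ * r)) ≤ C * ν (Metric.ball 0 (L * (Λ * r))) :=
        hΨ.measure_distBall_le hX.one_le hX.isLengthDist hr
    _ ≤ C * (ENNReal.ofReal ((L * Λ * L) ^ Module.finrank ℝ E) * (C * μ (distBall d x r))) := by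
        rw [hscale]
        gcongr
    _ = _ := by ring

lemma exists_measure_distBall_mul_le {Λ : ℝ} (hΛ : 1 ≤ Λ) (R : ℝ) :
    ∃ A : ℝ≥0∞, A ≠ ⊤ ∧ ∀ x r, 0 < r → r ≤ R →
      μ (distBall d x (Λ * r)) ≤ A * μ (distBall d x r) := by
  have hL0 : 0 < L := zero_lt_one.trans_le hX.one_le
  have hΛ0 : 0 < Λ := zero_lt_one.trans_le hΛ
  set r₁ := ρ / (L * Λ) with hr₁
  have hr₁0 : 0 < r₁ := div_pos hX.pos (mul_pos hL0 hΛ0)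
  obtain ⟨N, hN, hNx⟩ := hX.exists_measure_distBall_le (Λ * R)
  obtain ⟨m, hm0, hmt, hm⟩ := hX.exists_le_measure_distBall hr₁0
  set A := C * ENNReal.ofReal ((L * Λ * L) ^ Module.finrank ℝ E) * C
  have hAt : A ≠ ⊤ := by finiteness [hX.ne_top]
  refine ⟨N / m + A, ENNReal.add_ne_top.2 ⟨ENNReal.div_ne_top hN hm0, hAt⟩,
    fun x r hr0 hrR ↦ ?_⟩
  rcases le_total r₁ r with h | h
  · calc μ (distBall d x (Λ * r)) ≤ N := hNx x _ (by gcongr)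
      _ = N / m * m := (ENNReal.div_mul_cancel hm0 hmt).symm
      _ ≤ (N / m + A) * μ (distBall d x r) := mul_le_mul' le_self_add (hm x r h)
  · rw [hr₁, le_div_iff₀ (by positivity)] at h
    exact (hX.measure_distBall_mul_le_of_le hΛ x hr0 (by linarith)).trans
      (mul_le_mul' le_add_self le_rfl)

lemma exists_lintegral_distBall_enorm_sub_le_of_le {τ : ℝ} {s : ℝ} (hs0 : 0 < s)
    (hsτ : (L * L + 1) * s ≤ τ) (hs : L * s ≤ ρ) {A : ℝ≥0∞} (hA : A ≠ ⊤) (j : ℕ) :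
    ∃ B : ℝ≥0∞, B ≠ ⊤ ∧ ∀ (f a : X → ℝ) (G : X → ℝ≥0∞), Measurable f →
      (∀ x, ∫⁻ y in distBall d x τ, ‖f y - a x‖ₑ ∂μ ≤
        A * ∫⁻ y in distBall d x (L * L * τ), G y ∂μ) →
      ∀ r, τ ≤ r → r ≤ τ + j * (s / 2) → ∀ x, ∫⁻ y in distBall d x r, ‖f y - a x‖ₑ ∂μ ≤
        B * ∫⁻ y in distBall d x (3 * (L * L) * r), G y ∂μ := by
  have hd := hX.isLengthDist
  have hLL : 1 ≤ L * L := one_le_mul_of_one_le_of_one_le hX.one_le hX.one_le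
  have hsτ' : s ≤ τ := by nlinarith
  have hτ0 : 0 < τ := hs0.trans_le hsτ'
  have hLs : L * L * s ≤ L * L * τ := by gcongr
  have hLτ : 0 ≤ L * L * τ := by positivity
  obtain ⟨n, hn⟩ := hX.exists_isHalfNet hs0 hs
  obtain ⟨m, hm0, hmt, hm⟩ := hX.exists_le_measure_distBall hs0
  induction j with
  | zero =>
    refine ⟨A, hA, fun f a G _ hbase r hr hr' x ↦ ?_⟩
    obtain rfl : r = τ := le_antisymm (by simpa using hr') hr
    exact (hbase x).trans
      (mul_le_mul' le_rfl (lintegral_mono_set (distBall_mono d x (by nlinarith))))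
  | succ j ih =>
    obtain ⟨B, hB, hBx⟩ := ih
    obtain ⟨N, hN, hNx⟩ := hX.exists_measure_distBall_le (τ + j * (s / 2))
    refine ⟨n * (A + B + 2 * A / m * N), by finiteness, fun f a G hf hbase r hr hr' x ↦ ?_⟩
    obtain ⟨V, hVn, hV⟩ := hn x
    have enlarge {t T : ℝ} {B' : ℝ≥0∞} (hτt : τ ≤ t) (htj : t ≤ τ + j * (s / 2))
        (hrt : r ≤ t + s / 2) (hT : L * L * s + T ≤ 3 * (L * L) * r) (hB' : B' ≤ A + B)
        (hosc : ∀ v, ∫⁻ y in distBall d v t, ‖f y - a v‖ₑ ∂μ ≤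
          B' * ∫⁻ y in distBall d v T, G y ∂μ) :
        ∫⁻ y in distBall d x r, ‖f y - a x‖ₑ ∂μ ≤ n * (A + B + 2 * A / m * N) *
          ∫⁻ y in distBall d x (3 * (L * L) * r), G y ∂μ := by
      refine (lintegral_mono_set (distBall_mono d x hrt)).trans
        ((hV.lintegral_enorm_sub_le_mul hd hs0 (by linarith) hf hm0 hmt (fun v _ ↦ hm v s le_rfl)
          (fun v _ ↦ hNx v t htj) (by linarith) (by nlinarith) hT hbase fun v _ ↦ hosc v).trans ?_)
      gcongr
    push_cast at hr'
    rcases le_total (r - s / 2) τ with h | h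
    · exact enlarge le_rfl (le_add_of_nonneg_right (by positivity)) (by linarith) (by nlinarith)
        le_self_add hbase
    · exact enlarge h (by linarith) (by linarith) (by nlinarith) le_add_self
        (hBx f a G hf hbase _ h (by linarith))

lemma exists_lintegral_enorm_sub_le_of_mul_le {r : ℝ} (hr0 : 0 < r) (hr : L * r ≤ ρ) (x : X)
    {f : X → ℝ} (hf : IsLipschitzFor d f) :
    ∃ a, ∫⁻ y in distBall d x r, ‖f y - a‖ₑ ∂μ ≤
      C * C * ENNReal.ofReal (2 * L * L) * 2 ^ Module.finrank ℝ E * ENNReal.ofReal r *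
        ∫⁻ y in distBall d x (L * L * r), ENNReal.ofReal (localLip d f y) ∂μ :=
  let ⟨_, hΨ⟩ := hX.exists_chart x
  hΨ.exists_lintegral_enorm_sub_le hX.one_le hX.isLengthDist hr0 hr hf

lemma exists_lintegral_enorm_sub_le_of_le (R : ℝ) :
    ∃ A : ℝ≥0∞, A ≠ ⊤ ∧ ∀ x r, 0 < r → r ≤ R → ∀ f, IsLipschitzFor d f →
      ∃ a, ∫⁻ y in distBall d x r, ‖f y - a‖ₑ ∂μ ≤ A * ENNReal.ofReal r *
        ∫⁻ y in distBall d x (3 * (L * L) * r), ENNReal.ofReal (localLip d f y) ∂μ := by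
  have hL0 : 0 < L := zero_lt_one.trans_le hX.one_le
  have hρ := hX.pos
  set s := ρ / (L * (L * L + 1))
  set τ := (L * L + 1) * s with hτ
  have hs0 : 0 < s := by positivity
  have hτ0 : 0 < τ := by positivity
  have hτρ : L * τ = ρ := by rw [hτ, ← mul_assoc, mul_div_cancel₀ _ (by positivity)]
  have hsρ : L * s ≤ ρ := by
    rw [← hτρ]
    gcongr
    nlinarith
  set A := C * C * ENNReal.ofReal (2 * L * L) * 2 ^ Module.finrank ℝ E
  have hAt : A ≠ ⊤ := by finiteness [hX.ne_top]
  obtain ⟨j, hj⟩ := exists_nat_ge ((R - τ) / (s / 2))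
  rw [div_le_iff₀ (by positivity)] at hj
  obtain ⟨B, hB, hBx⟩ := hX.exists_lintegral_distBall_enorm_sub_le_of_le hs0 hτ.ge hsρ
    (ENNReal.mul_ne_top hAt (ENNReal.ofReal_ne_top (r := τ))) j
  have hτ' : ENNReal.ofReal τ ≠ 0 := by simpa using hτ0
  refine ⟨A + B / ENNReal.ofReal τ, by finiteness, fun x r hr0 hrR f hf ↦ ?_⟩
  rcases le_total r τ with hr | hr
  · obtain ⟨a, ha⟩ := hX.exists_lintegral_enorm_sub_le_of_mul_le hr0
      (hτρ ▸ mul_le_mul_of_nonneg_left hr hL0.le) x hf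
    refine ⟨a, ha.trans ?_⟩
    gcongr
    · exact le_self_add
    · exact distBall_mono d x (by nlinarith)
  · choose a ha using fun x ↦ hX.exists_lintegral_enorm_sub_le_of_mul_le hτ0 hτρ.le x hf
    refine ⟨a x, (hBx f a _ (hX.isLengthDist.continuous_of_isLipschitzFor hf).measurable ha r hr
      (by linarith) x).trans ?_⟩
    gcongr
    calc B = B / ENNReal.ofReal τ * ENNReal.ofReal τ :=
          (ENNReal.div_mul_cancel hτ' ENNReal.ofReal_ne_top).symm
      _ ≤ (A + B / ENNReal.ofReal τ) * ENNReal.ofReal r := by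
          gcongr
          exact le_add_self

lemma localPoincare12 : LocalPoincare12 d μ := by
  have hLL : 1 ≤ L * L := one_le_mul_of_one_le_of_one_le hX.one_le hX.one_le
  have hd := hX.isLengthDist
  choose A hA hAx using hX.exists_lintegral_enorm_sub_le_of_le
  choose D hD hDx using hX.exists_measure_distBall_mul_le (show 1 ≤ 3 * (L * L) by linarith)
  refine ⟨3 * (L * L), by linarith, fun R ↦ 2 * ((A R).toReal * (D R).toReal) + 1,
    fun R _ ↦ by positivity, fun R _ x r hr hrR ↦ ?_⟩
  have hsub : distBall d x r ⊆ distBall d x (3 * (L * L) * r) := distBall_mono d x (by nlinarith)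
  obtain ⟨m, hm0, -, hm⟩ := hX.exists_le_measure_distBall hr
  have hB0 : 0 < μ (distBall d x r) := (pos_iff_ne_zero.2 hm0).trans_le (hm x r le_rfl)
  obtain ⟨N, hN, hNx⟩ := hX.exists_measure_distBall_le (3 * (L * L) * r)
  have hB : μ (distBall d x (3 * (L * L) * r)) < ⊤ := (hNx x _ le_rfl).trans_lt hN.lt_top
  refine ⟨⟨hB0, hB⟩, fun f hf ↦ ?_⟩
  have hfi : IntegrableOn f (distBall d x r) μ :=
    hd.integrableOn_distBall hf (ne_top_of_le_ne_top hB.ne (measure_mono hsub))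
  have hg2 := hd.integrableOn_localLip_pow hf hB.ne 2
  have hg : IntegrableOn (localLip d f) (distBall d x (3 * (L * L) * r)) μ := by
    simpa only [pow_one] using hd.integrableOn_localLip_pow hf hB.ne 1
  obtain ⟨a, ha⟩ := hAx R x r hr hrR f hf
  refine ⟨hfi, hg2, (setAverage_abs_sub_setAverage_le_mul_sqrt hB0.ne' hsub hB.ne hfi
    (fun _ ↦ localLip_nonneg) hg hg2 (ENNReal.mul_ne_top (hA R) ENNReal.ofReal_ne_top) (hD R)
    (hDx R x r hr hrR) ha).trans (mul_le_mul_of_nonneg_right ?_ (Real.sqrt_nonneg _))⟩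
  rw [ENNReal.toReal_mul, ENNReal.toReal_ofReal hr.le]
  linarith

end HasBoundedGeometry

end UniformAtlas

section Paths

open Manifold

variable {n : ℕ} {X : Type*} [TopologicalSpace X] [ChartedSpace (Cn n) X]

/-- The `g`-length of a path between the times `a` and `b`. -/
def gLengthOn (g : BilinField n X) (γ : ℝ → X) (a b : ℝ) : ℝ≥0∞ :=
  ∫⁻ t in Icc a b, ENNReal.ofReal (√(g (γ t) (pathVelocity γ t) (pathVelocity γ t)))

/-- The extended norm `v ↦ g(v, v)^{1/2}` on a tangent space; it makes `gLengthOn` an instance of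
the length of paths in a manifold with a family of norms. -/
@[reducible] def metricENorm (g : BilinField n X) (x : X) : ENorm (TangentSpace 𝓘(ℝ, Cn n) x) :=
  ⟨fun v ↦ ENNReal.ofReal (√(g x v v))⟩

lemma metricENorm_smulClass (g : BilinField n X) (x : X) :
    letI := metricENorm g x
    ENormSMulClass ℝ (TangentSpace 𝓘(ℝ, Cn n) x) := by
  let := metricENorm g x
  have hsmul (c : ℝ) (v : Cn n) : ENNReal.ofReal (√(g x (c • v) (c • v))) =
      ‖c‖ₑ * ENNReal.ofReal (√(g x v v)) := by
    have hquad : g x (c • v) (c • v) = c ^ 2 * g x v v := by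
      rw [map_smul, map_smul, smul_apply, smul_eq_mul, smul_eq_mul]
      ring
    rw [hquad, Real.sqrt_mul (sq_nonneg c), Real.sqrt_sq_eq_abs, ENNReal.ofReal_mul (abs_nonneg c),
      ← Real.norm_eq_abs, ofReal_norm]
  exact ⟨hsmul⟩

variable {g : BilinField n X} {γ γ' : ℝ → X} {a b c : ℝ}

lemma gLengthOn_eq_pathELength :
    letI := metricENorm g
    gLengthOn g γ a b = pathELength 𝓘(ℝ, Cn n) γ a b := by
  let := metricENorm g
  rw [pathELength_eq_lintegral_mfderiv_Icc]
  rfl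

lemma gLengthOn_congr (h : EqOn γ γ' (Icc a b)) : gLengthOn g γ a b = gLengthOn g γ' a b := by
  let := metricENorm g
  rw [gLengthOn_eq_pathELength, gLengthOn_eq_pathELength]
  exact pathELength_congr h

lemma gLengthOn_add (h : a ≤ b) (h' : b ≤ c) :
    gLengthOn g γ a b + gLengthOn g γ b c = gLengthOn g γ a c := by
  let := metricENorm g
  simp only [gLengthOn_eq_pathELength]
  exact pathELength_add h h'

lemma gLengthOn_comp_of_monotoneOn {f : ℝ → ℝ} (h : a ≤ b) (hf : MonotoneOn f (Icc a b))
    (h'f : DifferentiableOn ℝ f (Icc a b))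
    (hγ : MDifferentiableOn 𝓘(ℝ, ℝ) 𝓘(ℝ, Cn n) γ (Icc (f a) (f b))) :
    gLengthOn g (γ ∘ f) a b = gLengthOn g γ (f a) (f b) := by
  let := metricENorm g
  have (x : X) : ENormSMulClass ℝ (TangentSpace 𝓘(ℝ, Cn n) x) := metricENorm_smulClass g x
  simp only [gLengthOn_eq_pathELength]
  exact pathELength_comp_of_monotoneOn h hf h'f hγ

lemma gLengthOn_comp_of_antitoneOn {f : ℝ → ℝ} (h : a ≤ b) (hf : AntitoneOn f (Icc a b))
    (h'f : DifferentiableOn ℝ f (Icc a b))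
    (hγ : MDifferentiableOn 𝓘(ℝ, ℝ) 𝓘(ℝ, Cn n) γ (Icc (f b) (f a))) :
    gLengthOn g (γ ∘ f) a b = gLengthOn g γ (f b) (f a) := by
  let := metricENorm g
  have (x : X) : ENormSMulClass ℝ (TangentSpace 𝓘(ℝ, Cn n) x) := metricENorm_smulClass g x
  simp only [gLengthOn_eq_pathELength]
  exact pathELength_comp_of_antitoneOn h hf h'f hγ

variable {U : Set X} {x y z : X} {r : ℝ≥0∞}

lemma riemannianEDistOn_le_gLength (hγ : ContMDiffOn 𝓘(ℝ, ℝ) 𝓘(ℝ, Cn n) 1 γ (Icc 0 1))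
    (hU : MapsTo γ (Icc 0 1) U) : riemannianEDistOn g U (γ 0) (γ 1) ≤ gLengthOn g γ 0 1 :=
  iInf₂_le γ ⟨hγ, hU, rfl, rfl⟩

lemma riemannianEDistOn_le_gLengthOn (hab : a ≤ b)
    (hγ : ContMDiffOn 𝓘(ℝ, ℝ) 𝓘(ℝ, Cn n) 1 γ (Icc a b)) (hU : MapsTo γ (Icc a b) U) :
    riemannianEDistOn g U (γ a) (γ b) ≤ gLengthOn g γ a b := by
  set η : ℝ → ℝ := fun t ↦ a + t * (b - a)
  have h0 : η 0 = a := by simp [η]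
  have h1 : η 1 = b := by simp [η]
  have hsmooth : ContDiff ℝ 1 η := by fun_prop
  have hmono : Monotone η := fun s t hst ↦
    add_le_add_right (mul_le_mul_of_nonneg_right hst (sub_nonneg.2 hab)) a
  have hmaps : MapsTo η (Icc 0 1) (Icc a b) := fun t ht ↦ ⟨h0 ▸ hmono ht.1, h1 ▸ hmono ht.2⟩
  have hle : riemannianEDistOn g U (γ (η 0)) (γ (η 1)) ≤ gLengthOn g (γ ∘ η) 0 1 :=
    riemannianEDistOn_le_gLength
      (hγ.comp (contMDiff_iff_contDiff.2 hsmooth).contMDiffOn hmaps) (hU.comp hmaps)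
  rwa [gLengthOn_comp_of_monotoneOn zero_le_one (hmono.monotoneOn _)
    (hsmooth.differentiable one_ne_zero).differentiableOn
    (by rw [h0, h1]; exact hγ.mdifferentiableOn one_ne_zero), h0, h1] at hle

lemma exists_path_of_riemannianEDistOn_lt (h : riemannianEDistOn g U x y < r) :
    ∃ γ : ℝ → X, ContMDiffOn 𝓘(ℝ, ℝ) 𝓘(ℝ, Cn n) 1 γ (Icc 0 1) ∧ MapsTo γ (Icc 0 1) U ∧
      γ 0 = x ∧ γ 1 = y ∧ gLengthOn g γ 0 1 < r := by
  simp only [riemannianEDistOn, iInf_lt_iff, exists_prop] at h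
  obtain ⟨γ, ⟨hγ, hU, h0, h1⟩, hlt⟩ := h
  exact ⟨γ, hγ, hU, h0, h1, hlt⟩

lemma exists_contMDiff_path_of_riemannianEDistOn_lt (h : riemannianEDistOn g U x y < r) :
    ∃ γ : ℝ → X, ContMDiff 𝓘(ℝ, ℝ) 𝓘(ℝ, Cn n) 1 γ ∧ (∀ t, γ t ∈ U) ∧ (∀ t ≤ 0, γ t = x) ∧
      (∀ t, 1 ≤ t → γ t = y) ∧ ∀ a ≤ 0, ∀ b, 1 ≤ b → gLengthOn g γ a b < r := by
  obtain ⟨γ, hγ, hU, rfl, rfl, hlt⟩ := exists_path_of_riemannianEDistOn_lt h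
  have hσ : ContDiff ℝ 1 Real.smoothTransition := Real.smoothTransition.contDiff
  have hσ01 (t : ℝ) : Real.smoothTransition t ∈ Icc (0 : ℝ) 1 :=
    ⟨Real.smoothTransition.nonneg t, Real.smoothTransition.le_one t⟩
  refine ⟨γ ∘ Real.smoothTransition, ?_, fun t ↦ hU (hσ01 t), fun t ht ↦ ?_, fun t ht ↦ ?_,
    fun a ha b hb ↦ ?_⟩
  · rw [← contMDiffOn_univ]
    exact hγ.comp (contMDiff_iff_contDiff.2 hσ).contMDiffOn fun t _ ↦ hσ01 t
  · rw [Function.comp_apply, Real.smoothTransition.zero_of_nonpos ht]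
  · rw [Function.comp_apply, Real.smoothTransition.one_of_one_le ht]
  · rw [gLengthOn_comp_of_monotoneOn (by linarith) (Real.smoothTransition.monotone.monotoneOn _)
      (hσ.differentiable one_ne_zero).differentiableOn] <;>
    rw [Real.smoothTransition.zero_of_nonpos ha, Real.smoothTransition.one_of_one_le hb]
    exacts [hlt, hγ.mdifferentiableOn one_ne_zero]

lemma riemannianEDistOn_self (hx : x ∈ U) : riemannianEDistOn g U x x = 0 := by
  have hle := riemannianEDistOn_le_gLengthOn (g := g) (γ := fun _ : ℝ ↦ x) (le_refl (0 : ℝ))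
    contMDiffOn_const fun _ _ ↦ hx
  exact le_antisymm (hle.trans_eq (by simp [gLengthOn])) zero_le

lemma riemannianEDistOn_comm : riemannianEDistOn g U x y = riemannianEDistOn g U y x := by
  suffices H : ∀ x y, riemannianEDistOn g U y x ≤ riemannianEDistOn g U x y from
    le_antisymm (H y x) (H x y)
  refine fun x y ↦ le_of_forall_gt fun r hr ↦ ?_
  obtain ⟨γ, hγ, hU, rfl, rfl, hlt⟩ := exists_path_of_riemannianEDistOn_lt hr
  have hflip : ContDiff ℝ 1 fun t : ℝ ↦ 1 - t := by fun_prop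
  have hmaps : MapsTo (fun t : ℝ ↦ 1 - t) (Icc 0 1) (Icc 0 1) := fun t ht ↦
    ⟨by linarith [ht.2], by linarith [ht.1]⟩
  have hle := riemannianEDistOn_le_gLength (g := g)
    (hγ.comp (contMDiff_iff_contDiff.2 hflip).contMDiffOn hmaps) (hU.comp hmaps)
  rw [gLengthOn_comp_of_antitoneOn zero_le_one (fun s _ t _ hst ↦ sub_le_sub_left hst 1)
    (hflip.differentiable one_ne_zero).differentiableOn
    (by simpa using hγ.mdifferentiableOn one_ne_zero)] at hle
  simp only [Function.comp_apply, sub_zero, sub_self] at hle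
  exact hle.trans_lt hlt

lemma riemannianEDistOn_triangle :
    riemannianEDistOn g U x z ≤ riemannianEDistOn g U x y + riemannianEDistOn g U y z := by
  refine le_of_forall_gt fun r hr ↦ ?_
  obtain ⟨u, hu, v, hv, huv⟩ := ENNReal.exists_add_lt_of_add_lt hr
  obtain ⟨γ₁, hγ₁, hU₁, hx, hy₁, hlt₁⟩ := exists_contMDiff_path_of_riemannianEDistOn_lt hu
  obtain ⟨γ₂, hγ₂, hU₂, hy₂, hz, hlt₂⟩ := exists_contMDiff_path_of_riemannianEDistOn_lt hv
  -- Both paths rest at `y` near the time `3 / 2` at which they are glued.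
  have hshift : ContDiff ℝ 1 fun t : ℝ ↦ t - 2 := by fun_prop
  set γ₂' : ℝ → X := γ₂ ∘ fun t ↦ t - 2
  set γ : ℝ → X := piecewise (Iic (3 / 2)) γ₁ γ₂' with hγdef
  have hyy : γ₁ =ᶠ[𝓝 (3 / 2)] γ₂' := by
    filter_upwards [Icc_mem_nhds (show (1 : ℝ) < 3 / 2 by norm_num)
      (show (3 / 2 : ℝ) < 2 by norm_num)] with t ht
    exact (hy₁ t ht.1).trans (hy₂ (t - 2) (by linarith [ht.2])).symm
  have hγ : ContMDiff 𝓘(ℝ, ℝ) 𝓘(ℝ, Cn n) 1 γ :=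
    ContMDiff.piecewise_Iic hγ₁ (hγ₂.comp (contMDiff_iff_contDiff.2 hshift)) hyy
  have hleft : EqOn γ γ₁ (Icc 0 (3 / 2)) := fun t ht ↦ piecewise_eq_of_mem _ _ _ ht.2
  have hright : EqOn γ γ₂' (Icc (3 / 2) 3) := fun t ht ↦ by
    rcases ht.1.eq_or_lt with rfl | h
    · exact (hleft ⟨by norm_num, le_rfl⟩).trans hyy.self_of_nhds
    · exact piecewise_eq_of_notMem _ _ _ h.not_ge
  have hle : riemannianEDistOn g U (γ 0) (γ 3) ≤ gLengthOn g γ 0 3 :=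
    riemannianEDistOn_le_gLengthOn (by norm_num) hγ.contMDiffOn fun t _ ↦ by
      by_cases ht : t ∈ Iic (3 / 2 : ℝ)
      · simpa only [hγdef, piecewise_eq_of_mem _ _ _ ht] using hU₁ t
      · rw [hγdef, piecewise_eq_of_notMem _ _ _ ht]
        exact hU₂ _
  rw [hleft ⟨le_rfl, by norm_num⟩, hright ⟨by norm_num, le_rfl⟩, hx 0 le_rfl,
    show γ₂' 3 = z from hz _ (by norm_num),
    ← gLengthOn_add (show (0 : ℝ) ≤ 3 / 2 by norm_num) (by norm_num), gLengthOn_congr hleft,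
    gLengthOn_congr hright, gLengthOn_comp_of_monotoneOn (by norm_num)
      (fun s _ t _ hst ↦ sub_le_sub_right hst 2)
      (hshift.differentiable one_ne_zero).differentiableOn
      (hγ₂.contMDiffOn.mdifferentiableOn one_ne_zero)] at hle
  exact hle.trans_lt ((ENNReal.add_lt_add (hlt₁ 0 le_rfl _ (by norm_num))
    (hlt₂ _ (by norm_num) _ (by norm_num))).trans huv)

lemma exists_path_add_lt_of_riemannianEDistOn_lt (h : riemannianEDistOn g U x y < r) :
    ∃ γ : ℝ → X, ContinuousOn γ (Icc 0 1) ∧ MapsTo γ (Icc 0 1) U ∧ γ 0 = x ∧ γ 1 = y ∧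
      ∀ t ∈ Icc (0 : ℝ) 1, riemannianEDistOn g U x (γ t) + riemannianEDistOn g U (γ t) y < r := by
  obtain ⟨γ, hγ, hU, rfl, rfl, hlt⟩ := exists_path_of_riemannianEDistOn_lt h
  refine ⟨γ, hγ.continuousOn, hU, rfl, rfl, fun t ht ↦ lt_of_le_of_lt ?_ hlt⟩
  rw [← gLengthOn_add ht.1 ht.2]
  have hs1 : Icc 0 t ⊆ Icc 0 1 := Icc_subset_Icc le_rfl ht.2
  have hs2 : Icc t 1 ⊆ Icc 0 1 := Icc_subset_Icc ht.1 le_rfl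
  exact add_le_add
    (riemannianEDistOn_le_gLengthOn ht.1 (hγ.mono hs1) (hU.mono hs1 Subset.rfl))
    (riemannianEDistOn_le_gLengthOn ht.2 (hγ.mono hs2) (hU.mono hs2 Subset.rfl))

end Paths

section QuadraticPath

lemma exists_norm_le_forall_bent_segment_ne_zero (w w' : ℂ) :
    ∃ ξ : ℂ, ‖ξ‖ ≤ ‖w - w'‖ ∧ (w ≠ 0 → w' ≠ 0 → ∀ t ∈ Icc (0 : ℝ) 1,
      (1 - t) • w + t • w' + (t * (1 - t)) • ξ ≠ 0) := by
  by_cases hneg : ∃ s : ℝ, 0 ≤ s ∧ w' = -(s : ℂ) * w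
  · obtain ⟨s, hs, rfl⟩ := hneg
    refine ⟨Complex.I * w, ?_, fun hw hw' t ht h0 ↦ ?_⟩
    · rw [norm_mul, Complex.norm_I, one_mul,
        show w - -(s : ℂ) * w = (1 + s : ℝ) * w by push_cast; ring, norm_mul, Complex.norm_real,
        Real.norm_of_nonneg (by positivity)]
      exact le_mul_of_one_le_left (norm_nonneg w) (by linarith)
    · have hfactor :
          (((1 - t - t * s : ℝ) : ℂ) + ((t * (1 - t) : ℝ) : ℂ) * Complex.I) * w = 0 := by
        rw [← h0]
        simp only [Complex.real_smul]
        push_cast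
        ring
      obtain ⟨hre, him⟩ := Complex.ext_iff.1 ((mul_eq_zero.1 hfactor).resolve_right hw)
      simp only [Complex.add_re, Complex.add_im, Complex.ofReal_re, Complex.ofReal_im,
        Complex.mul_re, Complex.mul_im, Complex.I_re, Complex.I_im, Complex.zero_re,
        Complex.zero_im] at hre him
      rcases mul_eq_zero.1 (show t * (1 - t) = 0 by linarith) with rfl | ht1
      · norm_num at hre
      · obtain rfl : t = 1 := by linarith
        obtain rfl : s = 0 := by linarith
        simp at hw'
  · refine ⟨0, by simp, fun hw _ t ht h0 ↦ ?_⟩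
    rw [smul_zero, add_zero] at h0
    rcases ht.1.eq_or_lt with rfl | ht0
    · simp [hw] at h0
    · refine hneg ⟨(1 - t) / t, div_nonneg (sub_nonneg.2 ht.2) ht0.le, ?_⟩
      have htc : (t : ℂ) ≠ 0 := by exact_mod_cast ht0.ne'
      simp only [Complex.real_smul] at h0
      push_cast at h0 ⊢
      field_simp
      linear_combination h0

variable {E : Type*} [NormedAddCommGroup E] [NormedSpace ℝ E] {w w' ξ : E} {t : ℝ}

/-- The segment from `w` to `w'`, bent in the direction `ξ`. A suitable bending makes it avoid
given coordinate hyperplanes of `ℂⁿ`. -/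
def quadraticPath (w w' ξ : E) (t : ℝ) : E := (1 - t) • w + t • w' + (t * (1 - t)) • ξ

lemma quadraticPath_zero : quadraticPath w w' ξ 0 = w := by simp [quadraticPath]

lemma quadraticPath_one : quadraticPath w w' ξ 1 = w' := by simp [quadraticPath]

lemma contDiff_quadraticPath : ContDiff ℝ 1 (quadraticPath w w' ξ) := by
  unfold quadraticPath
  fun_prop

lemma deriv_quadraticPath : deriv (quadraticPath w w' ξ) t = (w' - w) + (1 - 2 * t) • ξ := by
  have hid := hasDerivAt_id t
  have hflip := hid.const_sub 1
  have hder : HasDerivAt (quadraticPath w w' ξ)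
      ((-1 : ℝ) • w + (1 : ℝ) • w' + (1 * (1 - t) + t * (-1)) • ξ) t :=
    ((hflip.smul_const w).add (hid.smul_const w')).add ((hid.mul hflip).smul_const ξ)
  rw [hder.deriv]
  module

lemma norm_deriv_quadraticPath_le (hξ : ‖ξ‖ ≤ ‖w - w'‖) (ht : t ∈ Icc (0 : ℝ) 1) :
    ‖deriv (quadraticPath w w' ξ) t‖ ≤ 2 * ‖w - w'‖ := by
  have hone : ‖1 - 2 * t‖ ≤ 1 := by
    rw [Real.norm_eq_abs, abs_le]
    constructor <;> linarith [ht.1, ht.2]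
  calc ‖deriv (quadraticPath w w' ξ) t‖ ≤ ‖w' - w‖ + ‖1 - 2 * t‖ * ‖ξ‖ := by
        rw [deriv_quadraticPath, ← norm_smul]
        exact norm_add_le _ _
    _ ≤ ‖w - w'‖ + 1 * ‖w - w'‖ := by
        rw [norm_sub_rev]
        gcongr
    _ = 2 * ‖w - w'‖ := by ring

lemma norm_quadraticPath_sub_le (hξ : ‖ξ‖ ≤ ‖w - w'‖) (ht : t ∈ Icc (0 : ℝ) 1) :
    ‖quadraticPath w w' ξ t - w‖ ≤ 2 * ‖w - w'‖ := by
  have hle := (convex_Icc (0 : ℝ) 1).norm_image_sub_le_of_norm_deriv_le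
    (fun s _ ↦ (contDiff_quadraticPath.differentiable one_ne_zero) s)
    (fun s hs ↦ norm_deriv_quadraticPath_le hξ hs) ⟨le_rfl, zero_le_one⟩ ht
  rw [quadraticPath_zero, sub_zero, Real.norm_of_nonneg ht.1] at hle
  exact hle.trans (mul_le_of_le_one_right (by positivity) ht.2)

lemma exists_quadraticPath_apply_ne_zero {n : ℕ} (w w' : Cn n) :
    ∃ ξ : Cn n, ‖ξ‖ ≤ ‖w - w'‖ ∧ ∀ j, w j ≠ 0 → w' j ≠ 0 → ∀ t ∈ Icc (0 : ℝ) 1,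
      quadraticPath w w' ξ t j ≠ 0 := by
  choose ξ hξ hne using fun j ↦ exists_norm_le_forall_bent_segment_ne_zero (w j) (w' j)
  refine ⟨WithLp.toLp 2 ξ, ?_, hne⟩
  rw [EuclideanSpace.norm_eq, EuclideanSpace.norm_eq]
  exact Real.sqrt_le_sqrt (Finset.sum_le_sum fun j _ ↦ pow_le_pow_left₀ (norm_nonneg _) (hξ j) 2)

end QuadraticPath

lemma mapsTo_Icc_of_forall_mapsTo_imp {X : Type*} [TopologicalSpace X] {γ : ℝ → X} {a b : ℝ}
    (hγ : ContinuousOn γ (Icc a b)) {K V : Set X} (hK : IsClosed K) (hV : IsOpen V) (hKV : K ⊆ V)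
    (ha : γ a ∈ V) (h : ∀ t ∈ Icc a b, MapsTo γ (Icc a t) V → γ t ∈ K) :
    MapsTo γ (Icc a b) V := by
  by_contra hcon
  simp only [MapsTo, not_forall] at hcon
  obtain ⟨t, ht, htV⟩ := hcon
  have hcompact : IsCompact (Icc a b ∩ γ ⁻¹' Vᶜ) := isCompact_Icc.of_isClosed_subset
    (hγ.preimage_isClosed_of_isClosed isClosed_Icc hV.isClosed_compl) inter_subset_left
  obtain ⟨τ, ⟨hτ, hτV⟩, hmin⟩ := hcompact.exists_isLeast ⟨t, ht, htV⟩
  have hbefore : ∀ s ∈ Ico a τ, γ s ∈ V := fun s hs ↦ by_contra fun hsV ↦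
    hs.2.not_ge (hmin ⟨⟨hs.1, hs.2.le.trans hτ.2⟩, hsV⟩)
  have haτ : a < τ := hτ.1.lt_of_ne fun h0 ↦ hτV (h0 ▸ ha)
  have hmaps : MapsTo γ (Ico a τ) K := fun s hs ↦
    h s ⟨hs.1, hs.2.le.trans hτ.2⟩ fun s' hs' ↦ hbefore s' ⟨hs'.1, hs'.2.trans_lt hs.2⟩
  have hlim : ContinuousWithinAt γ (Ico a τ) τ :=
    (hγ τ hτ).mono fun s hs ↦ ⟨hs.1, hs.2.le.trans hτ.2⟩
  have hτK := hlim.mem_closure (by rw [closure_Ico haτ.ne]; exact ⟨haτ.le, le_rfl⟩) hmaps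
  exact hτV (hKV (hK.closure_eq ▸ hτK))

section ConeChart

variable {n : ℕ} {X : Type*} [TopologicalSpace X] [ChartedSpace (Cn n) X]

/-- A chart of `X`, continuously differentiable in both directions away from `D`, in which `g` is
`L`-bi-Lipschitz equivalent to the flat metric and `D` is a union of coordinate hyperplanes. Near
`D` this is a coordinate system of the cone metric, not a holomorphic chart of `X`. -/
structure IsConeChart (g : BilinField n X) (D : Set X) (L : ℝ)
    (Ψ : OpenPartialHomeomorph X (Cn n)) : Prop where
  contMDiffOn : ContMDiffOn 𝓘(ℝ, Cn n) 𝓘(ℝ, Cn n) 1 Ψ (Ψ.source ∩ Dᶜ)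
  contMDiffOn_symm : ContMDiffOn 𝓘(ℝ, Cn n) 𝓘(ℝ, Cn n) 1 Ψ.symm (Ψ.target ∩ Ψ.symm ⁻¹' Dᶜ)
  le_pullback : ∀ w ∈ Ψ.target, Ψ.symm w ∉ D → ∀ v : Cn n,
    ‖v‖ ^ 2 ≤ L ^ 2 * pullbackMetric g Ψ.symm w v v
  pullback_le : ∀ w ∈ Ψ.target, Ψ.symm w ∉ D → ∀ v : Cn n,
    pullbackMetric g Ψ.symm w v v ≤ L ^ 2 * ‖v‖ ^ 2
  divisor : ∃ J : Set (Fin n), ∀ w ∈ Ψ.target, Ψ.symm w ∈ D ↔ ∃ j ∈ J, w j = 0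

variable {g : BilinField n X} {D : Set X} {L : ℝ} {Ψ : OpenPartialHomeomorph X (Cn n)}

lemma pathVelocity_comp {F : Cn n → X} {c : ℝ → Cn n} {t : ℝ}
    (hF : MDifferentiableAt 𝓘(ℝ, Cn n) 𝓘(ℝ, Cn n) F (c t)) (hc : DifferentiableAt ℝ c t) :
    pathVelocity (F ∘ c) t = realDifferential F (c t) (deriv c t) := by
  rw [pathVelocity, mfderiv_comp t hF hc.mdifferentiableAt, mfderiv_eq_fderiv]
  rfl

lemma pullbackMetric_apply (F : Cn n → X) (z v w : Cn n) :
    pullbackMetric g F z v w = g (F z) (realDifferential F z v) (realDifferential F z w) := rfl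

namespace IsConeChart

lemma mono (h : IsConeChart g D L Ψ) (hL : 0 < L) {L' : ℝ} (hLL : L ≤ L') :
    IsConeChart g D L' Ψ where
  contMDiffOn := h.contMDiffOn
  contMDiffOn_symm := h.contMDiffOn_symm
  le_pullback w hw hwD v := by
    have hle := h.le_pullback w hw hwD v
    have hnonneg : 0 ≤ pullbackMetric g Ψ.symm w v v :=
      nonneg_of_mul_nonneg_right ((sq_nonneg ‖v‖).trans hle) (by positivity)
    exact hle.trans (by gcongr)
  pullback_le w hw hwD v := (h.pullback_le w hw hwD v).trans (by gcongr)
  divisor := h.divisor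

lemma mdifferentiableAt_symm (h : IsConeChart g D L Ψ) (hD : IsClosed D) {w : Cn n}
    (hw : w ∈ Ψ.target) (hwD : Ψ.symm w ∉ D) :
    MDifferentiableAt 𝓘(ℝ, Cn n) 𝓘(ℝ, Cn n) Ψ.symm w :=
  (h.contMDiffOn_symm.contMDiffAt
    ((Ψ.isOpen_inter_preimage_symm hD.isOpen_compl).mem_nhds ⟨hw, hwD⟩)).mdifferentiableAt
    one_ne_zero

lemma gLengthOn_symm_comp_le (h : IsConeChart g D L Ψ) (hD : IsClosed D) (hL : 0 ≤ L)
    {c : ℝ → Cn n} (hc : Differentiable ℝ c) {a b C : ℝ}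
    (hmaps : MapsTo c (Icc a b) (Ψ.target ∩ Ψ.symm ⁻¹' Dᶜ)) (hC : ∀ t ∈ Icc a b, ‖deriv c t‖ ≤ C) :
    gLengthOn g (Ψ.symm ∘ c) a b ≤ ENNReal.ofReal (L * C) * ENNReal.ofReal (b - a) := by
  rw [← Real.volume_Icc, ← setLIntegral_const]
  refine setLIntegral_mono' measurableSet_Icc fun t ht ↦ ENNReal.ofReal_le_ofReal ?_
  have hC0 : 0 ≤ C := (norm_nonneg _).trans (hC t ht)
  obtain ⟨hcT, hcD⟩ := hmaps ht
  rw [pathVelocity_comp (h.mdifferentiableAt_symm hD hcT hcD) (hc t)]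
  refine Real.sqrt_le_iff.2 ⟨by positivity, ?_⟩
  calc pullbackMetric g Ψ.symm (c t) (deriv c t) (deriv c t) ≤ L ^ 2 * ‖deriv c t‖ ^ 2 :=
        h.pullback_le (c t) hcT hcD (deriv c t)
    _ ≤ L ^ 2 * C ^ 2 := by gcongr; exact hC t ht
    _ = (L * C) ^ 2 := by ring

lemma riemannianEDistOn_symm_le (h : IsConeChart g D L Ψ) (hD : IsClosed D) (hL : 0 ≤ L)
    {p : Cn n} {ρ : ℝ} (hρ : Metric.ball p (5 * ρ) ⊆ Ψ.target) {w w' : Cn n}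
    (hw : w ∈ Metric.ball p ρ) (hw' : w' ∈ Metric.ball p ρ) (hwD : Ψ.symm w ∉ D)
    (hwD' : Ψ.symm w' ∉ D) :
    riemannianEDistOn g Dᶜ (Ψ.symm w) (Ψ.symm w') ≤ ENNReal.ofReal (2 * L * ‖w - w'‖) := by
  obtain ⟨J, hJ⟩ := h.divisor
  obtain ⟨ξ, hξ, hne⟩ := exists_quadraticPath_apply_ne_zero w w'
  have hww : ‖w - w'‖ < 2 * ρ := by
    rw [← dist_eq_norm]
    linarith [dist_triangle_right w w' p, Metric.mem_ball.1 hw, Metric.mem_ball.1 hw']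
  have hcT : ∀ t ∈ Icc (0 : ℝ) 1, quadraticPath w w' ξ t ∈ Ψ.target := fun t ht ↦
    hρ (mem_ball_iff_norm.2 (by
      linarith [norm_sub_le_norm_sub_add_norm_sub (quadraticPath w w' ξ t) w p,
        norm_quadraticPath_sub_le hξ ht, mem_ball_iff_norm.1 hw]))
  have hcD : ∀ t ∈ Icc (0 : ℝ) 1, Ψ.symm (quadraticPath w w' ξ t) ∉ D := fun t ht ↦ by
    rw [hJ _ (hcT t ht)]
    rintro ⟨j, hj, h0⟩
    have hwT : w ∈ Ψ.target := by simpa [quadraticPath_zero] using hcT 0 (by simp)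
    have hwT' : w' ∈ Ψ.target := by simpa [quadraticPath_one] using hcT 1 (by simp)
    exact hne j (fun h ↦ hwD ((hJ w hwT).2 ⟨j, hj, h⟩))
      (fun h ↦ hwD' ((hJ w' hwT').2 ⟨j, hj, h⟩)) t ht h0
  have hmaps : MapsTo (quadraticPath w w' ξ) (Icc 0 1) (Ψ.target ∩ Ψ.symm ⁻¹' Dᶜ) :=
    fun t ht ↦ ⟨hcT t ht, hcD t ht⟩
  calc riemannianEDistOn g Dᶜ (Ψ.symm w) (Ψ.symm w')
      = riemannianEDistOn g Dᶜ ((Ψ.symm ∘ quadraticPath w w' ξ) 0)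
          ((Ψ.symm ∘ quadraticPath w w' ξ) 1) := by
        simp only [Function.comp_apply, quadraticPath_zero, quadraticPath_one]
    _ ≤ gLengthOn g (Ψ.symm ∘ quadraticPath w w' ξ) 0 1 :=
        riemannianEDistOn_le_gLength (h.contMDiffOn_symm.comp
          (contMDiff_iff_contDiff.2 contDiff_quadraticPath).contMDiffOn hmaps) hcD
    _ ≤ ENNReal.ofReal (L * (2 * ‖w - w'‖)) * ENNReal.ofReal (1 - 0) :=
        h.gLengthOn_symm_comp_le hD hL (contDiff_quadraticPath.differentiable one_ne_zero) hmaps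
          fun t ht ↦ norm_deriv_quadraticPath_le hξ ht
    _ = ENNReal.ofReal (2 * L * ‖w - w'‖) := by
        rw [sub_zero, ENNReal.ofReal_one, mul_one]
        ring_nf

lemma enorm_sub_le_gLengthOn (h : IsConeChart g D L Ψ) (hD : IsClosed D) (hL : 0 ≤ L)
    {γ : ℝ → X} {a b : ℝ} (hab : a ≤ b)
    (hγ : ContMDiffOn 𝓘(ℝ, ℝ) 𝓘(ℝ, Cn n) 1 γ (Icc a b)) (hγD : MapsTo γ (Icc a b) Dᶜ)
    (hγs : MapsTo γ (Icc a b) Ψ.source) :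
    ‖Ψ (γ b) - Ψ (γ a)‖ₑ ≤ ENNReal.ofReal L * gLengthOn g γ a b := by
  set c : ℝ → Cn n := Ψ ∘ γ
  have hc : ContDiffOn ℝ 1 c (Icc a b) := by
    rw [← contMDiffOn_iff_contDiffOn]
    exact h.contMDiffOn.comp hγ fun t ht ↦ ⟨hγs ht, hγD ht⟩
  refine (enorm_sub_le_lintegral_deriv_of_contDiffOn_Icc hc hab).trans ?_
  rw [gLengthOn, ← lintegral_const_mul' _ _ ENNReal.ofReal_ne_top, ← restrict_Ioo_eq_restrict_Icc]
  refine setLIntegral_mono' measurableSet_Ioo fun t ht ↦ ?_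
  have hnhds : Icc a b ∈ 𝓝 t := Icc_mem_nhds ht.1 ht.2
  have hmem := Ioo_subset_Icc_self ht
  have hcT : c t ∈ Ψ.target := Ψ.map_source (hγs hmem)
  have hcγ : Ψ.symm (c t) = γ t := Ψ.left_inv (hγs hmem)
  have hcD : Ψ.symm (c t) ∉ D := by rw [hcγ]; exact hγD hmem
  have heq : Ψ.symm ∘ c =ᶠ[𝓝 t] γ := by
    filter_upwards [hnhds] with s hs using Ψ.left_inv (hγs hs)
  have hvel : pathVelocity γ t = realDifferential Ψ.symm (c t) (deriv c t) := by
    rw [← pathVelocity_comp (h.mdifferentiableAt_symm hD hcT hcD)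
      ((hc.contDiffAt hnhds).differentiableAt one_ne_zero)]
    unfold pathVelocity
    rw [heq.mfderiv_eq]
    rfl
  have hle := h.le_pullback (c t) hcT hcD (deriv c t)
  rw [pullbackMetric_apply, hcγ, ← hvel] at hle
  rw [← ofReal_norm, ← ENNReal.ofReal_mul hL]
  refine ENNReal.ofReal_le_ofReal ?_
  rw [← Real.sqrt_sq hL, ← Real.sqrt_mul (sq_nonneg L)]
  exact Real.le_sqrt_of_sq_le hle

lemma norm_sub_le_toReal_gLengthOn (h : IsConeChart g D L Ψ) (hD : IsClosed D) (hL : 0 ≤ L)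
    {γ : ℝ → X} (hγ : ContMDiffOn 𝓘(ℝ, ℝ) 𝓘(ℝ, Cn n) 1 γ (Icc 0 1)) (hγD : MapsTo γ (Icc 0 1) Dᶜ)
    (hfin : gLengthOn g γ 0 1 ≠ ⊤) {t : ℝ} (ht : t ∈ Icc (0 : ℝ) 1)
    (hγs : MapsTo γ (Icc 0 t) Ψ.source) :
    ‖Ψ (γ t) - Ψ (γ 0)‖ ≤ L * (gLengthOn g γ 0 1).toReal := by
  have hsub : Icc 0 t ⊆ Icc 0 1 := Icc_subset_Icc le_rfl ht.2
  have hle : ‖Ψ (γ t) - Ψ (γ 0)‖ₑ ≤ ENNReal.ofReal L * gLengthOn g γ 0 1 :=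
    (h.enorm_sub_le_gLengthOn hD hL ht.1 (hγ.mono hsub) (hγD.mono hsub Subset.rfl) hγs).trans
      (mul_le_mul_right (lintegral_mono_set hsub) _)
  rwa [← ENNReal.ofReal_toReal hfin, ← ENNReal.ofReal_mul hL, ← ofReal_norm,
    ENNReal.ofReal_le_ofReal_iff (by positivity)] at hle

lemma mem_source_of_gLengthOn_lt [T2Space X] (h : IsConeChart g D L Ψ) (hD : IsClosed D)
    (hL : 0 < L) {γ : ℝ → X} (hγ : ContMDiffOn 𝓘(ℝ, ℝ) 𝓘(ℝ, Cn n) 1 γ (Icc 0 1))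
    (hγD : MapsTo γ (Icc 0 1) Dᶜ) {ρ r : ℝ} (h0 : γ 0 ∈ Ψ.source)
    (hρ : Metric.ball (Ψ (γ 0)) ρ ⊆ Ψ.target) (hlen : gLengthOn g γ 0 1 < ENNReal.ofReal r)
    (hr : L * r ≤ ρ) : γ 1 ∈ Ψ.source ∧ ‖Ψ (γ 1) - Ψ (γ 0)‖ ≤ L * r := by
  set ℓ : ℝ := (gLengthOn g γ 0 1).toReal
  have hℓr : ℓ < r := (ENNReal.lt_ofReal_iff_toReal_lt hlen.ne_top).1 hlen
  have hLℓ : L * ℓ < ρ := (mul_lt_mul_of_pos_left hℓr hL).trans_le hr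
  have hρ0 : 0 < ρ := lt_of_le_of_lt (by positivity) hLℓ
  have hest {t : ℝ} (ht : t ∈ Icc (0 : ℝ) 1) (hmaps : MapsTo γ (Icc 0 t) Ψ.source) :
      ‖Ψ (γ t) - Ψ (γ 0)‖ ≤ L * ℓ :=
    h.norm_sub_le_toReal_gLengthOn hD hL.le hγ hγD hlen.ne_top ht hmaps
  have hball : Metric.closedBall (Ψ (γ 0)) (L * ℓ) ⊆ Metric.ball (Ψ (γ 0)) ρ :=
    Metric.closedBall_subset_ball hLℓ
  have hstay : MapsTo γ (Icc 0 1) (Ψ.source ∩ Ψ ⁻¹' Metric.ball (Ψ (γ 0)) ρ) := by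
    refine mapsTo_Icc_of_forall_mapsTo_imp hγ.continuousOn
      (K := Ψ.symm '' Metric.closedBall (Ψ (γ 0)) (L * ℓ))
      ((isCompact_closedBall _ _).image_of_continuousOn
        (Ψ.continuousOn_symm.mono (hball.trans hρ))).isClosed
      (Ψ.isOpen_inter_preimage Metric.isOpen_ball) ?_ ⟨h0, Metric.mem_ball_self hρ0⟩
      fun t ht hmaps ↦ ?_
    · rintro _ ⟨w, hw, rfl⟩
      have hwT := hρ (hball hw)
      exact ⟨Ψ.map_target hwT, by rw [mem_preimage, Ψ.right_inv hwT]; exact hball hw⟩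
    · exact ⟨Ψ (γ t), mem_closedBall_iff_norm.2 (hest ht fun s hs ↦ (hmaps hs).1),
        Ψ.left_inv (hmaps ⟨ht.1, le_rfl⟩).1⟩
  have h1 : (1 : ℝ) ∈ Icc (0 : ℝ) 1 := ⟨zero_le_one, le_rfl⟩
  exact ⟨(hstay h1).1, (hest h1 fun s hs ↦ (hstay hs).1).trans (by gcongr)⟩

lemma mem_source_of_riemannianEDistOn_lt [T2Space X] (h : IsConeChart g D L Ψ) (hD : IsClosed D)
    (hL : 0 < L) {x y : X} {ρ r : ℝ} (hx : x ∈ Ψ.source) (hρ : Metric.ball (Ψ x) ρ ⊆ Ψ.target)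
    (hlen : riemannianEDistOn g Dᶜ x y < ENNReal.ofReal r) (hr : L * r ≤ ρ) :
    y ∈ Ψ.source ∧ ‖Ψ y - Ψ x‖ ≤ L * r := by
  obtain ⟨γ, hγ, hγD, rfl, rfl, hlt⟩ := exists_path_of_riemannianEDistOn_lt hlen
  exact h.mem_source_of_gLengthOn_lt hD hL hγ hγD hx hρ hlt hr

end IsConeChart

end ConeChart

section DenseLengthDist

variable {X : Type*} [TopologicalSpace X] {d : X → X → ℝ} {S : Set X}

lemma IsLengthDist.of_dense (hS : Dense S) (hself : ∀ x, d x x = 0) (hsymm : ∀ x y, d x y = d y x)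
    (htri : ∀ x y z, d x z ≤ d x y + d y z) (hcont : Continuous fun p : X × X ↦ d p.1 p.2)
    (hbetween : ∀ x ∈ S, ∀ y ∈ S, ∀ a b, 0 < a → 0 < b → d x y < a + b →
      ∃ z, d x z < a ∧ d z y < b) : IsLengthDist d := by
  refine ⟨hself, hsymm, htri, hcont, fun x y a b ha hb hab ↦ ?_⟩
  obtain ⟨ε, hε0, hε⟩ := _root_.exists_between
    (show 0 < min (min a b) ((a + b - d x y) / 4) by
      have : 0 < a + b - d x y := by linarith
      positivity)
  obtain ⟨⟨hεa, hεb⟩, hεab⟩ : (ε < a ∧ ε < b) ∧ ε < (a + b - d x y) / 4 := by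
    simpa only [lt_min_iff] using hε
  have happrox (x : X) : ∃ x' ∈ S, d x x' < ε :=
    hS.exists_mem_open (isOpen_lt (hcont.comp (.prodMk_right x)) continuous_const)
      ⟨x, (hself x).trans_lt hε0⟩
  obtain ⟨x', hx'S, hx'⟩ := happrox x
  obtain ⟨y', hy'S, hy'⟩ := happrox y
  obtain ⟨z, hxz, hzy⟩ := hbetween x' hx'S y' hy'S (a - ε) (b - ε) (by linarith) (by linarith)
    (by linarith [htri x' x y', htri x y y', hsymm x x'])
  exact ⟨z, by linarith [htri x x' z], by linarith [htri z y' y, hsymm y y']⟩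

lemma exists_between_of_continuousOn_path {f g : ℝ → ℝ} (hg : ContinuousOn g (Icc 0 1))
    (hf0 : f 0 = 0) (hg1 : g 1 = 0) {a b : ℝ} (ha : 0 < a) (hb : 0 < b) {r : ℝ} (hr : r < a + b)
    (hsum : ∀ t ∈ Icc (0 : ℝ) 1, f t + g t < r) :
    ∃ t ∈ Icc (0 : ℝ) 1, f t < a ∧ g t < b := by
  rcases lt_or_ge r a with hra | har
  · have h1 := hsum 1 (by simp)
    exact ⟨1, by simp, by linarith, by linarith⟩
  rcases lt_or_ge (g 0) (r - a) with h0 | h0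
  · exact ⟨0, by simp, by linarith, by linarith⟩
  · obtain ⟨t, ht, hgt⟩ := intermediate_value_Icc' zero_le_one hg
      (show r - a ∈ Icc (g 1) (g 0) from ⟨by linarith, h0⟩)
    exact ⟨t, ht, by linarith [hsum t ht], by linarith⟩

end DenseLengthDist

section ConicalDist

lemma ae_forall_apply_ne_zero (n : ℕ) : ∀ᵐ w : Cn n, ∀ j, w j ≠ 0 := by
  refine ae_all_iff.2 fun j ↦ ?_
  let S : Submodule ℝ (Cn n) :=
    LinearMap.ker ((EuclideanSpace.proj j : Cn n →L[ℂ] ℂ).restrictScalars ℝ).toLinearMap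
  have hS : S ≠ ⊤ := by
    intro hS
    have hmem : EuclideanSpace.single j (1 : ℂ) ∈ S := hS ▸ Submodule.mem_top
    simp [S] at hmem
  exact measure_eq_zero_iff_ae_notMem.1 (Measure.addHaar_submodule volume S hS)

variable {n : ℕ} {X : Type*} [TopologicalSpace X] [ChartedSpace (Cn n) X]
  {g : BilinField n X} {D : Set X} {L ρ : ℝ}

lemma IsConeChart.target_subset_closure {Ψ : OpenPartialHomeomorph X (Cn n)}
    (h : IsConeChart g D L Ψ) : Ψ.target ⊆ closure (Ψ.target ∩ Ψ.symm ⁻¹' Dᶜ) := by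
  obtain ⟨J, hJ⟩ := h.divisor
  have hdense : Dense {w : Cn n | ∀ j, w j ≠ 0} :=
    Measure.dense_of_ae (ae_forall_apply_ne_zero n)
  refine (hdense.open_subset_closure_inter Ψ.open_target).trans (closure_mono ?_)
  rintro w ⟨hw, hw0⟩
  refine ⟨hw, fun hwD ↦ ?_⟩
  obtain ⟨j, -, hj⟩ := (hJ w hw).1 hwD
  exact hw0 j hj

/-- Every point is the centre of a cone chart of size `ρ` with constant `L`. Compactness of the
divisor and the ALE condition provide this for a conical metric; all the geometry of
`(X, d_g, μ_g)` is then read in these charts. -/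
def HasUniformConeCharts (g : BilinField n X) (D : Set X) (L ρ : ℝ) : Prop :=
  ∀ x, ∃ Ψ : OpenPartialHomeomorph X (Cn n), IsConeChart g D L Ψ ∧ x ∈ Ψ.source ∧
    Metric.ball (Ψ x) ρ ⊆ Ψ.target

namespace HasUniformConeCharts

variable (hu : HasUniformConeCharts g D L ρ)
include hu

lemma dense_compl : Dense Dᶜ := by
  intro x
  obtain ⟨Ψ, h, hx, -⟩ := hu x
  have hclosure : Ψ x ∈ closure (Ψ.target ∩ Ψ.symm ⁻¹' Dᶜ) :=
    h.target_subset_closure (Ψ.map_source hx)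
  have hcont : ContinuousWithinAt Ψ.symm (Ψ.target ∩ Ψ.symm ⁻¹' Dᶜ) (Ψ x) :=
    (Ψ.continuousOn_symm _ (Ψ.map_source hx)).mono inter_subset_left
  have hmem := hcont.mem_closure hclosure (t := Dᶜ) fun w hw ↦ hw.2
  rwa [Ψ.left_inv hx] at hmem

variable (hD : IsClosed D) (hL : 0 < L) (hρ : 0 < ρ)
include hD hL hρ

lemma exists_nhds_riemannianEDistOn_le {ε : ℝ} (hε : 0 < ε) (p : X) :
    ∃ V ∈ 𝓝 p, ∀ x ∈ V ∩ Dᶜ, ∀ y ∈ V ∩ Dᶜ, riemannianEDistOn g Dᶜ x y ≤ ENNReal.ofReal ε := by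
  obtain ⟨Ψ, h, hp, hball⟩ := hu p
  set δ : ℝ := min (ρ / 5) (ε / (4 * L))
  have hδ : 0 < δ := by positivity
  have hδρ : 5 * δ ≤ ρ := by linarith [min_le_left (ρ / 5) (ε / (4 * L))]
  have hδε : 2 * L * (2 * δ) ≤ ε := by
    have hle : δ * (4 * L) ≤ ε := (le_div_iff₀ (by positivity)).1 (min_le_right _ _)
    linarith
  refine ⟨Ψ.source ∩ Ψ ⁻¹' Metric.ball (Ψ p) δ,
    (Ψ.isOpen_inter_preimage Metric.isOpen_ball).mem_nhds ⟨hp, Metric.mem_ball_self hδ⟩, ?_⟩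
  rintro x ⟨⟨hxs, hxb⟩, hxD⟩ y ⟨⟨hys, hyb⟩, hyD⟩
  have hdist : ‖Ψ x - Ψ y‖ ≤ 2 * δ := by
    rw [← dist_eq_norm]
    linarith [dist_triangle_right (Ψ x) (Ψ y) (Ψ p), Metric.mem_ball.1 hxb, Metric.mem_ball.1 hyb]
  have hle := h.riemannianEDistOn_symm_le hD hL.le
    ((Metric.ball_subset_ball hδρ).trans hball) hxb hyb (by rwa [Ψ.left_inv hxs])
    (by rwa [Ψ.left_inv hys])
  rw [Ψ.left_inv hxs, Ψ.left_inv hys] at hle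
  exact hle.trans (ENNReal.ofReal_le_ofReal (le_trans (by gcongr) hδε))

variable [PreconnectedSpace X]

lemma riemannianEDistOn_lt_top {x y : X} (hx : x ∈ Dᶜ) (hy : y ∈ Dᶜ) :
    riemannianEDistOn g Dᶜ x y < ⊤ := by
  have hnear (p : X) : ∃ V ∈ 𝓝 p, ∀ x ∈ V ∩ Dᶜ, ∀ y ∈ V ∩ Dᶜ, riemannianEDistOn g Dᶜ x y < ⊤ := by
    obtain ⟨V, hV, hle⟩ := hu.exists_nhds_riemannianEDistOn_le hD hL hρ one_pos p
    exact ⟨V, hV, fun x hx y hy ↦ (hle x hx y hy).trans_lt ENNReal.ofReal_lt_top⟩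
  set S : Set X := {p | ∃ U ∈ 𝓝 p, ∀ z ∈ U ∩ Dᶜ, riemannianEDistOn g Dᶜ x z < ⊤}
  have hopen : IsOpen S := by
    rw [isOpen_iff_mem_nhds]
    rintro p ⟨U, hU, hUS⟩
    filter_upwards [eventually_mem_nhds_iff.2 hU] with q hq using ⟨U, hq, hUS⟩
  have hclosed : IsClosed S := by
    refine isClosed_of_closure_subset fun p hp ↦ ?_
    obtain ⟨V, hV, hlt⟩ := hnear p
    obtain ⟨q, hqV, U, hU, hUS⟩ := mem_closure_iff_nhds.1 hp _ (interior_mem_nhds.2 hV)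
    obtain ⟨z, ⟨hzU, hzV⟩, hzD⟩ := mem_closure_iff_nhds.1 (hu.dense_compl q) (U ∩ V)
      (inter_mem hU (mem_interior_iff_mem_nhds.1 hqV))
    exact ⟨V, hV, fun z' hz' ↦ riemannianEDistOn_triangle.trans_lt
      (ENNReal.add_lt_top.2 ⟨hUS z ⟨hzU, hzD⟩, hlt z ⟨hzV, hzD⟩ z' hz'⟩)⟩
  obtain ⟨V, hV, hlt⟩ := hnear x
  have hxS : x ∈ S := ⟨V, hV, fun z hz ↦ hlt x ⟨mem_of_mem_nhds hV, hx⟩ z hz⟩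
  obtain ⟨U, hU, hUS⟩ : y ∈ S := IsClopen.eq_univ ⟨hclosed, hopen⟩ ⟨x, hxS⟩ ▸ mem_univ y
  exact hUS y ⟨mem_of_mem_nhds hU, hy⟩

lemma toReal_riemannianEDistOn_triangle {x y z : X} (hx : x ∈ Dᶜ) (hy : y ∈ Dᶜ) (hz : z ∈ Dᶜ) :
    (riemannianEDistOn g Dᶜ x z).toReal ≤
      (riemannianEDistOn g Dᶜ x y).toReal + (riemannianEDistOn g Dᶜ y z).toReal := by
  have hxy := (hu.riemannianEDistOn_lt_top hD hL hρ hx hy).ne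
  have hyz := (hu.riemannianEDistOn_lt_top hD hL hρ hy hz).ne
  rw [← ENNReal.toReal_add hxy hyz]
  exact ENNReal.toReal_mono (ENNReal.add_ne_top.2 ⟨hxy, hyz⟩) riemannianEDistOn_triangle

lemma exists_tendsto_toReal_riemannianEDistOn (p : X × X) : ∃ l : ℝ,
    Tendsto (fun p : X × X ↦ (riemannianEDistOn g Dᶜ p.1 p.2).toReal) (𝓝[Dᶜ ×ˢ Dᶜ] p) (𝓝 l) := by
  have hne : (𝓝[Dᶜ ×ˢ Dᶜ] p).NeBot :=
    mem_closure_iff_nhdsWithin_neBot.1 ((hu.dense_compl.prod hu.dense_compl) p)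
  rw [← cauchy_map_iff_exists_tendsto, Metric.cauchy_iff]
  refine ⟨inferInstance, fun ε hε ↦ ?_⟩
  have hnear (q : X) : ∃ V ∈ 𝓝 q, ∀ x ∈ V ∩ Dᶜ, ∀ y ∈ V ∩ Dᶜ,
      (riemannianEDistOn g Dᶜ x y).toReal ≤ ε / 3 := by
    obtain ⟨V, hV, hle⟩ := hu.exists_nhds_riemannianEDistOn_le hD hL hρ (div_pos hε three_pos) q
    exact ⟨V, hV, fun x hx y hy ↦
      ENNReal.toReal_le_of_le_ofReal (div_pos hε three_pos).le (hle x hx y hy)⟩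
  obtain ⟨V, hVn, hV⟩ := hnear p.1
  obtain ⟨W, hWn, hW⟩ := hnear p.2
  have hdiff : ∀ x ∈ V ∩ Dᶜ, ∀ x' ∈ V ∩ Dᶜ, ∀ y ∈ W ∩ Dᶜ, ∀ y' ∈ W ∩ Dᶜ,
      (riemannianEDistOn g Dᶜ x y).toReal - (riemannianEDistOn g Dᶜ x' y').toReal < ε := by
    intro x hx x' hx' y hy y' hy'
    linarith [hu.toReal_riemannianEDistOn_triangle hD hL hρ hx.2 hx'.2 hy.2,
      hu.toReal_riemannianEDistOn_triangle hD hL hρ hx'.2 hy'.2 hy.2, hV x hx x' hx',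
      hW y' hy' y hy]
  refine ⟨_, image_mem_map (inter_mem (nhdsWithin_le_nhds (prod_mem_nhds hVn hWn))
    self_mem_nhdsWithin), ?_⟩
  rintro _ ⟨⟨x, y⟩, ⟨⟨hx, hy⟩, hxD, hyD⟩, rfl⟩ _ ⟨⟨x', y'⟩, ⟨⟨hx', hy'⟩, hxD', hyD'⟩, rfl⟩
  refine abs_lt.2 ⟨?_, hdiff x ⟨hx, hxD⟩ x' ⟨hx', hxD'⟩ y ⟨hy, hyD⟩ y' ⟨hy', hyD'⟩⟩
  linarith [hdiff x' ⟨hx', hxD'⟩ x ⟨hx, hxD⟩ y' ⟨hy', hyD'⟩ y ⟨hy, hyD⟩]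

lemma continuous_conicalDist : Continuous fun p : X × X ↦ conicalDist g D p.1 p.2 :=
  continuous_extendFrom (hu.dense_compl.prod hu.dense_compl)
    (hu.exists_tendsto_toReal_riemannianEDistOn hD hL hρ)

lemma continuousOn_conicalDist {α : Type*} [TopologicalSpace α] {s : Set α} {f h : α → X}
    (hf : ContinuousOn f s) (hh : ContinuousOn h s) :
    ContinuousOn (fun t ↦ conicalDist g D (f t) (h t)) s :=
  Continuous.comp_continuousOn (g := fun p : X × X ↦ conicalDist g D p.1 p.2)
    (f := fun t ↦ (f t, h t)) (hu.continuous_conicalDist hD hL hρ) (hf.prodMk hh)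

lemma conicalDist_eq {x y : X} (hx : x ∈ Dᶜ) (hy : y ∈ Dᶜ) :
    conicalDist g D x y = (riemannianEDistOn g Dᶜ x y).toReal := by
  obtain ⟨l, hl⟩ := hu.exists_tendsto_toReal_riemannianEDistOn hD hL hρ (x, y)
  have hmem : (x, y) ∈ Dᶜ ×ˢ Dᶜ := ⟨hx, hy⟩
  have hval : (riemannianEDistOn g Dᶜ x y).toReal = l :=
    tendsto_nhds_unique (tendsto_pure_nhds
      (fun p : X × X ↦ (riemannianEDistOn g Dᶜ p.1 p.2).toReal) (x, y))
      (hl.mono_left (pure_le_nhdsWithin hmem))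
  rw [hval]
  exact extendFrom_eq (subset_closure hmem) hl

lemma ofReal_conicalDist {x y : X} (hx : x ∈ Dᶜ) (hy : y ∈ Dᶜ) :
    ENNReal.ofReal (conicalDist g D x y) = riemannianEDistOn g Dᶜ x y := by
  rw [hu.conicalDist_eq hD hL hρ hx hy,
    ENNReal.ofReal_toReal (hu.riemannianEDistOn_lt_top hD hL hρ hx hy).ne]

lemma conicalDist_self (x : X) : conicalDist g D x x = 0 := by
  have hcont := hu.continuous_conicalDist hD hL hρ
  have hclosed : IsClosed {x | conicalDist g D x x = 0} :=
    isClosed_eq (hcont.comp (by fun_prop : Continuous fun x ↦ (x, x))) continuous_const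
  refine hclosed.closure_subset_iff.2 (fun x hx ↦ ?_) (hu.dense_compl x)
  rw [mem_ofPred_eq, hu.conicalDist_eq hD hL hρ hx hx, riemannianEDistOn_self hx,
    ENNReal.toReal_zero]

lemma conicalDist_comm (x y : X) : conicalDist g D x y = conicalDist g D y x := by
  have hcont := hu.continuous_conicalDist hD hL hρ
  have hclosed : IsClosed {p : X × X | conicalDist g D p.1 p.2 = conicalDist g D p.2 p.1} :=
    isClosed_eq hcont (hcont.comp continuous_swap)
  refine hclosed.closure_subset_iff.2 (fun p hp ↦ ?_)
    ((hu.dense_compl.prod hu.dense_compl) (x, y))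
  rw [mem_ofPred_eq, hu.conicalDist_eq hD hL hρ hp.1 hp.2, hu.conicalDist_eq hD hL hρ hp.2 hp.1,
    riemannianEDistOn_comm]

lemma conicalDist_triangle (x y z : X) :
    conicalDist g D x z ≤ conicalDist g D x y + conicalDist g D y z := by
  have hcont := hu.continuous_conicalDist hD hL hρ
  have hclosed : IsClosed {p : X × X × X | conicalDist g D p.1 p.2.2 ≤
      conicalDist g D p.1 p.2.1 + conicalDist g D p.2.1 p.2.2} :=
    isClosed_le (hcont.comp (by fun_prop : Continuous fun p : X × X × X ↦ (p.1, p.2.2)))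
      ((hcont.comp (by fun_prop : Continuous fun p : X × X × X ↦ (p.1, p.2.1))).add
        (hcont.comp (by fun_prop : Continuous fun p : X × X × X ↦ (p.2.1, p.2.2))))
  refine hclosed.closure_subset_iff.2 (fun p hp ↦ ?_)
    ((hu.dense_compl.prod (hu.dense_compl.prod hu.dense_compl)) (x, y, z))
  obtain ⟨h1, h2, h3⟩ := hp
  rw [mem_ofPred_eq, hu.conicalDist_eq hD hL hρ h1 h3, hu.conicalDist_eq hD hL hρ h1 h2,
    hu.conicalDist_eq hD hL hρ h2 h3]
  exact hu.toReal_riemannianEDistOn_triangle hD hL hρ h1 h2 h3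

lemma exists_conicalDist_lt_of_lt_add {x y : X} (hx : x ∈ Dᶜ) (hy : y ∈ Dᶜ) {a b : ℝ} (ha : 0 < a)
    (hb : 0 < b) (hab : conicalDist g D x y < a + b) :
    ∃ z, conicalDist g D x z < a ∧ conicalDist g D z y < b := by
  obtain ⟨r, hr, hrab⟩ := exists_between (max_lt hab (add_pos ha hb))
  have hlt : riemannianEDistOn g Dᶜ x y < ENNReal.ofReal r := by
    rw [← hu.ofReal_conicalDist hD hL hρ hx hy]
    exact (ENNReal.ofReal_lt_ofReal_iff (le_max_right _ _ |>.trans_lt hr)).2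
      (le_max_left _ _ |>.trans_lt hr)
  obtain ⟨γ, hγ, hγD, h0, h1, hsum⟩ := exists_path_add_lt_of_riemannianEDistOn_lt hlt
  have hsum' : ∀ t ∈ Icc (0 : ℝ) 1, conicalDist g D x (γ t) + conicalDist g D (γ t) y < r := by
    intro t ht
    have hfin := (hu.riemannianEDistOn_lt_top hD hL hρ hx (hγD ht)).ne
    have hfin' := (hu.riemannianEDistOn_lt_top hD hL hρ (hγD ht) hy).ne
    rw [hu.conicalDist_eq hD hL hρ hx (hγD ht), hu.conicalDist_eq hD hL hρ (hγD ht) hy,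
      ← ENNReal.toReal_add hfin hfin']
    exact (ENNReal.lt_ofReal_iff_toReal_lt (ENNReal.add_ne_top.2 ⟨hfin, hfin'⟩)).1 (hsum t ht)
  have hstart : conicalDist g D x (γ 0) = 0 := h0 ▸ hu.conicalDist_self hD hL hρ x
  have hend : conicalDist g D (γ 1) y = 0 := h1 ▸ hu.conicalDist_self hD hL hρ y
  obtain ⟨t, -, hz⟩ := exists_between_of_continuousOn_path
    (f := fun t ↦ conicalDist g D x (γ t)) (g := fun t ↦ conicalDist g D (γ t) y)
    (hu.continuousOn_conicalDist hD hL hρ hγ continuousOn_const) hstart hend ha hb hrab hsum'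
  exact ⟨γ t, hz⟩

lemma isLengthDist : IsLengthDist (conicalDist g D) :=
  .of_dense hu.dense_compl (hu.conicalDist_self hD hL hρ) (hu.conicalDist_comm hD hL hρ)
    (hu.conicalDist_triangle hD hL hρ) (hu.continuous_conicalDist hD hL hρ)
    fun _ hx _ hy _ _ ha hb hab ↦ hu.exists_conicalDist_lt_of_lt_add hD hL hρ hx hy ha hb hab

variable {Ψ : OpenPartialHomeomorph X (Cn n)}

lemma conicalDist_symm_le (h : IsConeChart g D L Ψ) {p : Cn n} {δ : ℝ}
    (hball : Metric.ball p (5 * δ) ⊆ Ψ.target) {w w' : Cn n} (hw : w ∈ Metric.ball p δ)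
    (hw' : w' ∈ Metric.ball p δ) :
    conicalDist g D (Ψ.symm w) (Ψ.symm w') ≤ 2 * L * ‖w - w'‖ := by
  have hδ : 0 < δ := dist_nonneg.trans_lt (Metric.mem_ball.1 hw)
  have hsub : Metric.ball p δ ⊆ Ψ.target :=
    (Metric.ball_subset_ball (by linarith)).trans hball
  set G := Metric.ball p δ ∩ (Ψ.target ∩ Ψ.symm ⁻¹' Dᶜ)
  have hclosure : Metric.ball p δ ⊆ closure G := fun z hz ↦
    Metric.isOpen_ball.inter_closure ⟨hz, h.target_subset_closure (hsub hz)⟩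
  have hmem : (w, w') ∈ closure (G ×ˢ G) := by
    rw [closure_prod_eq]
    exact ⟨hclosure hw, hclosure hw'⟩
  have hcont : ContinuousOn (fun q : Cn n × Cn n ↦ conicalDist g D (Ψ.symm q.1) (Ψ.symm q.2))
      (Metric.ball p δ ×ˢ Metric.ball p δ) :=
    hu.continuousOn_conicalDist hD hL hρ
      ((Ψ.continuousOn_symm.mono hsub).comp continuousOn_fst fun q hq ↦ hq.1)
      ((Ψ.continuousOn_symm.mono hsub).comp continuousOn_snd fun q hq ↦ hq.2)
  have hle : ∀ q ∈ G ×ˢ G, conicalDist g D (Ψ.symm q.1) (Ψ.symm q.2) ≤ 2 * L * ‖q.1 - q.2‖ := by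
    intro q hq
    rw [hu.conicalDist_eq hD hL hρ hq.1.2.2 hq.2.2.2]
    exact ENNReal.toReal_le_of_le_ofReal (by positivity)
      (h.riemannianEDistOn_symm_le hD hL.le hball hq.1.1 hq.2.1 hq.1.2.2 hq.2.2.2)
  have hbound : ContinuousWithinAt (fun q : Cn n × Cn n ↦ 2 * L * ‖q.1 - q.2‖) (G ×ˢ G) (w, w') :=
    (by fun_prop : Continuous fun q : Cn n × Cn n ↦ 2 * L * ‖q.1 - q.2‖).continuousWithinAt
  exact ContinuousWithinAt.closure_le hmem
    ((hcont (w, w') ⟨hw, hw'⟩).mono (prod_mono inter_subset_left inter_subset_left)) hbound hle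

variable [T2Space X]

lemma norm_sub_le_conicalDist_of_mem_compl (h : IsConeChart g D L Ψ) {x y : X} {δ : ℝ}
    (hx : x ∈ Ψ.source) (hxD : x ∈ Dᶜ) (hyD : y ∈ Dᶜ) (hball : Metric.ball (Ψ x) δ ⊆ Ψ.target)
    (hxy : L * conicalDist g D x y < δ) :
    y ∈ Ψ.source ∧ ‖Ψ y - Ψ x‖ ≤ L * conicalDist g D x y := by
  have hlt : ∀ r, conicalDist g D x y < r → L * r ≤ δ → y ∈ Ψ.source ∧ ‖Ψ y - Ψ x‖ ≤ L * r := by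
    intro r hr hrδ
    refine h.mem_source_of_riemannianEDistOn_lt hD hL hx hball ?_ hrδ
    rw [← hu.ofReal_conicalDist hD hL hρ hxD hyD]
    exact (ENNReal.ofReal_lt_ofReal_iff
      (((hu.isLengthDist hD hL hρ).nonneg x y).trans_lt hr)).2 hr
  have hxy' : conicalDist g D x y < δ / L := (lt_div_iff₀' hL).2 hxy
  refine ⟨(hlt _ hxy' (mul_div_cancel₀ _ hL.ne').le).1, ?_⟩
  rw [← div_le_iff₀' hL]
  refine le_of_forall_gt_imp_ge_of_dense fun r hr ↦ ?_
  rw [div_le_iff₀' hL]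
  refine (hlt (min r (δ / L)) (lt_min hr hxy') ?_).2.trans ?_
  · exact (le_div_iff₀' hL).1 (min_le_right _ _)
  · gcongr
    exact min_le_left _ _

lemma eventually_norm_sub_le_conicalDist (h : IsConeChart g D L Ψ) {x y : X} {δ : ℝ}
    (hx : x ∈ Ψ.source) (hball : Metric.ball (Ψ x) (2 * δ) ⊆ Ψ.target)
    (hxy : L * conicalDist g D x y < δ) :
    ∀ᶠ q in 𝓝[Dᶜ ×ˢ Dᶜ] (x, y), q.2 ∈ Ψ.source ∧
      ‖Ψ q.2 - Ψ q.1‖ ≤ L * conicalDist g D q.1 q.2 ∧ ‖Ψ q.2 - Ψ x‖ ≤ 2 * δ := by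
  have hδ : 0 < δ :=
    (mul_nonneg hL.le ((hu.isLengthDist hD hL hρ).nonneg x y)).trans_lt hxy
  have hdist : ∀ᶠ q in 𝓝 (x, y), L * conicalDist g D q.1 q.2 < δ :=
    ((hu.continuous_conicalDist hD hL hρ).const_mul L).continuousAt.eventually_lt
      continuousAt_const hxy
  have hsource : ∀ᶠ q : X × X in 𝓝 (x, y), q.1 ∈ Ψ.source ∧ Ψ q.1 ∈ Metric.ball (Ψ x) δ :=
    (continuous_fst.tendsto (x, y)).eventually (Filter.Eventually.and (Ψ.open_source.mem_nhds hx)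
      ((Ψ.continuousAt hx).preimage_mem_nhds (Metric.ball_mem_nhds _ hδ)))
  filter_upwards [nhdsWithin_le_nhds hdist, nhdsWithin_le_nhds hsource, self_mem_nhdsWithin]
    with q hqδ ⟨hqs, hqx⟩ hqD
  have hqball : Metric.ball (Ψ q.1) δ ⊆ Ψ.target :=
    (Metric.ball_subset_ball' (by linarith [Metric.mem_ball.1 hqx])).trans hball
  obtain ⟨hmem, hle⟩ :=
    hu.norm_sub_le_conicalDist_of_mem_compl hD hL hρ h hqs hqD.1 hqD.2 hqball hqδ
  exact ⟨hmem, hle, by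
    linarith [norm_sub_le_norm_sub_add_norm_sub (Ψ q.2) (Ψ q.1) (Ψ x), mem_ball_iff_norm.1 hqx]⟩

lemma norm_sub_le_conicalDist (h : IsConeChart g D L Ψ) {x y : X} {δ : ℝ} (hx : x ∈ Ψ.source)
    (hball : Metric.ball (Ψ x) (3 * δ) ⊆ Ψ.target) (hxy : L * conicalDist g D x y < δ) :
    y ∈ Ψ.source ∧ ‖Ψ y - Ψ x‖ ≤ L * conicalDist g D x y := by
  have hδ : 0 < δ :=
    (mul_nonneg hL.le ((hu.isLengthDist hD hL hρ).nonneg x y)).trans_lt hxy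
  have hne : (𝓝[Dᶜ ×ˢ Dᶜ] (x, y)).NeBot :=
    mem_closure_iff_nhdsWithin_neBot.1 ((hu.dense_compl.prod hu.dense_compl) _)
  have hfst : Tendsto Prod.fst (𝓝[Dᶜ ×ˢ Dᶜ] (x, y)) (𝓝 x) :=
    (continuous_fst.tendsto (x, y)).mono_left nhdsWithin_le_nhds
  have hsnd : Tendsto Prod.snd (𝓝[Dᶜ ×ˢ Dᶜ] (x, y)) (𝓝 y) :=
    (continuous_snd.tendsto (x, y)).mono_left nhdsWithin_le_nhds
  have hnear := hu.eventually_norm_sub_le_conicalDist hD hL hρ h hx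
    ((Metric.ball_subset_ball (by linarith)).trans hball) hxy
  have hsub : Metric.closedBall (Ψ x) (2 * δ) ⊆ Ψ.target :=
    (Metric.closedBall_subset_ball (by linarith)).trans hball
  have hclosed : IsClosed (Ψ.symm '' Metric.closedBall (Ψ x) (2 * δ)) :=
    ((isCompact_closedBall _ _).image_of_continuousOn (Ψ.continuousOn_symm.mono hsub)).isClosed
  obtain ⟨w, hw, hwy⟩ : y ∈ Ψ.symm '' Metric.closedBall (Ψ x) (2 * δ) :=
    hclosed.mem_of_tendsto hsnd (hnear.mono fun q hq ↦
      ⟨Ψ q.2, mem_closedBall_iff_norm.2 hq.2.2, Ψ.left_inv hq.1⟩)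
  have hy : y ∈ Ψ.source := hwy ▸ Ψ.map_target (hsub hw)
  refine ⟨hy, le_of_tendsto_of_tendsto
    (((Ψ.continuousAt hy).tendsto.comp hsnd).sub ((Ψ.continuousAt hx).tendsto.comp hfst)).norm
    ((((hu.continuous_conicalDist hD hL hρ).const_mul L).tendsto (x, y)).mono_left
      nhdsWithin_le_nhds) (hnear.mono fun q hq ↦ hq.2.1)⟩

end HasUniformConeCharts

end ConicalDist

section GramDeterminant

open Matrix

variable {κ : Type*} [Fintype κ]

lemma pow_card_le_det_and_det_le_pow_card [DecidableEq κ] {H : Matrix κ κ ℝ}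
    (hH : H.IsHermitian) {a b : ℝ} (ha : 0 ≤ a) (hle : ∀ x : κ → ℝ, a * (x ⬝ᵥ x) ≤ x ⬝ᵥ H *ᵥ x)
    (hge : ∀ x : κ → ℝ, x ⬝ᵥ H *ᵥ x ≤ b * (x ⬝ᵥ x)) :
    a ^ Fintype.card κ ≤ H.det ∧ H.det ≤ b ^ Fintype.card κ := by
  have heig (i : κ) : a ≤ hH.eigenvalues i ∧ hH.eigenvalues i ≤ b := by
    have hunit : (hH.eigenvectorBasis i).ofLp ⬝ᵥ (hH.eigenvectorBasis i).ofLp = 1 := by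
      have h := real_inner_self_eq_norm_sq (hH.eigenvectorBasis i)
      rw [hH.eigenvectorBasis.orthonormal.1 i, EuclideanSpace.inner_eq_star_dotProduct] at h
      simpa using h
    have hquad := hH.eigenvalues_eq i
    simp only [star_trivial, RCLike.re_to_real] at hquad
    rw [hquad]
    exact ⟨by simpa [hunit] using hle (hH.eigenvectorBasis i).ofLp,
      by simpa [hunit] using hge (hH.eigenvectorBasis i).ofLp⟩
  rw [hH.det_eq_prod_eigenvalues, ← Finset.card_univ, ← Finset.prod_const, ← Finset.prod_const]
  exact ⟨Finset.prod_le_prod (fun _ _ ↦ ha) fun i _ ↦ (heig i).1,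
    Finset.prod_le_prod (fun i _ ↦ ha.trans (heig i).1) fun i _ ↦ (heig i).2⟩

variable {E : Type*} [NormedAddCommGroup E] [InnerProductSpace ℝ E] (e : OrthonormalBasis κ ℝ E)

lemma dotProduct_gram_mulVec (G : E →L[ℝ] E →L[ℝ] ℝ) (x : κ → ℝ) :
    x ⬝ᵥ (Matrix.of fun i j ↦ G (e i) (e j)) *ᵥ x = G (∑ i, x i • e i) (∑ i, x i • e i) := by
  simp only [dotProduct, mulVec, Matrix.of_apply, map_sum, map_smul, _root_.smul_apply, smul_eq_mul,
    Finset.mul_sum, _root_.sum_apply]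
  rw [Finset.sum_comm]
  exact Finset.sum_congr rfl fun i _ ↦ Finset.sum_congr rfl fun j _ ↦ by ring

lemma dotProduct_self_eq_norm_sum_sq (x : κ → ℝ) : x ⬝ᵥ x = ‖∑ i, x i • e i‖ ^ 2 := by
  simp only [dotProduct, ← real_inner_self_eq_norm_sq, e.orthonormal.inner_sum, conj_trivial]

lemma pow_card_le_det_gram [DecidableEq κ] {G : E →L[ℝ] E →L[ℝ] ℝ}
    (hsymm : ∀ v w, G v w = G w v) {a b : ℝ} (ha : 0 ≤ a) (hle : ∀ v, a * ‖v‖ ^ 2 ≤ G v v)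
    (hge : ∀ v, G v v ≤ b * ‖v‖ ^ 2) :
    a ^ Fintype.card κ ≤ (Matrix.of fun i j ↦ G (e i) (e j)).det ∧
      (Matrix.of fun i j ↦ G (e i) (e j)).det ≤ b ^ Fintype.card κ := by
  refine pow_card_le_det_and_det_le_pow_card ?_ ha (fun x ↦ ?_) fun x ↦ ?_
  · ext i j
    exact hsymm _ _
  · rw [dotProduct_gram_mulVec, dotProduct_self_eq_norm_sum_sq e]
    exact hle _
  · rw [dotProduct_gram_mulVec, dotProduct_self_eq_norm_sum_sq e]
    exact hge _

lemma det_gram_bilinearComp [DecidableEq κ] (G : E →L[ℝ] E →L[ℝ] ℝ) (A : E →L[ℝ] E) :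
    (Matrix.of fun i j ↦ G.bilinearComp A A (e i) (e j)).det =
      (Matrix.of fun i j ↦ G (e i) (e j)).det * A.det ^ 2 := by
  have hgram (G : E →L[ℝ] E →L[ℝ] ℝ) : (Matrix.of fun i j ↦ G (e i) (e j)) =
      LinearMap.toMatrix₂ e.toBasis e.toBasis G.toBilinForm := by
    ext i j
    simp [LinearMap.toMatrix₂_apply]
  have hcomp : (G.bilinearComp A A).toBilinForm =
      G.toBilinForm.compl₁₂ (A : E →ₗ[ℝ] E) (A : E →ₗ[ℝ] E) := rfl
  rw [hgram, hgram, hcomp, LinearMap.toMatrix₂_compl₁₂ e.toBasis e.toBasis, det_mul, det_mul,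
    det_transpose, LinearMap.det_toMatrix]
  change A.det * _ * A.det = _
  ring

end GramDeterminant

section VolumeDensity

variable {n : ℕ}

lemma volumeDensity_bilinearComp (G : Cn n →L[ℝ] Cn n →L[ℝ] ℝ) (A : Cn n →L[ℝ] Cn n) :
    volumeDensity (G.bilinearComp A A) = volumeDensity G * |A.det| := by
  rw [volumeDensity, det_gram_bilinearComp, Real.sqrt_mul' _ (sq_nonneg _), Real.sqrt_sq_eq_abs,
    volumeDensity]

lemma volumeDensity_le_and_one_le {G : Cn n →L[ℝ] Cn n →L[ℝ] ℝ} (hsymm : ∀ v w, G v w = G w v)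
    {L : ℝ} (hL : 0 < L) (hle : ∀ v, ‖v‖ ^ 2 ≤ L ^ 2 * G v v) (hge : ∀ v, G v v ≤ L ^ 2 * ‖v‖ ^ 2) :
    volumeDensity G ≤ L ^ Module.finrank ℝ (Cn n) ∧
      1 ≤ L ^ Module.finrank ℝ (Cn n) * volumeDensity G := by
  obtain ⟨hlow, hup⟩ := pow_card_le_det_gram (stdOrthonormalBasis ℝ (Cn n)) hsymm
    (a := (L ^ 2)⁻¹) (by positivity) (fun v ↦ (inv_mul_le_iff₀ (by positivity)).2 (hle v)) hge
  rw [Fintype.card_fin] at hlow hup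
  refine ⟨Real.sqrt_le_iff.2 ⟨by positivity, hup.trans_eq (pow_right_comm _ _ _)⟩, ?_⟩
  rw [← inv_le_iff_one_le_mul₀' (by positivity)]
  refine Real.le_sqrt_of_sq_le (le_trans (le_of_eq ?_) hlow)
  rw [inv_pow, inv_pow, pow_right_comm]

end VolumeDensity

section MeasureComparison

lemma image_symm_comp_inter_preimage {α β γ : Type*} [TopologicalSpace α] [TopologicalSpace β]
    [TopologicalSpace γ] (e : OpenPartialHomeomorph α β) (f : OpenPartialHomeomorph α γ) {s : Set α}
    (hs : s ⊆ f.source) :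
    (f ∘ e.symm) '' (e.target ∩ e.symm ⁻¹' s) = f.target ∩ f.symm ⁻¹' (e.source ∩ s) := by
  have himage : e.symm '' (e.target ∩ e.symm ⁻¹' s) = e.source ∩ s := by
    rw [image_inter_preimage, e.symm_image_target_eq_source]
  rw [image_comp, himage, f.image_eq_target_inter_inv_preimage (inter_subset_right.trans hs)]

lemma measurableSet_inter_preimage_of_continuousOn {α β : Type*} [TopologicalSpace α]
    [MeasurableSpace α] [BorelSpace α] [TopologicalSpace β] [MeasurableSpace β] [BorelSpace β]
    {f : α → β} {s : Set α} (hs : MeasurableSet s) (hf : ContinuousOn f s) {t : Set β}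
    (ht : MeasurableSet t) : MeasurableSet (s ∩ f ⁻¹' t) := by
  rw [← Subtype.image_preimage_coe]
  exact hs.subtype_image (hf.domRestrict.measurable ht)

variable {α : Type*} [MeasurableSpace α]

lemma restrict_iSup_le {ι : Sort*} {μ : ι → Measure α} {ν : Measure α} {s : Set α}
    (hs : MeasurableSet s) (h : ∀ i, (μ i).restrict s ≤ ν) : (⨆ i, μ i).restrict s ≤ ν := by
  have hle : ⨆ i, μ i ≤ ν + (⨆ i, μ i).restrict sᶜ := iSup_le fun i ↦ by
    rw [← Measure.restrict_add_restrict_compl (μ := μ i) hs]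
    exact add_le_add (h i) (Measure.restrict_mono le_rfl (le_iSup μ i))
  refine (Measure.restrict_mono (le_refl s) hle).trans ?_
  rw [Measure.restrict_add, Measure.restrict_restrict hs, inter_compl_self, Measure.restrict_empty,
    add_zero]
  exact Measure.restrict_le_self

lemma measure_le_of_forall_exists_restrict_le [TopologicalSpace α] [SecondCountableTopology α]
    [OpensMeasurableSpace α] {μ ν : Measure α}
    (h : ∀ x, ∃ U, IsOpen U ∧ x ∈ U ∧ ν.restrict U ≤ μ) : ν ≤ μ := by
  choose U hUo hxU hUle using h
  rcases isEmpty_or_nonempty α with _ | _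
  · exact (Measure.eq_zero_of_isEmpty ν).trans_le (Measure.zero_le μ)
  obtain ⟨s, hs, hcover⟩ := TopologicalSpace.countable_cover_nhds fun x ↦ (hUo x).mem_nhds (hxU x)
  have hne : s.Nonempty := by
    rw [nonempty_iff_ne_empty]
    rintro rfl
    exact empty_ne_univ (by simpa using hcover)
  obtain ⟨f, rfl⟩ := hs.exists_eq_range hne
  set V : ℕ → Set α := disjointed fun k ↦ U (f k)
  have hVm (k : ℕ) : MeasurableSet (V k) :=
    MeasurableSet.disjointed (fun k ↦ (hUo (f k)).measurableSet) k
  have hV : ⋃ k, V k = univ := by rw [iUnion_disjointed]; simpa using hcover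
  have hVle (k : ℕ) : ν.restrict (V k) ≤ μ.restrict (V k) := by
    have := Measure.restrict_mono (le_refl (V k)) (hUle (f k))
    rwa [Measure.restrict_restrict (hVm k), inter_eq_left.2 (disjointed_subset _ k)] at this
  rw [← Measure.restrict_univ (μ := ν), ← Measure.restrict_univ (μ := μ), ← hV,
    Measure.restrict_iUnion (disjoint_disjointed _) hVm,
    Measure.restrict_iUnion (disjoint_disjointed _) hVm]
  refine Measure.le_iff.2 fun t ht ↦ ?_
  rw [Measure.sum_apply _ ht, Measure.sum_apply _ ht]
  exact ENNReal.tsum_le_tsum fun k ↦ hVle k t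

lemma map_symm_restrict_apply {E : Type*} [NormedAddCommGroup E] [MeasurableSpace E]
    [BorelSpace E] [TopologicalSpace α] [BorelSpace α] (Ψ : OpenPartialHomeomorph α E)
    (ν : Measure E) {s : Set α} (hs : MeasurableSet s) :
    (ν.restrict Ψ.target).map Ψ.symm s = ν (Ψ.target ∩ Ψ.symm ⁻¹' s) := by
  rw [Measure.map_apply_of_aemeasurable (aemeasurable_symm_restrict_target Ψ ν) hs,
    Measure.restrict_apply' Ψ.open_target.measurableSet, inter_comm]

end MeasureComparison

section RestrictScalars

variable {E F M N : Type*} [NormedAddCommGroup E] [NormedSpace ℂ E] [NormedAddCommGroup F]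
  [NormedSpace ℂ F] [TopologicalSpace M] [ChartedSpace E M] [TopologicalSpace N] [ChartedSpace F N]

lemma contMDiffOn_real_of_complex {m : ℕ∞ω} {f : M → N} {s : Set M}
    (hf : ContMDiffOn 𝓘(ℂ, E) 𝓘(ℂ, F) m f s) : ContMDiffOn 𝓘(ℝ, E) 𝓘(ℝ, F) m f s := by
  intro x hx
  have h := hf x hx
  rw [contMDiffWithinAt_iff] at h ⊢
  exact ⟨h.1, h.2.restrict_scalars ℝ⟩

end RestrictScalars

section ConicalMeasure

variable {n : ℕ} {X : Type*} [TopologicalSpace X] [ChartedSpace (Cn n) X]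

/-- `g` is a continuous Riemannian metric on `U`: in every holomorphic chart its coordinate
expression is symmetric, positive definite and continuous. This is all that the metric measure
geometry retains of a Kähler metric. -/
structure IsContinuousMetricOn (g : BilinField n X) (U : Set X) : Prop where
  symm : ∀ ψ ∈ IsManifold.maximalAtlas 𝓘(ℂ, Cn n) ω X, ∀ z ∈ ψ.target ∩ ψ.symm ⁻¹' U, ∀ v w,
    pullbackMetric g ψ.symm z v w = pullbackMetric g ψ.symm z w v
  pos : ∀ ψ ∈ IsManifold.maximalAtlas 𝓘(ℂ, Cn n) ω X, ∀ z ∈ ψ.target ∩ ψ.symm ⁻¹' U, ∀ v, v ≠ 0 →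
    0 < pullbackMetric g ψ.symm z v v
  continuousOn : ∀ ψ ∈ IsManifold.maximalAtlas 𝓘(ℂ, Cn n) ω X,
    ContinuousOn (pullbackMetric g ψ.symm) (ψ.target ∩ ψ.symm ⁻¹' U)

variable {g : BilinField n X} {D : Set X} {L : ℝ} {Ψ ψ : OpenPartialHomeomorph X (Cn n)}

lemma pullbackMetric_comp {P Q : Cn n → X} {F : Cn n → Cn n} {z : Cn n}
    (heq : P =ᶠ[𝓝 z] Q ∘ F) (hQ : MDifferentiableAt 𝓘(ℝ, Cn n) 𝓘(ℝ, Cn n) Q (F z))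
    (hF : DifferentiableAt ℝ F z) :
    pullbackMetric g P z =
      (pullbackMetric g Q (F z)).bilinearComp (fderiv ℝ F z) (fderiv ℝ F z) := by
  have hchain : realDifferential P z = (realDifferential Q (F z)).comp (fderiv ℝ F z) := by
    unfold realDifferential
    rw [heq.mfderiv_eq, mfderiv_comp z hQ hF.mdifferentiableAt, mfderiv_eq_fderiv]
    rfl
  ext v w
  rw [pullbackMetric_apply, hchain, heq.eq_of_nhds]
  rfl

namespace IsConeChart

lemma volume_preimage_divisor (h : IsConeChart g D L Ψ) :
    volume (Ψ.target ∩ Ψ.symm ⁻¹' D) = 0 := by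
  obtain ⟨J, hJ⟩ := h.divisor
  refine measure_mono_null ?_ (ae_iff.1 (ae_forall_apply_ne_zero n))
  rintro w ⟨hw, hwD⟩ hne
  obtain ⟨j, -, hj⟩ := (hJ w hw).1 hwD
  exact hne j hj

lemma differentiableAt_transition (h : IsConeChart g D L Ψ) (hD : IsClosed D)
    (hψ : ψ ∈ IsManifold.maximalAtlas 𝓘(ℂ, Cn n) ω X) {z : Cn n}
    (hz : z ∈ ψ.target ∩ ψ.symm ⁻¹' (Ψ.source ∩ Dᶜ)) : DifferentiableAt ℝ (Ψ ∘ ψ.symm) z := by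
  have hdiff : ContDiffOn ℝ 1 (Ψ ∘ ψ.symm) (ψ.target ∩ ψ.symm ⁻¹' (Ψ.source ∩ Dᶜ)) := by
    rw [← contMDiffOn_iff_contDiffOn]
    exact h.contMDiffOn.comp ((contMDiffOn_real_of_complex
      ((contMDiffOn_symm_of_mem_maximalAtlas hψ).of_le le_top)).mono inter_subset_left)
      fun z hz ↦ hz.2
  exact (hdiff.contDiffAt ((ψ.isOpen_inter_preimage_symm
    (Ψ.open_source.inter hD.isOpen_compl)).mem_nhds hz)).differentiableAt one_ne_zero

lemma pullbackMetric_symm_eq (h : IsConeChart g D L Ψ) (hD : IsClosed D)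
    (hψ : ψ ∈ IsManifold.maximalAtlas 𝓘(ℂ, Cn n) ω X) {z : Cn n}
    (hz : z ∈ ψ.target ∩ ψ.symm ⁻¹' (Ψ.source ∩ Dᶜ)) :
    pullbackMetric g ψ.symm z = (pullbackMetric g Ψ.symm (Ψ (ψ.symm z))).bilinearComp
      (fderiv ℝ (Ψ ∘ ψ.symm) z) (fderiv ℝ (Ψ ∘ ψ.symm) z) := by
  have heq : ψ.symm =ᶠ[𝓝 z] Ψ.symm ∘ (Ψ ∘ ψ.symm) := by
    filter_upwards [(ψ.isOpen_inter_preimage_symm Ψ.open_source).mem_nhds ⟨hz.1, hz.2.1⟩]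
      with z' hz' using (Ψ.left_inv hz'.2).symm
  have hwD : Ψ.symm (Ψ (ψ.symm z)) ∉ D := by rw [Ψ.left_inv hz.2.1]; exact hz.2.2
  have hsymm : MDifferentiableAt 𝓘(ℝ, Cn n) 𝓘(ℝ, Cn n) Ψ.symm ((Ψ ∘ ψ.symm) z) :=
    h.mdifferentiableAt_symm hD (Ψ.map_source hz.2.1) hwD
  exact pullbackMetric_comp (P := ψ.symm) (Q := Ψ.symm) (F := Ψ ∘ ψ.symm) heq hsymm
    (h.differentiableAt_transition hD hψ hz)

lemma volumeDensity_le_and_abs_det_le (h : IsConeChart g D L Ψ) (hL : 0 < L) (hD : IsClosed D)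
    (hg : IsContinuousMetricOn g Dᶜ) (hψ : ψ ∈ IsManifold.maximalAtlas 𝓘(ℂ, Cn n) ω X) {z : Cn n}
    (hz : z ∈ ψ.target ∩ ψ.symm ⁻¹' (Ψ.source ∩ Dᶜ)) :
    volumeDensity (pullbackMetric g ψ.symm z) ≤
        L ^ Module.finrank ℝ (Cn n) * |(fderiv ℝ (Ψ ∘ ψ.symm) z).det| ∧
      |(fderiv ℝ (Ψ ∘ ψ.symm) z).det| ≤
        L ^ Module.finrank ℝ (Cn n) * volumeDensity (pullbackMetric g ψ.symm z) := by
  set A := fderiv ℝ (Ψ ∘ ψ.symm) z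
  set G := pullbackMetric g Ψ.symm (Ψ (ψ.symm z))
  have hzD : z ∈ ψ.target ∩ ψ.symm ⁻¹' Dᶜ := ⟨hz.1, hz.2.2⟩
  have hwD : Ψ.symm (Ψ (ψ.symm z)) ∉ D := by rw [Ψ.left_inv hz.2.1]; exact hz.2.2
  have hpull : pullbackMetric g ψ.symm z = G.bilinearComp A A := h.pullbackMetric_symm_eq hD hψ hz
  have hinj : Function.Injective (A : Cn n →ₗ[ℝ] Cn n) := by
    refine (injective_iff_map_eq_zero _).2 fun v hv ↦ by_contra fun hv0 ↦ ?_
    have hpos := hg.pos ψ hψ z hzD v hv0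
    have hAv : A v = 0 := hv
    rw [hpull, ContinuousLinearMap.bilinearComp_apply, hAv, map_zero] at hpos
    exact hpos.false
  have hsymm (v w : Cn n) : G v w = G w v := by
    obtain ⟨v, rfl⟩ := LinearMap.injective_iff_surjective.1 hinj v
    obtain ⟨w, rfl⟩ := LinearMap.injective_iff_surjective.1 hinj w
    have := hg.symm ψ hψ z hzD v w
    rwa [hpull] at this
  obtain ⟨hle, hge⟩ := volumeDensity_le_and_one_le hsymm hL
    (h.le_pullback _ (Ψ.map_source hz.2.1) hwD) (h.pullback_le _ (Ψ.map_source hz.2.1) hwD)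
  rw [hpull, volumeDensity_bilinearComp, ← mul_assoc]
  exact ⟨by gcongr, le_mul_of_one_le_left (abs_nonneg _) hge⟩

end IsConeChart

variable [MeasurableSpace X] [BorelSpace X]

lemma chartMeasure_apply (hD : IsClosed D) {A : Set X} (hA : MeasurableSet A) :
    chartMeasure g D ψ A = ∫⁻ z in ψ.target ∩ ψ.symm ⁻¹' (A ∩ Dᶜ),
      ENNReal.ofReal (volumeDensity (pullbackMetric g ψ.symm z)) := by
  have hm : MeasurableSet (ψ.target ∩ ψ.symm ⁻¹' Dᶜ) :=
    (ψ.isOpen_inter_preimage_symm hD.isOpen_compl).measurableSet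
  have hae : AEMeasurable ψ.symm (volume.restrict (ψ.target ∩ ψ.symm ⁻¹' Dᶜ)) :=
    (ψ.continuousOn_symm.mono inter_subset_left).aemeasurable hm
  rw [chartMeasure, Measure.map_apply_of_aemeasurable
    (hae.mono_ac (withDensity_absolutelyContinuous _ _)) hA, withDensity_apply',
    Measure.restrict_restrict' hm, preimage_inter, inter_left_comm]

namespace IsConeChart

lemma chartMeasure_le_and_volume_le (h : IsConeChart g D L Ψ) (hL : 0 < L) (hD : IsClosed D)
    (hg : IsContinuousMetricOn g Dᶜ) (hψ : ψ ∈ IsManifold.maximalAtlas 𝓘(ℂ, Cn n) ω X)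
    {A : Set X} (hA : MeasurableSet A) (hAs : A ⊆ Ψ.source) :
    chartMeasure g D ψ A ≤ ENNReal.ofReal (L ^ Module.finrank ℝ (Cn n)) *
        volume (Ψ.target ∩ Ψ.symm ⁻¹' (ψ.source ∩ (A ∩ Dᶜ))) ∧
      volume (Ψ.target ∩ Ψ.symm ⁻¹' (ψ.source ∩ (A ∩ Dᶜ))) ≤
        ENNReal.ofReal (L ^ Module.finrank ℝ (Cn n)) * chartMeasure g D ψ A := by
  set S : Set (Cn n) := ψ.target ∩ ψ.symm ⁻¹' (A ∩ Dᶜ)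
  have hS : ∀ z ∈ S, z ∈ ψ.target ∩ ψ.symm ⁻¹' (Ψ.source ∩ Dᶜ) :=
    fun z hz ↦ ⟨hz.1, hAs hz.2.1, hz.2.2⟩
  have hSm : MeasurableSet S := measurableSet_inter_preimage_of_continuousOn
    ψ.open_target.measurableSet ψ.continuousOn_symm (hA.inter hD.measurableSet.compl)
  have hinj : InjOn (Ψ ∘ ψ.symm) S :=
    Ψ.injOn.comp (ψ.symm.injOn.mono inter_subset_left) fun z hz ↦ hAs hz.2.1
  have hcov : ∫⁻ z in S, ENNReal.ofReal |(fderiv ℝ (Ψ ∘ ψ.symm) z).det| =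
      volume (Ψ.target ∩ Ψ.symm ⁻¹' (ψ.source ∩ (A ∩ Dᶜ))) := by
    rw [← image_symm_comp_inter_preimage ψ Ψ (inter_subset_left.trans hAs)]
    exact lintegral_abs_det_fderiv_eq_addHaar_image volume hSm (fun z hz ↦
      (h.differentiableAt_transition hD hψ (hS z hz)).hasFDerivAt.hasFDerivWithinAt) hinj
  have hdens := fun z hz ↦ h.volumeDensity_le_and_abs_det_le hL hD hg hψ (hS z hz)
  rw [← hcov, chartMeasure_apply hD hA, ← lintegral_const_mul' _ _ ENNReal.ofReal_ne_top,
    ← lintegral_const_mul' _ _ ENNReal.ofReal_ne_top]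
  refine ⟨setLIntegral_mono' hSm fun z hz ↦ ?_, setLIntegral_mono' hSm fun z hz ↦ ?_⟩
  · rw [← ENNReal.ofReal_mul (by positivity)]
    exact ENNReal.ofReal_le_ofReal (hdens z hz).1
  · rw [← ENNReal.ofReal_mul (by positivity)]
    exact ENNReal.ofReal_le_ofReal (hdens z hz).2

lemma conicalMeasure_restrict_le (h : IsConeChart g D L Ψ) (hL : 0 < L) (hD : IsClosed D)
    (hg : IsContinuousMetricOn g Dᶜ) :
    (conicalMeasure g D).restrict Ψ.source ≤
      ENNReal.ofReal (L ^ Module.finrank ℝ (Cn n)) • (volume.restrict Ψ.target).map Ψ.symm := by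
  have hs := Ψ.open_source.measurableSet
  refine restrict_iSup_le hs fun ψ ↦ restrict_iSup_le hs fun hψ ↦ Measure.le_iff.2 fun A hA ↦ ?_
  rw [Measure.restrict_apply hA, Measure.smul_apply, smul_eq_mul,
    map_symm_restrict_apply Ψ volume hA]
  refine (h.chartMeasure_le_and_volume_le hL hD hg hψ (hA.inter hs) inter_subset_right).1.trans ?_
  gcongr
  exact inter_subset_right.trans (inter_subset_left.trans inter_subset_left)

lemma map_symm_le_conicalMeasure [IsManifold 𝓘(ℂ, Cn n) ω X] [SecondCountableTopology X]
    (h : IsConeChart g D L Ψ)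
    (hL : 0 < L) (hD : IsClosed D) (hg : IsContinuousMetricOn g Dᶜ) :
    (volume.restrict Ψ.target).map Ψ.symm ≤
      ENNReal.ofReal (L ^ Module.finrank ℝ (Cn n)) • conicalMeasure g D := by
  refine measure_le_of_forall_exists_restrict_le fun x ↦
    ⟨(chartAt (Cn n) x).source, (chartAt (Cn n) x).open_source, mem_chart_source _ x,
      Measure.le_iff.2 fun A hA ↦ ?_⟩
  have hψ : chartAt (Cn n) x ∈ IsManifold.maximalAtlas 𝓘(ℂ, Cn n) ω X :=
    IsManifold.chart_mem_maximalAtlas x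
  set ψ := chartAt (Cn n) x
  have hψm := ψ.open_source.measurableSet
  have hsub : Ψ.target ∩ Ψ.symm ⁻¹' (A ∩ ψ.source) ⊆
      (Ψ.target ∩ Ψ.symm ⁻¹' (ψ.source ∩ (A ∩ Ψ.source ∩ Dᶜ))) ∪ (Ψ.target ∩ Ψ.symm ⁻¹' D) := by
    rintro w ⟨hw, hwA, hwψ⟩
    by_cases hwD : Ψ.symm w ∈ D
    · exact Or.inr ⟨hw, hwD⟩
    · exact Or.inl ⟨hw, hwψ, ⟨hwA, Ψ.map_target hw⟩, hwD⟩
  rw [Measure.restrict_apply hA, map_symm_restrict_apply Ψ volume (hA.inter hψm),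
    Measure.smul_apply, smul_eq_mul]
  calc volume (Ψ.target ∩ Ψ.symm ⁻¹' (A ∩ ψ.source))
      ≤ volume (Ψ.target ∩ Ψ.symm ⁻¹' (ψ.source ∩ (A ∩ Ψ.source ∩ Dᶜ))) := by
        refine (measure_mono hsub).trans ((measure_union_le _ _).trans_eq ?_)
        rw [h.volume_preimage_divisor, add_zero]
    _ ≤ ENNReal.ofReal (L ^ Module.finrank ℝ (Cn n)) * chartMeasure g D ψ (A ∩ Ψ.source) :=
        (h.chartMeasure_le_and_volume_le hL hD hg hψ (hA.inter Ψ.open_source.measurableSet)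
          inter_subset_right).2
    _ ≤ ENNReal.ofReal (L ^ Module.finrank ℝ (Cn n)) * conicalMeasure g D A := by
        have hle : chartMeasure g D ψ ≤ conicalMeasure g D :=
          le_iSup₂ (f := fun ψ _ ↦ chartMeasure g D ψ) ψ hψ
        exact mul_le_mul_right ((hle _).trans (measure_mono inter_subset_left)) _

end IsConeChart

namespace HasUniformConeCharts

variable [IsManifold 𝓘(ℂ, Cn n) ω X] [T2Space X] [SecondCountableTopology X] [PreconnectedSpace X]
  {ρ : ℝ}

lemma hasBoundedGeometry (hu : HasUniformConeCharts g D L ρ) (hD : IsClosed D) (hL : 1 ≤ L)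
    (hρ : 0 < ρ) (hg : IsContinuousMetricOn g Dᶜ) :
    HasBoundedGeometry (conicalDist g D) (conicalMeasure g D) (volume : Measure (Cn n)) (2 * L)
      (ρ / 5) (ENNReal.ofReal (L ^ Module.finrank ℝ (Cn n))) := by
  have hL0 : 0 < L := by linarith
  have hlen := hu.isLengthDist hD hL0 hρ
  refine ⟨hlen, by linarith, by positivity, ENNReal.ofReal_ne_top, fun x ↦ ?_⟩
  obtain ⟨Ψ, h, hx, hball⟩ := hu x
  have hball' : Metric.ball (Ψ x) (5 * (ρ / 5)) ⊆ Ψ.target := by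
    rwa [mul_div_cancel₀ _ (by norm_num)]
  refine ⟨Ψ, hx, (Metric.ball_subset_ball (by linarith)).trans hball, fun w hw w' hw' ↦
    hu.conicalDist_symm_le hD hL0 hρ h hball' hw hw', fun y hy ↦ ?_,
    h.conicalMeasure_restrict_le hL0 hD hg, h.map_symm_le_conicalMeasure hL0 hD hg⟩
  rw [lt_div_iff₀' (by positivity)] at hy
  have hnonneg : 0 ≤ L * conicalDist g D x y := mul_nonneg hL0.le (hlen.nonneg x y)
  obtain ⟨hmem, hle⟩ := hu.norm_sub_le_conicalDist hD hL0 hρ h (y := y) (δ := ρ / 5) hx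
    ((Metric.ball_subset_ball (by linarith)).trans hball) (by linarith)
  exact ⟨hmem, hle.trans (by linarith)⟩

end HasUniformConeCharts

end ConicalMeasure

section Radial

variable {F : Type*} [NormedAddCommGroup F]

/-- The radial map `z ↦ |z|^(e-1) z`, which takes the cone metric `|z|^(2e-2) |dz|²` of the plane to
a metric that is bi-Lipschitz to the flat one. -/
def radial [NormedSpace ℝ F] (e : ℝ) (z : F) : F := (‖z‖ ^ (e - 1)) • z

section NormedSpace

variable [NormedSpace ℝ F]

lemma radial_zero (e : ℝ) : radial e (0 : F) = 0 := smul_zero _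

lemma radial_one (z : F) : radial 1 z = z := by simp [radial]

lemma norm_radial {e : ℝ} (he : 0 < e) (z : F) : ‖radial e z‖ = ‖z‖ ^ e := by
  rcases eq_or_ne z 0 with rfl | hz
  · simp [radial, Real.zero_rpow he.ne']
  · have hz0 : 0 < ‖z‖ := norm_pos_iff.2 hz
    rw [radial, norm_smul, Real.norm_of_nonneg (by positivity), Real.rpow_sub_one hz0.ne',
      div_mul_cancel₀ _ hz0.ne']

lemma radial_eq_zero {e : ℝ} (he : 0 < e) {z : F} : radial e z = 0 ↔ z = 0 := by
  rw [← norm_eq_zero, norm_radial he, Real.rpow_eq_zero (norm_nonneg _) he.ne', norm_eq_zero]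

lemma radial_radial {e e' : ℝ} (he : 0 < e) (z : F) :
    radial e' (radial e z) = radial (e * e') z := by
  rcases eq_or_ne z 0 with rfl | hz
  · simp only [radial_zero]
  · have hz0 : 0 < ‖z‖ := norm_pos_iff.2 hz
    rw [radial, norm_radial he, radial, radial, smul_smul, ← Real.rpow_mul hz0.le,
      ← Real.rpow_add hz0]
    congr 2
    ring

lemma continuous_radial {e : ℝ} (he : 0 < e) : Continuous (radial e : F → F) := by
  rw [continuous_iff_continuousAt]
  intro z
  rcases eq_or_ne z 0 with rfl | hz
  · have hnorm : Tendsto (fun z : F ↦ ‖z‖ ^ e) (𝓝 0) (𝓝 (‖(0 : F)‖ ^ e)) :=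
      (continuous_norm.rpow_const fun _ ↦ Or.inr he.le).tendsto 0
    rw [norm_zero, Real.zero_rpow he.ne'] at hnorm
    rw [ContinuousAt, radial_zero, tendsto_zero_iff_norm_tendsto_zero]
    simpa only [norm_radial he] using hnorm
  · exact (continuous_norm.continuousAt.rpow_const (Or.inl (norm_ne_zero_iff.2 hz))).smul
      continuousAt_id

end NormedSpace

variable [InnerProductSpace ℝ F]

lemma contDiffAt_radial {e : ℝ} {z : F} (h : z ≠ 0 ∨ e = 1) : ContDiffAt ℝ 1 (radial e) z := by
  rcases h with hz | rfl
  · exact ((contDiffAt_norm ℝ hz).rpow_const_of_ne (norm_ne_zero_iff.2 hz)).smul contDiffAt_id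
  · exact contDiffAt_id.congr_of_eventuallyEq (Eventually.of_forall radial_one)

lemma hasFDerivAt_norm_rpow_of_ne_zero (p : ℝ) {z : F} (hz : z ≠ 0) :
    HasFDerivAt (fun y : F ↦ ‖y‖ ^ p) ((p * ‖z‖ ^ p / ‖z‖ ^ 2) • innerSL ℝ z) z := by
  have hpow : (fun y : F ↦ (‖y‖ ^ 2) ^ (p / 2)) = fun y ↦ ‖y‖ ^ p := by
    ext y
    rw [← Real.rpow_natCast_mul (norm_nonneg _)]
    congr 1
    push_cast
    ring
  have hpow' : (‖z‖ ^ 2) ^ (p / 2 - 1) = ‖z‖ ^ p / ‖z‖ ^ 2 := by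
    rw [Real.rpow_sub_one (by positivity), congrFun hpow z]
  convert (hasStrictFDerivAt_norm_sq z).hasFDerivAt.rpow_const (p := p / 2)
    (Or.inl (by positivity)) using 1
  · exact hpow.symm
  · rw [hpow', two_smul, ← two_smul ℝ, smul_smul]
    congr 1
    ring

lemma fderiv_radial_apply {e : ℝ} {z : F} (hz : z ≠ 0) (v : F) :
    fderiv ℝ (radial e) z v =
      (‖z‖ ^ (e - 1)) • (v + ((e - 1) * inner ℝ z v / ‖z‖ ^ 2) • z) := by
  have hderiv : HasFDerivAt (radial e) _ z :=
    (hasFDerivAt_norm_rpow_of_ne_zero (e - 1) hz).smul (hasFDerivAt_id z)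
  rw [hderiv.fderiv]
  simp only [_root_.add_apply, _root_.smul_apply, ContinuousLinearMap.id_apply,
    ContinuousLinearMap.smulRight_apply, innerSL_apply_apply, smul_add, smul_smul, smul_eq_mul]
  congr 2
  ring

lemma norm_fderiv_radial_sq {e : ℝ} {z : F} (hz : z ≠ 0) (v : F) :
    ‖fderiv ℝ (radial e) z v‖ ^ 2 =
      ‖z‖ ^ (2 * e - 2) * (‖v‖ ^ 2 + (e ^ 2 - 1) * (inner ℝ z v ^ 2 / ‖z‖ ^ 2)) := by
  have hz0 : 0 < ‖z‖ := norm_pos_iff.2 hz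
  have hpow : (‖z‖ ^ (e - 1)) ^ 2 = ‖z‖ ^ (2 * e - 2) := by
    rw [← Real.rpow_mul_natCast hz0.le]
    congr 1
    push_cast
    ring
  rw [fderiv_radial_apply hz, norm_smul, mul_pow, Real.norm_eq_abs, sq_abs, hpow,
    norm_add_sq_real, norm_smul, mul_pow, Real.norm_eq_abs, sq_abs, real_inner_smul_right,
    real_inner_comm z v]
  congr 1
  field_simp
  ring

lemma norm_fderiv_radial_bounds {e : ℝ} (he0 : 0 < e) (he1 : e ≤ 1) {z : F} (h : z ≠ 0 ∨ e = 1)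
    (v : F) :
    e ^ 2 * (‖z‖ ^ (2 * e - 2) * ‖v‖ ^ 2) ≤ ‖fderiv ℝ (radial e) z v‖ ^ 2 ∧
      ‖fderiv ℝ (radial e) z v‖ ^ 2 ≤ ‖z‖ ^ (2 * e - 2) * ‖v‖ ^ 2 := by
  rcases eq_or_ne e 1 with rfl | hne
  · have hid : (radial 1 : F → F) = id := funext radial_one
    simp [hid]
  have hz : z ≠ 0 := h.resolve_right hne
  have hcauchy : inner ℝ z v ^ 2 / ‖z‖ ^ 2 ≤ ‖v‖ ^ 2 := by
    rw [div_le_iff₀ (by positivity), ← mul_pow, mul_comm ‖v‖, sq_le_sq,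
      abs_of_nonneg (by positivity : 0 ≤ ‖z‖ * ‖v‖)]
    exact abs_real_inner_le_norm z v
  have hnonneg : 0 ≤ inner ℝ z v ^ 2 / ‖z‖ ^ 2 := by positivity
  have he : e ^ 2 ≤ 1 := pow_le_one₀ he0.le he1
  rw [norm_fderiv_radial_sq hz]
  constructor
  · rw [mul_left_comm]
    gcongr
    nlinarith
  · gcongr
    nlinarith

variable {n : ℕ}

/-- The map of `ℂⁿ` that acts on the `j`-th coordinate by the radial map with exponent `e j`. -/
def radialMap (e : Fin n → ℝ) (z : Cn n) : Cn n := WithLp.toLp 2 fun j ↦ radial (e j) (z j)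

lemma radialMap_apply (e : Fin n → ℝ) (z : Cn n) (j : Fin n) :
    radialMap e z j = radial (e j) (z j) := rfl

lemma radialMap_radialMap {e e' : Fin n → ℝ} (he : ∀ j, 0 < e j) (h : ∀ j, e j * e' j = 1)
    (z : Cn n) : radialMap e' (radialMap e z) = z := by
  ext j
  rw [radialMap_apply, radialMap_apply, radial_radial (he j), h, radial_one]

lemma continuous_radialMap {e : Fin n → ℝ} (he : ∀ j, 0 < e j) : Continuous (radialMap e) :=
  (PiLp.continuous_toLp 2 _).comp
    (continuous_pi fun j ↦ (continuous_radial (he j)).comp (by fun_prop))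

/-- The map `radialMap e` as a homeomorphism of `ℂⁿ`, when all the exponents are positive. -/
def radialHomeomorph (e : Fin n → ℝ) (he : ∀ j, 0 < e j) : Cn n ≃ₜ Cn n where
  toFun := radialMap e
  invFun := radialMap fun j ↦ (e j)⁻¹
  left_inv := radialMap_radialMap he fun j ↦ mul_inv_cancel₀ (he j).ne'
  right_inv := radialMap_radialMap (fun j ↦ inv_pos.2 (he j)) fun j ↦ inv_mul_cancel₀ (he j).ne'
  continuous_toFun := continuous_radialMap he
  continuous_invFun := continuous_radialMap fun j ↦ inv_pos.2 (he j)

section Derivative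

variable {e : Fin n → ℝ} {z : Cn n}

lemma contDiffAt_radialMap (h : ∀ j, z j ≠ 0 ∨ e j = 1) : ContDiffAt ℝ 1 (radialMap e) z := by
  rw [contDiffAt_piLp 2]
  intro j
  have hproj : ContDiffAt ℝ 1 (fun y : Cn n ↦ y j) z := by fun_prop
  exact (contDiffAt_radial (h j)).comp z hproj

lemma fderiv_radialMap_apply (h : ∀ j, z j ≠ 0 ∨ e j = 1) (v : Cn n) (j : Fin n) :
    fderiv ℝ (radialMap e) z v j = fderiv ℝ (radial (e j)) (z j) (v j) := by
  have hproj (w : Cn n) := PiLp.hasFDerivAt_apply (𝕜 := ℝ) 2 (E := fun _ : Fin n ↦ ℂ) w j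
  have hleft := (hproj (radialMap e z)).comp z
    ((contDiffAt_radialMap h).differentiableAt one_ne_zero).hasFDerivAt
  have hright := ((contDiffAt_radial (h j)).differentiableAt one_ne_zero).hasFDerivAt.comp z
    (hproj z)
  exact DFunLike.congr_fun (hleft.unique hright) v

lemma norm_fderiv_radialMap_bounds (he0 : ∀ j, 0 < e j) (he1 : ∀ j, e j ≤ 1) {c : ℝ}
    (hc : ∀ j, c ≤ e j ^ 2) (h : ∀ j, z j ≠ 0 ∨ e j = 1) (v : Cn n) :
    c * ∑ j, ‖z j‖ ^ (2 * e j - 2) * ‖v j‖ ^ 2 ≤ ‖fderiv ℝ (radialMap e) z v‖ ^ 2 ∧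
      ‖fderiv ℝ (radialMap e) z v‖ ^ 2 ≤ ∑ j, ‖z j‖ ^ (2 * e j - 2) * ‖v j‖ ^ 2 := by
  have hbounds (j : Fin n) := norm_fderiv_radial_bounds (he0 j) (he1 j) (h j) (v j)
  simp only [EuclideanSpace.norm_sq_eq, Finset.mul_sum, fderiv_radialMap_apply h]
  exact ⟨Finset.sum_le_sum fun j _ ↦
    (mul_le_mul_of_nonneg_right (hc j) (by positivity)).trans (hbounds j).1,
    Finset.sum_le_sum fun j _ ↦ (hbounds j).2⟩

lemma surjective_fderiv_radialMap (he0 : ∀ j, 0 < e j) (he1 : ∀ j, e j ≤ 1)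
    (h : ∀ j, z j ≠ 0 ∨ e j = 1) : Function.Surjective (fderiv ℝ (radialMap e) z) := by
  refine (LinearMap.injective_iff_surjective
    (f := (fderiv ℝ (radialMap e) z : Cn n →ₗ[ℝ] Cn n))).1 ?_
  refine (injective_iff_map_eq_zero _).2 fun v (hv : fderiv ℝ (radialMap e) z v = 0) ↦ ?_
  ext j
  have hle := (norm_fderiv_radial_bounds (he0 j) (he1 j) (h j) (v j)).1
  rw [← fderiv_radialMap_apply h, hv, PiLp.zero_apply, norm_zero, zero_pow two_ne_zero,
    ← mul_assoc] at hle
  have hpos : 0 < e j ^ 2 * ‖z j‖ ^ (2 * e j - 2) := by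
    refine mul_pos (pow_pos (he0 j) 2) ?_
    rcases h j with hzj | hej
    · exact Real.rpow_pos_of_pos (norm_pos_iff.2 hzj) _
    · simp [hej]
  exact norm_eq_zero.1 (pow_eq_zero_iff two_ne_zero |>.1
    (le_antisymm (nonpos_of_mul_nonpos_right hle hpos) (sq_nonneg _)))

end Derivative

end Radial

section ConicalChart

variable {n : ℕ}

/-- The exponents of the cone metric `modelConeMetric n k b` in all the coordinate directions:
`b j` for the first `k` coordinates, and `1` for the directions along the divisor. -/
def coneExponent (n k : ℕ) (b : Fin k → ℝ) (j : Fin n) : ℝ :=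
  if h : (j : ℕ) < k then b ⟨j, h⟩ else 1

variable {k : ℕ} {b : Fin k → ℝ}

lemma modelConeMetric_eq_sum (b : Fin k → ℝ) (z v : Cn n) :
    modelConeMetric n k b z v =
      ∑ j, ‖z j‖ ^ (2 * coneExponent n k b j - 2) * ‖v j‖ ^ 2 := by
  refine Finset.sum_congr rfl fun j _ ↦ ?_
  by_cases h : (j : ℕ) < k <;> simp [coneExponent, h]

lemma coneExponent_pos (hb : ∀ i, 0 < b i) (j : Fin n) : 0 < coneExponent n k b j := by
  unfold coneExponent
  split_ifs with h
  exacts [hb _, one_pos]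

lemma coneExponent_le_one (hb : ∀ i, b i ≤ 1) (j : Fin n) : coneExponent n k b j ≤ 1 := by
  unfold coneExponent
  split_ifs with h
  exacts [hb _, le_rfl]

variable {X : Type*} [TopologicalSpace X]

/-- The coordinates `|z_j|^(b_j - 1) z_j`, for complex coordinates `ψ = (z_1, …, z_n)`. -/
def coneChart (ψ : OpenPartialHomeomorph X (Cn n)) (b : Fin k → ℝ) (hb : ∀ i, 0 < b i) :
    OpenPartialHomeomorph X (Cn n) :=
  ψ ≫ₕ (radialHomeomorph (coneExponent n k b) (coneExponent_pos hb)).toOpenPartialHomeomorph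

section ConeChart

variable {ψ : OpenPartialHomeomorph X (Cn n)} {hb : ∀ i, 0 < b i}

lemma coneChart_source : (coneChart ψ b hb).source = ψ.source := by simp [coneChart]

lemma mem_coneChart_target {w : Cn n} : w ∈ (coneChart ψ b hb).target ↔
    radialMap (fun j ↦ (coneExponent n k b j)⁻¹) w ∈ ψ.target := by
  simp [coneChart, radialHomeomorph]

end ConeChart

namespace IsAdaptedChart

variable [ChartedSpace (Cn n) X] {ι : Type*} {D : ι → Set X} {p : X}
  {ψ : OpenPartialHomeomorph X (Cn n)} {hk : k ≤ n} {σ : Fin k → ι}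

lemma mem_iUnion_iff (h : IsAdaptedChart D p ψ k hk σ) {x : X} (hx : x ∈ ψ.source) :
    x ∈ ⋃ i, D i ↔ ∃ j : Fin n, (j : ℕ) < k ∧ ψ x j = 0 := by
  rw [mem_iUnion]
  constructor
  · rintro ⟨i, hi⟩
    by_cases hr : i ∈ range σ
    · obtain ⟨j, rfl⟩ := hr
      exact ⟨Fin.castLE hk j, j.2, (h.mem_iff j x hx).1 hi⟩
    · exact ((disjoint_left.1 (h.disjoint i hr)) hi hx).elim
  · rintro ⟨j, hj, hzero⟩
    exact ⟨σ ⟨j, hj⟩, (h.mem_iff ⟨j, hj⟩ x hx).2 hzero⟩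

variable {hb : ∀ i, 0 < b i} {g : BilinField n X}

lemma ne_zero_or_coneExponent_eq_one (h : IsAdaptedChart D p ψ k hk σ) (b : Fin k → ℝ) {z : Cn n}
    (hz : z ∈ ψ.target) (hzD : ψ.symm z ∉ ⋃ i, D i) (j : Fin n) :
    z j ≠ 0 ∨ coneExponent n k b j = 1 := by
  by_cases hj : (j : ℕ) < k
  · refine Or.inl fun hzero ↦ hzD ((h.mem_iUnion_iff (ψ.map_target hz)).2 ⟨j, hj, ?_⟩)
    rwa [ψ.right_inv hz]
  · exact Or.inr (by simp [coneExponent, hj])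

lemma coneChart_symm_mem_iUnion_iff (h : IsAdaptedChart D p ψ k hk σ) {w : Cn n}
    (hw : w ∈ (coneChart ψ b hb).target) :
    (coneChart ψ b hb).symm w ∈ ⋃ i, D i ↔ ∃ j : Fin n, (j : ℕ) < k ∧ w j = 0 := by
  have hz := mem_coneChart_target.1 hw
  change ψ.symm (radialMap _ w) ∈ _ ↔ _
  rw [h.mem_iUnion_iff (ψ.map_target hz), ψ.right_inv hz]
  simp only [radialMap_apply, radial_eq_zero (inv_pos.2 (coneExponent_pos hb _))]

lemma contMDiffAt_coneChart (h : IsAdaptedChart D p ψ k hk σ) {x : X} (hx : x ∈ ψ.source)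
    (hxD : x ∉ ⋃ i, D i) :
    ContMDiffAt 𝓘(ℝ, Cn n) 𝓘(ℝ, Cn n) 1 (coneChart ψ b hb) x := by
  have hradial : ContMDiffAt 𝓘(ℝ, Cn n) 𝓘(ℝ, Cn n) 1 (radialMap (coneExponent n k b)) (ψ x) := by
    refine (contDiffAt_radialMap
      (h.ne_zero_or_coneExponent_eq_one b (ψ.map_source hx) ?_)).contMDiffAt
    rwa [ψ.left_inv hx]
  have hψ : ContMDiffOn 𝓘(ℝ, Cn n) 𝓘(ℝ, Cn n) 1 ψ ψ.source := contMDiffOn_real_of_complex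
    ((contMDiffOn_of_mem_maximalAtlas h.mem_atlas).of_le le_top)
  exact hradial.comp x (hψ.contMDiffAt (ψ.open_source.mem_nhds hx))

lemma contMDiffAt_coneChart_symm (h : IsAdaptedChart D p ψ k hk σ) {w : Cn n}
    (hw : w ∈ (coneChart ψ b hb).target) (hwD : (coneChart ψ b hb).symm w ∉ ⋃ i, D i) :
    ContMDiffAt 𝓘(ℝ, Cn n) 𝓘(ℝ, Cn n) 1 (coneChart ψ b hb).symm w := by
  have hz := mem_coneChart_target.1 hw
  have hradial : ContMDiffAt 𝓘(ℝ, Cn n) 𝓘(ℝ, Cn n) 1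
      (radialMap fun j ↦ (coneExponent n k b j)⁻¹) w := by
    refine (contDiffAt_radialMap fun j ↦ ?_).contMDiffAt
    refine (h.ne_zero_or_coneExponent_eq_one b hz hwD j).imp (fun hne hzero ↦ hne ?_)
      inv_eq_one.2
    rw [radialMap_apply, hzero, radial_zero]
  have hψ : ContMDiffOn 𝓘(ℝ, Cn n) 𝓘(ℝ, Cn n) 1 ψ.symm ψ.target := contMDiffOn_real_of_complex
    ((contMDiffOn_symm_of_mem_maximalAtlas h.mem_atlas).of_le le_top)
  exact ContMDiffAt.comp (g := ψ.symm) w (hψ.contMDiffAt (ψ.open_target.mem_nhds hz)) hradial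

lemma pullbackMetric_symm_eq_coneChart (h : IsAdaptedChart D p ψ k hk σ) (hb : ∀ i, 0 < b i)
    {z : Cn n} (hz : z ∈ ψ.target) (hzD : ψ.symm z ∉ ⋃ i, D i) :
    pullbackMetric g ψ.symm z =
      (pullbackMetric g (coneChart ψ b hb).symm (radialMap (coneExponent n k b) z)).bilinearComp
        (fderiv ℝ (radialMap (coneExponent n k b)) z)
        (fderiv ℝ (radialMap (coneExponent n k b)) z) := by
  have hinv (y : Cn n) : radialMap (fun j ↦ (coneExponent n k b j)⁻¹)
      (radialMap (coneExponent n k b) y) = y :=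
    (radialHomeomorph (coneExponent n k b) (coneExponent_pos hb)).symm_apply_apply y
  have hsymm (y : Cn n) :
      (coneChart ψ b hb).symm (radialMap (coneExponent n k b) y) = ψ.symm y :=
    congrArg ψ.symm (hinv y)
  have hw : radialMap (coneExponent n k b) z ∈ (coneChart ψ b hb).target := by
    rwa [mem_coneChart_target, hinv]
  exact pullbackMetric_comp (F := radialMap (coneExponent n k b))
    (Eventually.of_forall fun y ↦ (hsymm y).symm)
    ((h.contMDiffAt_coneChart_symm hw (by rwa [hsymm])).mdifferentiableAt one_ne_zero)
    ((contDiffAt_radialMap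
      (h.ne_zero_or_coneExponent_eq_one b hz hzD)).differentiableAt one_ne_zero)

lemma pullbackMetric_coneChart_bounds (h : IsAdaptedChart D p ψ k hk σ) (hb0 : ∀ i, 0 < b i)
    (hb1 : ∀ i, b i ≤ 1) {c C : ℝ} (hc0 : 0 < c) (hc : ∀ j, c ≤ coneExponent n k b j ^ 2)
    (hC : 0 < C)
    (hg : ∀ z ∈ ψ.target, ψ.symm z ∉ ⋃ i, D i → ∀ v : Cn n,
        C⁻¹ * modelConeMetric n k b z v ≤ pullbackMetric g ψ.symm z v v ∧
        pullbackMetric g ψ.symm z v v ≤ C * modelConeMetric n k b z v)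
    {w : Cn n} (hw : w ∈ (coneChart ψ b hb0).target)
    (hwD : (coneChart ψ b hb0).symm w ∉ ⋃ i, D i) (v : Cn n) :
    ‖v‖ ^ 2 ≤ C * pullbackMetric g (coneChart ψ b hb0).symm w v v ∧
      pullbackMetric g (coneChart ψ b hb0).symm w v v ≤ C / c * ‖v‖ ^ 2 := by
  have he0 : ∀ j : Fin n, 0 < coneExponent n k b j := coneExponent_pos hb0
  have he1 : ∀ j : Fin n, coneExponent n k b j ≤ 1 := coneExponent_le_one hb1
  obtain ⟨z, rfl⟩ := (radialHomeomorph _ he0).surjective w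
  have hinv : radialMap (fun j ↦ (coneExponent n k b j)⁻¹) (radialMap (coneExponent n k b) z) = z :=
    (radialHomeomorph _ he0).symm_apply_apply z
  have hz : z ∈ ψ.target := by
    have := mem_coneChart_target.1 hw
    rwa [show radialHomeomorph _ he0 z = radialMap (coneExponent n k b) z from rfl, hinv] at this
  have hzD : ψ.symm z ∉ ⋃ i, D i := by
    have : (coneChart ψ b hb0).symm (radialHomeomorph _ he0 z) = ψ.symm z := congrArg ψ.symm hinv
    rwa [this] at hwD
  have hne := h.ne_zero_or_coneExponent_eq_one b hz hzD
  obtain ⟨u, rfl⟩ := surjective_fderiv_radialMap he0 he1 hne v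
  obtain ⟨hlow, hup⟩ := norm_fderiv_radialMap_bounds he0 he1 hc hne u
  obtain ⟨hglow, hgup⟩ := hg z hz hzD u
  rw [← modelConeMetric_eq_sum] at hlow hup
  rw [h.pullbackMetric_symm_eq_coneChart hb0 hz hzD, ContinuousLinearMap.bilinearComp_apply]
    at hglow hgup
  refine ⟨hup.trans ((inv_mul_le_iff₀ hC).1 hglow), hgup.trans ?_⟩
  calc C * modelConeMetric n k b z u = C / c * (c * modelConeMetric n k b z u) := by field_simp
    _ ≤ C / c * ‖fderiv ℝ (radialMap (coneExponent n k b)) z u‖ ^ 2 := by gcongr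

lemma exists_isConeChart (h : IsAdaptedChart D p ψ k hk σ) (hb0 : ∀ i, 0 < b i)
    (hb1 : ∀ i, b i ≤ 1) {C : ℝ} (hC : 1 ≤ C)
    (hg : ∀ z ∈ ψ.target, ψ.symm z ∉ ⋃ i, D i → ∀ v : Cn n,
        C⁻¹ * modelConeMetric n k b z v ≤ pullbackMetric g ψ.symm z v v ∧
        pullbackMetric g ψ.symm z v v ≤ C * modelConeMetric n k b z v) :
    ∃ L, 1 ≤ L ∧ ∃ Ψ : OpenPartialHomeomorph X (Cn n), IsConeChart g (⋃ i, D i) L Ψ ∧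
      p ∈ Ψ.source := by
  obtain ⟨c, hc, hc0⟩ : ∃ c : ℝ, (∀ j : Fin n, c ≤ coneExponent n k b j ^ 2) ∧ 0 < c :=
    ((eventually_all.2 fun j ↦ eventually_nhdsWithin_of_eventually_nhds
      (eventually_le_nhds (pow_pos (coneExponent_pos hb0 j) 2))).and
      (self_mem_nhdsWithin (s := Ioi 0))).exists
  have hC0 : 0 < C := by linarith
  set L := max C (C / c)
  have hL : 1 ≤ L := hC.trans (le_max_left _ _)
  have hLsq : L ≤ L ^ 2 := le_self_pow₀ hL two_ne_zero
  have hbounds (w : Cn n) (hw : w ∈ (coneChart ψ b hb0).target)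
      (hwD : (coneChart ψ b hb0).symm w ∉ ⋃ i, D i) (v : Cn n) :=
    h.pullbackMetric_coneChart_bounds hb0 hb1 hc0 hc hC0 hg hw hwD v
  refine ⟨L, hL, coneChart ψ b hb0, ⟨fun x hx ↦ ?_, fun w hw ↦ ?_, fun w hw hwD v ↦ ?_,
    fun w hw hwD v ↦ ?_, {j | (j : ℕ) < k}, fun w hw ↦ h.coneChart_symm_mem_iUnion_iff hw⟩,
    by rw [coneChart_source]; exact h.mem_source⟩
  · have hxs : x ∈ ψ.source := by simpa only [coneChart_source] using hx.1
    exact (h.contMDiffAt_coneChart hxs hx.2).contMDiffWithinAt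
  · exact (h.contMDiffAt_coneChart_symm hw.1 hw.2).contMDiffWithinAt
  · have hnonneg := nonneg_of_mul_nonneg_right ((sq_nonneg ‖v‖).trans (hbounds w hw hwD v).1) hC0
    exact (hbounds w hw hwD v).1.trans
      (mul_le_mul_of_nonneg_right ((le_max_left _ _).trans hLsq) hnonneg)
  · exact (hbounds w hw hwD v).2.trans
      (mul_le_mul_of_nonneg_right ((le_max_right _ _).trans hLsq) (sq_nonneg _))

end IsAdaptedChart

end ConicalChart

section PositiveForms

variable {E : Type*} [NormedAddCommGroup E] [NormedSpace ℝ E] {B : E →L[ℝ] E →L[ℝ] ℝ}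

lemma abs_apply_apply_le_opNorm_mul_sq (B : E →L[ℝ] E →L[ℝ] ℝ) (v : E) :
    |B v v| ≤ ‖B‖ * ‖v‖ ^ 2 := by
  rw [sq, ← mul_assoc]
  exact B.le_opNorm₂ v v

lemma exists_pos_mul_norm_sq_le_apply_apply [FiniteDimensional ℝ E]
    (hB : ∀ v, v ≠ 0 → 0 < B v v) : ∃ c, 0 < c ∧ ∀ v, c * ‖v‖ ^ 2 ≤ B v v := by
  rcases subsingleton_or_nontrivial E with hE | hE
  · exact ⟨1, one_pos, fun v ↦ by simp [Subsingleton.elim v 0]⟩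
  obtain ⟨u, hu, hmin⟩ := (isCompact_sphere (0 : E) 1).exists_isMinOn
    (NormedSpace.sphere_nonempty.2 zero_le_one)
    (by fun_prop : Continuous fun v ↦ B v v).continuousOn
  refine ⟨B u u, hB u (ne_zero_of_mem_unit_sphere ⟨u, hu⟩), fun v ↦ ?_⟩
  rcases eq_or_ne v 0 with rfl | hv
  · simp
  have hunit : (‖v‖⁻¹ : ℝ) • v ∈ Metric.sphere (0 : E) 1 := by simp [norm_smul, hv]
  have hscale : B ((‖v‖⁻¹ : ℝ) • v) ((‖v‖⁻¹ : ℝ) • v) * ‖v‖ ^ 2 = B v v := by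
    simp only [map_smul, _root_.smul_apply, smul_eq_mul]
    field_simp
  rw [← hscale]
  exact mul_le_mul_of_nonneg_right (hmin hunit) (sq_nonneg _)

lemma exists_eventually_norm_sq_le_and_le_of_tendsto [FiniteDimensional ℝ E] {α : Type*}
    {l : Filter α} {G : α → E →L[ℝ] E →L[ℝ] ℝ} (hB : ∀ v, v ≠ 0 → 0 < B v v)
    (hG : Tendsto G l (𝓝 B)) :
    ∃ L : ℝ, 1 ≤ L ∧ ∀ᶠ a in l, ∀ v, ‖v‖ ^ 2 ≤ L ^ 2 * G a v v ∧ G a v v ≤ L ^ 2 * ‖v‖ ^ 2 := by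
  obtain ⟨c, hc, hcB⟩ := exists_pos_mul_norm_sq_le_apply_apply hB
  set L := max 1 (max (2 / c) (‖B‖ + c / 2))
  have hL : 1 ≤ L := le_max_left _ _
  have hLsq : L ≤ L ^ 2 := le_self_pow₀ hL two_ne_zero
  have hcL : 2 / c ≤ L ^ 2 := ((le_max_left _ _).trans (le_max_right _ _)).trans hLsq
  have hBL : ‖B‖ + c / 2 ≤ L ^ 2 := ((le_max_right _ _).trans (le_max_right _ _)).trans hLsq
  refine ⟨L, hL, ?_⟩
  filter_upwards [hG.eventually (Metric.ball_mem_nhds B (half_pos hc))] with a ha v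
  have hdiff : |G a v v - B v v| ≤ c / 2 * ‖v‖ ^ 2 :=
    (abs_apply_apply_le_opNorm_mul_sq (G a - B) v).trans
      (mul_le_mul_of_nonneg_right ((dist_eq_norm (G a) B).symm.trans_le (le_of_lt ha))
        (sq_nonneg _))
  have hlow : c / 2 * ‖v‖ ^ 2 ≤ G a v v := by linarith [(abs_le.1 hdiff).1, hcB v]
  have hup : G a v v ≤ (‖B‖ + c / 2) * ‖v‖ ^ 2 := by
    linarith [(abs_le.1 hdiff).2, le_of_abs_le (abs_apply_apply_le_opNorm_mul_sq B v)]
  refine ⟨?_, hup.trans (by gcongr)⟩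
  calc ‖v‖ ^ 2 = 2 / c * (c / 2 * ‖v‖ ^ 2) := by field_simp
    _ ≤ 2 / c * G a v v := by gcongr
    _ ≤ L ^ 2 * G a v v := mul_le_mul_of_nonneg_right hcL (le_trans (by positivity) hlow)

end PositiveForms

section LocalDiffeomorph

lemma exists_openPartialHomeomorph_of_isLocalHomeomorphOn {M N : Type*} [TopologicalSpace M]
    [TopologicalSpace N] [Nonempty M] {f : M → N} {s : Set M} (hf : IsLocalHomeomorphOn f s)
    (hs : IsOpen s) (hinj : InjOn f s) :
    ∃ e : OpenPartialHomeomorph M N, ⇑e = f ∧ e.source = s := by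
  have hopen : IsOpenMap (s.domRestrict f) := isOpenMap_iff_nhds_le.2 fun ⟨z, hz⟩ ↦ by
    calc 𝓝 (f z) = map f (map (↑) (𝓝 (⟨z, hz⟩ : s))) := by
          rw [map_nhds_subtype_coe_eq_nhds hz (hs.mem_nhds hz), hf.map_nhds_eq hz]
      _ ≤ map (s.domRestrict f) (𝓝 ⟨z, hz⟩) := le_rfl
  exact ⟨.ofContinuousOpenRestrict (hinj.bijOn_image.toPartialEquiv f s (f '' s))
    hf.continuousOn hopen hs, rfl, rfl⟩

variable {𝕜 E F H H' M N : Type*} [NontriviallyNormedField 𝕜] [NormedAddCommGroup E]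
  [NormedSpace 𝕜 E] [NormedAddCommGroup F] [NormedSpace 𝕜 F] [TopologicalSpace H]
  [TopologicalSpace H'] {I : ModelWithCorners 𝕜 E H} {J : ModelWithCorners 𝕜 F H'}
  [TopologicalSpace M] [ChartedSpace H M] [TopologicalSpace N] [ChartedSpace H' N]
  {m m' : ℕ∞ω} {f : M → N} {s : Set M}

lemma isLocalDiffeomorphOn_of_le (hf : IsLocalDiffeomorphOn I J m f s) (h : m' ≤ m) :
    IsLocalDiffeomorphOn I J m' f s := fun x ↦
  let ⟨Φ, hx, heq⟩ := hf x
  ⟨⟨Φ.toPartialEquiv, Φ.open_source, Φ.open_target, Φ.contMDiffOn_toFun.of_le h,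
    Φ.contMDiffOn_invFun.of_le h⟩, hx, heq⟩

lemma contMDiffOn_symm_of_isLocalDiffeomorphOn {e : OpenPartialHomeomorph M N}
    (he : IsLocalDiffeomorphOn I J m e e.source) : ContMDiffOn J I m e.symm e.target := by
  intro y hy
  have hloc := he ⟨e.symm y, e.map_target hy⟩
  have hsmooth := hloc.localInverse_contMDiffAt
  rw [e.right_inv hy] at hsmooth
  refine (hsmooth.congr_of_eventuallyEq ?_).contMDiffWithinAt
  filter_upwards [e.open_target.mem_nhds hy, (e.continuousAt_symm hy).eventually_mem
    (hloc.localInverse.open_target.mem_nhds hloc.localInverse_mem_target)] with w hw hwt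
  rw [← hloc.localInverse_left_inv hwt, e.right_inv hw]

end LocalDiffeomorph

section FreeActions

lemma exists_pos_mul_norm_le_norm_sub_of_free {E : Type*} [NormedAddCommGroup E]
    [NormedSpace ℂ E] [FiniteDimensional ℂ E] {Γ : Subgroup (E ≃ₗᵢ[ℂ] E)} [Finite Γ]
    (hfree : ∀ γ ∈ Γ, γ ≠ 1 → ∀ z, z ≠ 0 → γ z ≠ z) :
    ∃ δ : ℝ, 0 < δ ∧ ∀ γ ∈ Γ, γ ≠ 1 → ∀ z, δ * ‖z‖ ≤ ‖γ z - z‖ := by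
  have hsingle (γ : Γ) : ∀ᶠ δ in 𝓝[>] (0 : ℝ), (γ : E ≃ₗᵢ[ℂ] E) ≠ 1 →
      ∀ z, δ * ‖z‖ ≤ ‖(γ : E ≃ₗᵢ[ℂ] E) z - z‖ := by
    by_cases hγ : (γ : E ≃ₗᵢ[ℂ] E) = 1
    · exact Eventually.of_forall fun _ hne ↦ (hne hγ).elim
    let f : E →ₗ[ℂ] E := ((γ : E ≃ₗᵢ[ℂ] E).toLinearEquiv : E →ₗ[ℂ] E) - LinearMap.id
    have hf (z : E) : f z = (γ : E ≃ₗᵢ[ℂ] E) z - z := rfl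
    have hker : LinearMap.ker f = ⊥ := LinearMap.ker_eq_bot'.2 fun z hz ↦
      by_contra fun hz0 ↦ hfree γ γ.2 hγ z hz0 (sub_eq_zero.1 (hf z ▸ hz))
    obtain ⟨K, hK, hanti⟩ := f.exists_antilipschitzWith hker
    filter_upwards [Ioo_mem_nhdsGT (inv_pos.2 (NNReal.coe_pos.2 hK))] with δ hδ _ z
    have hbound : ‖z‖ ≤ K * ‖(γ : E ≃ₗᵢ[ℂ] E) z - z‖ := by
      simpa only [hf, map_zero, sub_zero, dist_zero_right] using hanti.le_mul_dist z 0
    calc δ * ‖z‖ ≤ (K : ℝ)⁻¹ * ‖z‖ := mul_le_mul_of_nonneg_right hδ.2.le (norm_nonneg _)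
      _ ≤ ‖(γ : E ≃ₗᵢ[ℂ] E) z - z‖ := (inv_mul_le_iff₀ (NNReal.coe_pos.2 hK)).2 hbound
  obtain ⟨δ, hδ, hδ0⟩ := ((eventually_all.2 hsingle).and self_mem_nhdsWithin).exists
  exact ⟨δ, hδ0, fun γ hγ ↦ hδ ⟨γ, hγ⟩⟩

end FreeActions

lemma eventually_cobounded_forall_mem_ball {M : Type*} [PseudoMetricSpace M] {p : M → Prop}
    (h : ∀ᶠ z in Bornology.cobounded M, p z) (r : ℝ) :
    ∀ᶠ z in Bornology.cobounded M, ∀ w ∈ Metric.ball z r, p w := by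
  have hbdd : Bornology.IsBounded {z | ¬p z} :=
    Bornology.isBounded_def.2 (h.mono fun _ hz hnot ↦ hnot hz)
  filter_upwards [Bornology.isBounded_def.1 (hbdd.thickening (δ := r))] with z hz w hw
  by_contra hpw
  exact hz (Metric.mem_thickening_iff.2 ⟨w, hpw, dist_comm w z ▸ hw⟩)

section Atlas

variable {n : ℕ} {X : Type*} [TopologicalSpace X] [ChartedSpace (Cn n) X]
  {g : BilinField n X} {D : Set X}

lemma isConeChart_symm_of_forall_notMem {E : OpenPartialHomeomorph (Cn n) X} {L : ℝ}
    (hE : ContMDiffOn 𝓘(ℝ, Cn n) 𝓘(ℝ, Cn n) 1 E E.source)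
    (hE' : ContMDiffOn 𝓘(ℝ, Cn n) 𝓘(ℝ, Cn n) 1 E.symm E.target) (hD : ∀ z ∈ E.source, E z ∉ D)
    (hg : ∀ z ∈ E.source, ∀ v, ‖v‖ ^ 2 ≤ L ^ 2 * pullbackMetric g E z v v ∧
      pullbackMetric g E z v v ≤ L ^ 2 * ‖v‖ ^ 2) :
    IsConeChart g D L E.symm where
  contMDiffOn := hE'.mono inter_subset_left
  contMDiffOn_symm := hE.mono inter_subset_left
  le_pullback z hz _ v := (hg z hz v).1
  pullback_le z hz _ v := (hg z hz v).2
  divisor := ⟨∅, fun z hz ↦ ⟨fun hzD ↦ (hD z hz hzD).elim, fun ⟨_, hj, _⟩ ↦ hj.elim⟩⟩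

lemma IsContinuousMetricOn.exists_isConeChart [IsManifold 𝓘(ℂ, Cn n) ω X]
    (hg : IsContinuousMetricOn g Dᶜ) (hD : IsClosed D) {p : X} (hp : p ∉ D) :
    ∃ L, 1 ≤ L ∧ ∃ Ψ : OpenPartialHomeomorph X (Cn n), IsConeChart g D L Ψ ∧ p ∈ Ψ.source := by
  set ψ := chartAt (Cn n) p
  have hps : p ∈ ψ.source := mem_chart_source _ p
  have hat : ψ ∈ IsManifold.maximalAtlas 𝓘(ℂ, Cn n) ω X := IsManifold.chart_mem_maximalAtlas p
  have hopen : IsOpen (ψ.target ∩ ψ.symm ⁻¹' Dᶜ) := ψ.isOpen_inter_preimage_symm hD.isOpen_compl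
  have hpU : ψ p ∈ ψ.target ∩ ψ.symm ⁻¹' Dᶜ :=
    ⟨ψ.map_source hps, by rwa [mem_preimage, ψ.left_inv hps]⟩
  obtain ⟨L, hL, hbounds⟩ := exists_eventually_norm_sq_le_and_le_of_tendsto (hg.pos ψ hat _ hpU)
    ((hg.continuousOn ψ hat).continuousAt (hopen.mem_nhds hpU))
  obtain ⟨N, hN, hNo, hpN⟩ := eventually_nhds_iff.1 ((hopen.eventually_mem hpU).and hbounds)
  refine ⟨L, hL, (ψ.symm.restrOpen N hNo).symm, isConeChart_symm_of_forall_notMem ?_ ?_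
    (fun z hz ↦ (hN z hz.2).1.2) fun z hz ↦ (hN z hz.2).2, hps, hpN⟩
  · exact (contMDiffOn_real_of_complex
      ((contMDiffOn_symm_of_mem_maximalAtlas hat).of_le le_top)).mono fun _ hz ↦ hz.1
  · exact (contMDiffOn_real_of_complex
      ((contMDiffOn_of_mem_maximalAtlas hat).of_le le_top)).mono fun _ hx ↦ hx.1

/-- `g` is asymptotically locally Euclidean at the `C⁰` level: as for `IsALE`, the covering of the
end of `X` by a neighbourhood of infinity of `ℂⁿ` is given by the map `Φ`, but `Φ^* g` is only
required to converge to the flat metric, at no particular rate and without its derivatives. -/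
def IsC0ALE (g : BilinField n X) : Prop :=
  ∃ (Γ : Subgroup (Cn n ≃ₗᵢ[ℂ] Cn n)) (R₀ : ℝ) (Φ : Cn n → X),
    Finite Γ ∧ (∀ γ ∈ Γ, γ ≠ 1 → ∀ z, z ≠ 0 → γ z ≠ z) ∧
    IsLocalDiffeomorphOn 𝓘(ℝ, Cn n) 𝓘(ℝ, Cn n) 1 Φ {z | R₀ < ‖z‖} ∧
    (∀ z w, R₀ < ‖z‖ → R₀ < ‖w‖ → (Φ z = Φ w ↔ ∃ γ ∈ Γ, γ z = w)) ∧
    map Φ (Bornology.cobounded (Cn n)) = cocompact X ∧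
    Tendsto (pullbackMetric g Φ) (Bornology.cobounded (Cn n)) (𝓝 (flatMetric n))

lemma IsALE.isC0ALE (h : IsALE g) : IsC0ALE g := by
  obtain ⟨K, Γ, R₀, Φ, -, hfin, hfree, hloc, -, hfib, hmap, ℓ, hℓ, hdecay⟩ := h
  refine ⟨Γ, R₀, Φ, hfin, hfree, isLocalDiffeomorphOn_of_le hloc (by norm_cast), hfib, hmap, ?_⟩
  have hrate :
      Tendsto (fun z : Cn n ↦ ‖z‖ ^ (-ℓ - (0 : ℕ))) (Bornology.cobounded (Cn n)) (𝓝 0) := by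
    simp only [Nat.cast_zero, sub_zero]
    exact (tendsto_rpow_neg_atTop hℓ).comp tendsto_norm_cobounded_atTop
  have hlim := (tendsto_zero_iff_norm_tendsto_zero.1 ((hdecay 0).trans_tendsto hrate))
  simp only [norm_iteratedFDeriv_zero] at hlim
  exact (tendsto_iff_norm_sub_tendsto_zero (E := Cn n →L[ℝ] Cn n →L[ℝ] ℝ)).2 hlim

lemma injOn_ball_of_fibers {N : Type*} {Γ : Subgroup (Cn n ≃ₗᵢ[ℂ] Cn n)} {Φ : Cn n → N}
    {R₀ δ r : ℝ} {z₀ : Cn n} (hδ : ∀ γ ∈ Γ, γ ≠ 1 → ∀ z, δ * ‖z‖ ≤ ‖γ z - z‖)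
    (hfib : ∀ z w, R₀ < ‖z‖ → R₀ < ‖w‖ → Φ z = Φ w → ∃ γ ∈ Γ, γ z = w)
    (hball : ∀ z ∈ Metric.ball z₀ r, R₀ < ‖z‖ ∧ 2 * r < δ * ‖z‖) : InjOn Φ (Metric.ball z₀ r) := by
  intro z hz w hw hzw
  obtain ⟨γ, hγ, rfl⟩ := hfib z w (hball z hz).1 (hball w hw).1 hzw
  by_cases hone : γ = 1
  · rw [hone]
    rfl
  have hfar : 2 * r < dist (γ z) z :=
    (hball z hz).2.trans_le ((hδ γ hγ hone z).trans_eq (dist_eq_norm _ _).symm)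
  linarith [dist_triangle_right (γ z) z z₀, Metric.mem_ball.1 hz, Metric.mem_ball.1 hw]

lemma IsC0ALE.exists_isConeChart (h : IsC0ALE g) (hD : IsCompact D) :
    ∃ L, 1 ≤ L ∧ ∀ᶠ x in cocompact X, ∃ Ψ : OpenPartialHomeomorph X (Cn n),
      IsConeChart g D L Ψ ∧ x ∈ Ψ.source ∧ Metric.ball (Ψ x) 1 ⊆ Ψ.target := by
  obtain ⟨Γ, R₀, Φ, hfin, hfree, hloc, hfib, hmap, hlim⟩ := h
  obtain ⟨δ, hδ, hδΓ⟩ := exists_pos_mul_norm_le_norm_sub_of_free hfree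
  have hpos (v : Cn n) (hv : v ≠ 0) : 0 < flatMetric n v v := real_inner_self_pos.2 hv
  obtain ⟨L, hL, hbounds⟩ := exists_eventually_norm_sq_le_and_le_of_tendsto hpos hlim
  have hnorm : Tendsto (norm : Cn n → ℝ) (Bornology.cobounded (Cn n)) atTop :=
    tendsto_norm_cobounded_atTop
  have hnotMem : ∀ᶠ z in Bornology.cobounded (Cn n), Φ z ∉ D :=
    (show Tendsto Φ _ _ from hmap.le).eventually hD.compl_mem_cocompact
  refine ⟨L, hL, ?_⟩
  rw [← hmap, eventually_map]
  filter_upwards [eventually_cobounded_forall_mem_ball (((hnorm.eventually_gt_atTop R₀).and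
    ((hnorm.const_mul_atTop hδ).eventually_gt_atTop (2 * 1))).and (hbounds.and hnotMem)) 1]
    with z₀ hball
  have hloc₀ : IsLocalDiffeomorphOn 𝓘(ℝ, Cn n) 𝓘(ℝ, Cn n) 1 Φ (Metric.ball z₀ 1) :=
    fun z ↦ hloc ⟨z, (hball z z.2).1.1⟩
  obtain ⟨E, rfl, hEs⟩ := exists_openPartialHomeomorph_of_isLocalHomeomorphOn
    hloc₀.isLocalHomeomorphOn Metric.isOpen_ball
    (injOn_ball_of_fibers hδΓ (fun z w hz hw ↦ (hfib z w hz hw).1) fun z hz ↦ (hball z hz).1)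
  rw [← hEs] at hball hloc₀
  have hz₀ : z₀ ∈ E.source := hEs ▸ Metric.mem_ball_self one_pos
  refine ⟨E.symm, isConeChart_symm_of_forall_notMem hloc₀.contMDiffOn
    (contMDiffOn_symm_of_isLocalDiffeomorphOn hloc₀) (fun z hz ↦ (hball z hz).2.2)
    fun z hz ↦ (hball z hz).2.1, E.map_source hz₀, ?_⟩
  rw [E.left_inv hz₀, ← hEs]
  rfl

/-- The points of `S` are centres of cone charts of a common distortion and a common size. -/
def HasUniformConeChartsOn (g : BilinField n X) (D S : Set X) : Prop :=
  ∃ L, 1 ≤ L ∧ ∃ ρ, 0 < ρ ∧ ∀ x ∈ S, ∃ Ψ : OpenPartialHomeomorph X (Cn n),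
    IsConeChart g D L Ψ ∧ x ∈ Ψ.source ∧ Metric.ball (Ψ x) ρ ⊆ Ψ.target

namespace HasUniformConeChartsOn

variable {S T : Set X}

lemma mono (h : HasUniformConeChartsOn g D T) (hST : S ⊆ T) : HasUniformConeChartsOn g D S :=
  let ⟨L, hL, ρ, hρ, hT⟩ := h
  ⟨L, hL, ρ, hρ, fun x hx ↦ hT x (hST hx)⟩

lemma union (hS : HasUniformConeChartsOn g D S) (hT : HasUniformConeChartsOn g D T) :
    HasUniformConeChartsOn g D (S ∪ T) := by
  obtain ⟨L, hL, ρ, hρ, hS⟩ := hS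
  obtain ⟨L', hL', ρ', hρ', hT⟩ := hT
  refine ⟨max L L', hL.trans (le_max_left _ _), min ρ ρ', lt_min hρ hρ', ?_⟩
  rintro x (hx | hx)
  · obtain ⟨Ψ, hΨ, hxs, hball⟩ := hS x hx
    exact ⟨Ψ, hΨ.mono (by linarith) (le_max_left _ _), hxs,
      (Metric.ball_subset_ball (min_le_left _ _)).trans hball⟩
  · obtain ⟨Ψ, hΨ, hxs, hball⟩ := hT x hx
    exact ⟨Ψ, hΨ.mono (by linarith) (le_max_right _ _), hxs,
      (Metric.ball_subset_ball (min_le_right _ _)).trans hball⟩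

end HasUniformConeChartsOn

lemma IsConeChart.exists_mem_nhds_hasUniformConeChartsOn {L : ℝ} {p : X}
    {Ψ : OpenPartialHomeomorph X (Cn n)} (h : IsConeChart g D L Ψ) (hL : 1 ≤ L)
    (hp : p ∈ Ψ.source) : ∃ S ∈ 𝓝 p, HasUniformConeChartsOn g D S := by
  obtain ⟨ρ, hρ, hball⟩ := Metric.isOpen_iff.1 Ψ.open_target _ (Ψ.map_source hp)
  refine ⟨Ψ.source ∩ Ψ ⁻¹' Metric.ball (Ψ p) (ρ / 2),
    (Ψ.isOpen_inter_preimage Metric.isOpen_ball).mem_nhds ⟨hp, Metric.mem_ball_self (half_pos hρ)⟩,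
    L, hL, ρ / 2, half_pos hρ, fun x hx ↦ ⟨Ψ, h, hx.1, (Metric.ball_subset_ball' ?_).trans hball⟩⟩
  linarith [Metric.mem_ball.1 hx.2]

lemma hasUniformConeChartsOn_of_isCompact {K : Set X} (hK : IsCompact K)
    (hlocal : ∀ p ∈ K, ∃ L, 1 ≤ L ∧ ∃ Ψ : OpenPartialHomeomorph X (Cn n), IsConeChart g D L Ψ ∧
      p ∈ Ψ.source) : HasUniformConeChartsOn g D K := by
  refine hK.induction_on ⟨1, le_rfl, 1, one_pos, fun x hx ↦ hx.elim⟩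
    (fun _ _ hst ht ↦ ht.mono hst) (fun _ _ ↦ .union) fun p hp ↦ ?_
  obtain ⟨L, hL, Ψ, hΨ, hps⟩ := hlocal p hp
  obtain ⟨S, hS, hunif⟩ := hΨ.exists_mem_nhds_hasUniformConeChartsOn hL hps
  exact ⟨S, mem_nhdsWithin_of_mem_nhds hS, hunif⟩

lemma IsC0ALE.exists_hasUniformConeCharts (h : IsC0ALE g) (hD : IsCompact D)
    (hlocal : ∀ p, ∃ L, 1 ≤ L ∧ ∃ Ψ : OpenPartialHomeomorph X (Cn n), IsConeChart g D L Ψ ∧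
      p ∈ Ψ.source) :
    ∃ L, 1 ≤ L ∧ ∃ ρ, 0 < ρ ∧ HasUniformConeCharts g D L ρ := by
  obtain ⟨L, hL, hend⟩ := h.exists_isConeChart hD
  obtain ⟨K, hK, hKend⟩ := mem_cocompact.1 hend
  obtain ⟨L', hL', ρ, hρ, hall⟩ := (hasUniformConeChartsOn_of_isCompact hK fun p _ ↦ hlocal p).union
    (T := Kᶜ) ⟨L, hL, 1, one_pos, fun x hx ↦ hKend hx⟩
  exact ⟨L', hL', ρ, hρ, fun x ↦ hall x (union_compl_self K ▸ mem_univ x)⟩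

lemma IsKahlerMetricOn.isContinuousMetricOn {U : Set X} (h : IsKahlerMetricOn g U) :
    IsContinuousMetricOn g U where
  symm := h.symm
  pos := h.pos
  continuousOn ψ hψ := (h.smooth ψ hψ).continuousOn

/-- `g` has conical singularities of cone angles `2π βᵢ` along the `Dᵢ`: near every point of
`⋃ Dᵢ` there are adapted coordinates in which it is comparable to the model cone metric. -/
def IsConicalAlong {ι : Type*} (D : ι → Set X) (β : ι → ℝ) (g : BilinField n X) : Prop :=
  ∀ p ∈ ⋃ i, D i, ∃ (ψ : OpenPartialHomeomorph X (Cn n)) (k : ℕ) (hk : k ≤ n) (σ : Fin k → ι),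
    IsAdaptedChart D p ψ k hk σ ∧ ∃ C : ℝ, 1 < C ∧
      ∀ z ∈ ψ.target, ψ.symm z ∉ ⋃ i, D i → ∀ v : Cn n,
        C⁻¹ * modelConeMetric n k (β ∘ σ) z v ≤ pullbackMetric g ψ.symm z v v ∧
        pullbackMetric g ψ.symm z v v ≤ C * modelConeMetric n k (β ∘ σ) z v

end Atlas

theorem proposition3p3_general {n : ℕ} {X : Type*} [TopologicalSpace X] [ChartedSpace (Cn n) X]
    [IsManifold 𝓘(ℂ, Cn n) ω X] [T2Space X] [SecondCountableTopology X]
    [PreconnectedSpace X] [MeasurableSpace X] [BorelSpace X]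
    {ι : Type*} {D : ι → Set X} (hD : IsCompact (⋃ i, D i))
    {β : ι → ℝ} (hβ : ∀ i, β i ∈ Ioc (0 : ℝ) 1)
    {g : BilinField n X} (hg : IsContinuousMetricOn g (⋃ i, D i)ᶜ) (hcone : IsConicalAlong D β g)
    (hale : IsC0ALE g) :
    Continuous (fun p : X × X ↦ conicalDist g (⋃ i, D i) p.1 p.2) ∧
    LocalPoincare12 (conicalDist g (⋃ i, D i)) (conicalMeasure g (⋃ i, D i)) := by
  have hDc : IsClosed (⋃ i, D i) := hD.isClosed
  obtain ⟨L, hL, ρ, hρ, hu⟩ := hale.exists_hasUniformConeCharts hD fun p ↦ by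
    by_cases hp : p ∈ ⋃ i, D i
    · obtain ⟨ψ, k, hk, σ, hψ, C, hC, hbounds⟩ := hcone p hp
      exact hψ.exists_isConeChart (fun i ↦ (hβ (σ i)).1) (fun i ↦ (hβ (σ i)).2) hC.le hbounds
    · exact hg.exists_isConeChart hDc hp
  exact ⟨hu.continuous_conicalDist hDc (one_pos.trans_le hL) hρ,
    (hu.hasBoundedGeometry hDc hL hρ hg).localPoincare12⟩

theorem proposition3p3 {n : ℕ} {X : Type*} [TopologicalSpace X] [ChartedSpace (Cn n) X]
    [IsManifold 𝓘(ℂ, Cn n) ω X] [T2Space X] [SecondCountableTopology X]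
    [ConnectedSpace X] [NoncompactSpace X] [MeasurableSpace X] [BorelSpace X]
    {ι : Type*} [Finite ι] (D : ι → Set X) (hD : IsCompactSNCDivisor n D)
    (β : ι → ℝ) (hβ : ∀ i, β i ∈ Ioo (0 : ℝ) 1)
    (g : BilinField n X) (hg : IsALEConicalKahlerMetric D β g) :
    Continuous (fun p : X × X ↦ conicalDist g (⋃ i, D i) p.1 p.2) ∧
    LocalPoincare12 (conicalDist g (⋃ i, D i)) (conicalMeasure g (⋃ i, D i)) :=
  proposition3p3_general hD.isCompact (fun i ↦ Ioo_subset_Ioc_self (hβ i))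
    hg.kahler.isContinuousMetricOn hg.conical hg.ale.isC0ALE

end
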